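/- **Model.** Let $V$ be a set of $n$ vertices with degrees $d(v)\ge 2$, $v\in V$, such that $\ell=\sum_{v}d(v)$ is even, and put $m=\ell/2$. Let $H$ be the set of half-edges, $d(v)$ of them being incident to $v$; $|H|=\ell$. Two distinct half-edges incident to the same vertex are called siblings. A configuration is a fixed-point free involution $\eta$ of $H$; its edges are the pairs $\{x,\eta(x)\}$. Let $2\le k\le m$ and $\alpha_n=k/m$. Given an initial configuration $C_0=\eta$ and half-edge $X_0=x$, at each time $t=1,2,\dots$: - $k$ edges of $C_{t-1}$ are chosen uniformly at random without replacement and cut; $R_t$ denotes the set of the resulting $2k$ half-edges; - these $2k$ half-edges are paired uniformly at random, which together with the edges that were kept gives $C_t$; - the walk jumps from $X_{t-1}$ to a uniformly chosen sibling $X_t$ of $C_t(X_{t-1})$. Write $\mathbb P_{\eta,x}$ for the law of this process, $R_{\le t}=R_1\cup\dots\cup R_t$, and let $$\tau=\min\{t\ge 1: X_{t-1}\in R_{\le t}\}$$ be the first time the walk moves along a previously rewired edge ($\tau = \infty$ if there is no such time). Let $U_H$ be the uniform distribution on $H$, let $\mu_n$ be the uniform distribution on pairs $(\eta,x)$ of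 a configuration and a half-edge, and let $\|\cdot\|_{\mathrm{TV}}$ be the total variation distance. **Proposition (closeness to stationarity and tail behaviour of the stopping time).** Consider a sequence of such models with $n\to\infty$, where all of the above may depend on $n$, and suppose that $\ell=\Theta(n)$, that $$\limsup_{n\to\infty}\ \frac{\sum_{v}d(v)(d(v)-1)}{\sum_v d(v)}<\infty ,$$ and that $\alpha_n(\log n)^2\to\infty$. Let $t=t(n)\in\mathbb N_0$ with $t(n)=o(\log n)$. Then there is a deterministic sequence $\varepsilon_n\to 0$ such that the $\mu_n$-probability of the set of pairs $(\eta,x)$ for which all three of the following hold tends to $1$ as $n\to\infty$: 1. $\|\mathbb P_{\eta,x}(X_t\in\cdot\mid \tau\le t)-U_H\|_{\mathrm{TV}}\le\varepsilon_n$, provided $t\ge 1$; 2. $\|\mathbb P_{\eta,x}(X_t\in\cdot\mid \tau> t)-U_H\|_{\mathrm{TV}}\ge 1-\varepsilon_n$, provided $\mathbb P_{\eta,x}(\tau>t)>0$; 3. $\bigl|\mathbb P_{\eta,x}(\tau>t)-(1-\alpha_n)^{t(t+1)/2}\bigr|\le\varepsilon_n$. -/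

import Mathlib

open Filter Topology Asymptotics

/-- Data of the dynamic configuration model on the vertex set `Fin n`: degrees `d v ≥ 2` with an even
sum `2m`, and the number `k` of edges rewired at each time step, `2 ≤ k ≤ m`. -/
structure DynConfModel (n : ℕ) where
  d : Fin n → ℕ
  k : ℕ
  two_le_d : ∀ v, 2 ≤ d v
  even_sum : Even (∑ v, d v)
  two_le_k : 2 ≤ k
  k_le : k ≤ (∑ v, d v) / 2

namespace DynConfModel

variable {n : ℕ} (M : DynConfModel n)

/-- Half-edges; the half-edge `x` is incident to the vertex `x.1`. -/
abbrev HalfEdge : Type := Σ v : Fin n, Fin (M.d v)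

/-- Number of half-edges. -/
def ell : ℕ := ∑ v, M.d v

/-- Number of edges. -/
def m : ℕ := M.ell / 2

/-- Proportion of edges rewired at each time step. -/
noncomputable def alpha : ℝ := (M.k : ℝ) / (M.m : ℝ)

/-- Expected degree `ν` of a uniformly chosen half-edge, the degree of `x` being `d (v(x)) - 1`. -/
noncomputable def nu : ℝ := (∑ x : M.HalfEdge, ((M.d x.1 : ℝ) - 1)) / (M.ell : ℝ)

/-- Configurations: fixed-point free involutions of the set of half-edges. -/
abbrev Conf : Type :=
  {η : Equiv.Perm M.HalfEdge // (∀ x, η (η x) = x) ∧ ∀ x, η x ≠ x}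

/-- The edges of a configuration. -/
def edges (η : M.Conf) : Finset (Sym2 M.HalfEdge) :=
  Finset.univ.image fun x => s(x, η.1 x)

/-- The half-edges obtained by cutting the edges in `E`. -/
def cut (E : Finset (Sym2 M.HalfEdge)) : Finset M.HalfEdge :=
  Finset.univ.filter fun x => ∃ e ∈ E, x ∈ e

/-- The configurations obtained from `η` by keeping the pairs outside `R` and pairing the half-edges
of `R` among themselves arbitrarily (used when `R` is a union of edges of `η`; a configuration that
agrees with `η` outside such an `R` automatically maps `R` to `R`). -/
def repairings (η : M.Conf) (R : Finset M.HalfEdge) : Finset M.Conf :=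
  Finset.univ.filter fun ζ => ∀ x, x ∉ R → ζ.1 x = η.1 x

/-- Siblings of a half-edge: the other half-edges at the same vertex. -/
def siblings (x : M.HalfEdge) : Finset M.HalfEdge :=
  Finset.univ.filter fun y => y.1 = x.1 ∧ y ≠ x

theorem card_edges (η : M.Conf) : (M.edges η).card = M.m := by
  have h1 : (Finset.univ : Finset M.HalfEdge).card = 2 * (M.edges η).card := by
    rw [Finset.card_eq_sum_card_image (fun x => s(x, η.1 x)) Finset.univ, mul_comm,
      ← smul_eq_mul]
    refine Finset.sum_const_nat ?_ |>.trans (by rfl)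
    intro e he
    obtain ⟨x, -, rfl⟩ := Finset.mem_image.1 he
    have : (Finset.univ.filter fun y => s(y, η.1 y) = s(x, η.1 x)) = {x, η.1 x} := by
      ext y
      simp only [Finset.mem_filter, Finset.mem_univ, true_and, Finset.mem_insert,
        Finset.mem_singleton, Sym2.eq_iff]
      constructor
      · rintro (h | h)
        · exact Or.inl h.1
        · exact Or.inr h.1
      · rintro (h | h)
        · subst h; exact Or.inl ⟨rfl, rfl⟩
        · subst h; exact Or.inr ⟨rfl, η.2.1 x⟩
    rw [this, Finset.card_pair (η.2.2 x).symm]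
  have h2 : (Finset.univ : Finset M.HalfEdge).card = M.ell := by
    simp [ell]
  unfold m
  omega

theorem edgeChoices_nonempty (η : M.Conf) : ((M.edges η).powersetCard M.k).Nonempty :=
  Finset.powersetCard_nonempty.2 (by rw [card_edges]; exact M.k_le)

theorem repairings_nonempty (η : M.Conf) (R : Finset M.HalfEdge) : (M.repairings η R).Nonempty :=
  ⟨η, by simp [repairings]⟩

theorem siblings_nonempty (x : M.HalfEdge) : (M.siblings x).Nonempty := by
  obtain ⟨v, a⟩ := x
  have : Nontrivial (Fin (M.d v)) := Fin.nontrivial_iff_two_le.2 (M.two_le_d v)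
  obtain ⟨b, hb⟩ := exists_ne a
  exact ⟨⟨v, b⟩, by simp [siblings, hb]⟩

/-- State at time `s`: the configuration `C_s`, the set `R_s` of half-edges rewired at time `s`, and
the position `X_s` of the walk. -/
abbrev State : Type := M.Conf × Finset M.HalfEdge × M.HalfEdge

/-- One time step from configuration `ξ` and position `y`: choose `k` edges of `ξ` uniformly, cut
them, pair the resulting half-edges uniformly to get the new configuration `ζ`, and then let the
walk jump to a uniform sibling of `ζ y`. -/
noncomputable def step (ξ : M.Conf) (y : M.HalfEdge) : PMF M.State :=
  (PMF.uniformOfFinset _ (M.edgeChoices_nonempty ξ)).bind fun E =>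
    (PMF.uniformOfFinset _ (M.repairings_nonempty ξ (M.cut E))).bind fun ζ =>
      (PMF.uniformOfFinset _ (M.siblings_nonempty (ζ.1 y))).map fun z => (ζ, M.cut E, z)

/-- Trajectories up to time `t`. -/
abbrev Path (t : ℕ) : Type := Fin (t + 1) → M.State

/-- Law of the trajectory up to time `t` of the chain started from `(η, x)` (with `R_0 = ∅`). -/
noncomputable def pathLaw (η : M.Conf) (x : M.HalfEdge) : (t : ℕ) → PMF (M.Path t)
  | 0 => PMF.pure fun _ => (η, ∅, x)
  | t + 1 => (pathLaw η x t).bind fun w =>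
      (M.step (w (Fin.last t)).1 (w (Fin.last t)).2.2).map fun s =>
        (Fin.snoc w s : Fin (t + 2) → M.State)

variable {M}

/-- The set `R_s` of half-edges rewired at time `s`. -/
def Path.rewired {t : ℕ} (w : M.Path t) (s : Fin (t + 1)) : Finset M.HalfEdge := (w s).2.1

/-- The position `X_s` of the walk at time `s`. -/
def Path.pos {t : ℕ} (w : M.Path t) (s : Fin (t + 1)) : M.HalfEdge := (w s).2.2

/-- `R_{≤ s} = R_1 ∪ ⋯ ∪ R_s`. -/
def Path.rewiredUpTo {t : ℕ} (w : M.Path t) (s : Fin (t + 1)) : Set M.HalfEdge :=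
  {h | ∃ r : Fin (t + 1), 0 < r ∧ r ≤ s ∧ h ∈ Path.rewired w r}

/-- The first time `s ≥ 1` with `X_{s-1} ∈ R_{≤ s}`, and `⊤` if there is none up to the horizon `t`
of the trajectory. The events `τ ≤ t` and `τ > t` depend on the trajectory up to time `t` only. -/
noncomputable def Path.tau {t : ℕ} (w : M.Path t) : ℕ∞ :=
  sInf {r : ℕ∞ | ∃ s : Fin t,
    Path.pos w s.castSucc ∈ Path.rewiredUpTo w s.succ ∧ r = ((s : ℕ) + 1 : ℕ)}

variable (M)

/-- Probability, for the chain started from `(η, x)`, of an event determined by time `t`. -/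
noncomputable def prob (η : M.Conf) (x : M.HalfEdge) (t : ℕ) (A : Set (M.Path t)) : ℝ :=
  ((M.pathLaw η x t).toOuterMeasure A).toReal

/-- Conditional law of `X_t` given the event `A` (meaningful if `A` has positive probability). -/
noncomputable def condLaw (η : M.Conf) (x : M.HalfEdge) (t : ℕ) (A : Set (M.Path t)) :
    M.HalfEdge → ℝ :=
  fun y => M.prob η x t ({w | Path.pos w (Fin.last t) = y} ∩ A) / M.prob η x t A

/-- The uniform distribution on half-edges. -/
noncomputable def unif : M.HalfEdge → ℝ := fun _ => 1 / (M.ell : ℝ)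

/-- Measure of a set of initial conditions `(η, x)` under the uniform distribution `μ_n`. -/
noncomputable def initMeasure (S : Set (M.Conf × M.HalfEdge)) : ℝ :=
  (S.ncard : ℝ) / (Nat.card (M.Conf × M.HalfEdge) : ℝ)

end DynConfModel

/-- Total variation distance of two probability mass functions on a finite set. -/
noncomputable def tvDist {S : Type*} [Fintype S] (p q : S → ℝ) : ℝ :=
  (1 / 2) * ∑ x, |p x - q x|

open scoped BigOperators

namespace DynConfModel

variable {n : ℕ} (M : DynConfModel n)

/-! ### Half-edges, siblings and relabellings -/

/-! Until it crosses a rewired edge, the walk is the walk on the initial configuration `η`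
(`pathExp_alive`). Given its positions `x_0, …, x_{t-1}`, survival up to time `t` means that `x_j`
is not rewired at times `1, …, j + 1`. If these half-edges lie on distinct edges of `η`, then `t - r
+ 1` given edges must be kept at time `r`, and the product of the corresponding probabilities is
within `2t³/m` of `(1 - α)^(t(t+1)/2)` (`abs_prod_keepProb_sub_le`). An edge is used twice only if a
vertex is repeated, which for a uniform initial state has probability `O(t²(ν + 1)/ℓ)`
(`sum_revisit_le`). This is the third claim.

For the second claim, on survival `X_t` lies in the ball of radius `t` around the starting vertex in
`η`. By exchangeability the truncated mean size of this ball is at most of order `(ν + 1)(2ν + 3)^t`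
(`sum_min_ball_le`), which is `o(ℓ)` since `t = o(log n)`.

For the first claim, let `u` be the half-edge from which the walk first crosses a rewired edge, and
look at the last rewiring of `u`. If `ξ` is the configuration just before it, exchanging two edges
of `ξ` is an automorphism of `ξ`, so it commutes with the dynamics, even restricted to an event
about the half-edges of a small set `S`, provided that `S` is fixed. Hence the new partner of `u`
may be replaced by a uniform half-edge `b`, at the price of relabelling the later configuration on
the `ξ`-edges of `b` and of the actual partner (`symmetrization`). The later walk notices this only
if it uses one of these four half-edges. Two of them do not depend on `b`, and are rarely met from a
uniform start; meeting the `ξ`-edge of `b` from a sibling of `b` is once more a repetition of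
vertices (`sum_pow_returns_le`). The mean total error is `O(t⁴(1 + ν)/(αℓ))`; conditioning divides
it by `P(τ ≤ t) ≥ α`, and `1/α²` is at most `(log n)⁴` eventually.

The estimates for hitting and repetition are stated for lists of Markov operators on configurations,
so that they cover the static walk (operator `1`), the dynamic walk (`dyn`) and pauses (powers of
`dyn`). They use that these operators commute with relabelling and preserve the uniform
distribution, and that the partner map and the sibling jump preserve the counting measure on
half-edges. Markov's inequality finally turns bounds in mean into bounds for typical `(η, x)`. -/

theorem card_halfEdge : Fintype.card M.HalfEdge = M.ell := by
  simp [ell]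

theorem ell_eq : M.ell = 2 * M.m := by
  have h : Even M.ell := M.even_sum
  unfold m
  obtain ⟨r, hr⟩ := h
  omega

theorem k_le_m : M.k ≤ M.m := M.k_le

theorem m_pos : 0 < M.m := lt_of_lt_of_le (by have := M.two_le_k; omega) M.k_le_m

theorem ell_pos : 0 < M.ell := by
  have := M.m_pos
  have := M.ell_eq
  omega

theorem mem_siblings {x y : M.HalfEdge} : y ∈ M.siblings x ↔ y.1 = x.1 ∧ y ≠ x := by
  simp [siblings]

theorem card_siblings (x : M.HalfEdge) : (M.siblings x).card = M.d x.1 - 1 := by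
  have h : M.siblings x
      = (Finset.univ.image fun a : Fin (M.d x.1) => (⟨x.1, a⟩ : M.HalfEdge)).erase x := by
    ext y
    simp only [mem_siblings, Finset.mem_erase, Finset.mem_image, Finset.mem_univ, true_and]
    constructor
    · rintro ⟨h1, h2⟩
      refine ⟨h2, ?_⟩
      obtain ⟨v, a⟩ := y
      obtain ⟨w, b⟩ := x
      simp only at h1
      subst h1
      exact ⟨a, rfl⟩
    · rintro ⟨h2, a, rfl⟩
      exact ⟨rfl, h2⟩
  rw [h, Finset.card_erase_of_mem, Finset.card_image_of_injective]
  · simp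
  · intro a b hab
    simpa using hab
  · exact Finset.mem_image.2 ⟨x.2, Finset.mem_univ _, rfl⟩

/-- Average over the siblings of `z`. -/
noncomputable def savg (z : M.HalfEdge) (g : M.HalfEdge → ℝ) : ℝ :=
  𝔼 w ∈ M.siblings z, g w

variable {M}

theorem savg_mono {z : M.HalfEdge} {f g : M.HalfEdge → ℝ} (h : ∀ w ∈ M.siblings z, f w ≤ g w) :
    M.savg z f ≤ M.savg z g := Finset.expect_le_expect h

theorem savg_congr {z : M.HalfEdge} {f g : M.HalfEdge → ℝ} (h : ∀ w ∈ M.siblings z, f w = g w) :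
    M.savg z f = M.savg z g := Finset.expect_congr rfl h

theorem savg_const (z : M.HalfEdge) (c : ℝ) : M.savg z (fun _ => c) = c :=
  Finset.expect_const (M.siblings_nonempty z) c

theorem savg_nonneg {z : M.HalfEdge} {f : M.HalfEdge → ℝ} (h : ∀ w ∈ M.siblings z, 0 ≤ f w) :
    0 ≤ M.savg z f := Finset.expect_nonneg h

theorem savg_le {z : M.HalfEdge} {f : M.HalfEdge → ℝ} {c : ℝ} (h : ∀ w ∈ M.siblings z, f w ≤ c) :
    M.savg z f ≤ c := Finset.expect_le (M.siblings_nonempty z) h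

theorem savg_add (z : M.HalfEdge) (f g : M.HalfEdge → ℝ) :
    M.savg z (fun w => f w + g w) = M.savg z f + M.savg z g := Finset.expect_add_distrib _ _ _

theorem savg_sub (z : M.HalfEdge) (f g : M.HalfEdge → ℝ) :
    M.savg z (fun w => f w - g w) = M.savg z f - M.savg z g := Finset.expect_sub_distrib _ _ _

theorem savg_sum {ι : Type*} (s : Finset ι) (z : M.HalfEdge) (f : ι → M.HalfEdge → ℝ) :
    M.savg z (fun w => ∑ i ∈ s, f i w) = ∑ i ∈ s, M.savg z (f i) := Finset.expect_sum_comm _ _ _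

theorem savg_const_mul (z : M.HalfEdge) (c : ℝ) (f : M.HalfEdge → ℝ) :
    M.savg z (fun w => c * f w) = c * M.savg z f := (Finset.mul_expect _ _ _).symm

theorem abs_savg_le (z : M.HalfEdge) (f : M.HalfEdge → ℝ) :
    |M.savg z f| ≤ M.savg z (fun w => |f w|) := Finset.abs_expect_le _ _

/-- Being siblings is a symmetric relation and siblings have equally many siblings, so the jump
kernel is doubly stochastic. Together with `sum_conf`, every step of the walk preserves the counting
measure. -/
theorem sum_savg (g : M.HalfEdge → ℝ) : ∑ z, M.savg z g = ∑ w, g w := by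
  have h1 : ∀ z, M.savg z g
      = ∑ w, if w ∈ M.siblings z then g w / ((M.siblings w).card : ℝ) else 0 := by
    intro z
    rw [savg, Finset.expect_eq_sum_div_card, Finset.sum_div, Finset.sum_ite_mem, Finset.univ_inter]
    refine Finset.sum_congr rfl fun w hw => ?_
    rw [card_siblings, card_siblings, (M.mem_siblings.1 hw).1]
  simp_rw [h1]
  rw [Finset.sum_comm]
  refine Finset.sum_congr rfl fun w _ => ?_
  have h2 : (Finset.univ.filter fun z => w ∈ M.siblings z) = M.siblings w := by
    ext z
    simp only [Finset.mem_filter, Finset.mem_univ, true_and, mem_siblings]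
    exact ⟨fun h => ⟨h.1.symm, h.2.symm⟩, fun h => ⟨h.1.symm, h.2.symm⟩⟩
  rw [← Finset.sum_filter, h2, Finset.sum_const, nsmul_eq_mul]
  have h3 : ((M.siblings w).card : ℝ) ≠ 0 := by
    exact_mod_cast (Finset.card_pos.2 (M.siblings_nonempty w)).ne'
  field_simp

@[simp] theorem conf_conf (ξ : M.Conf) (x : M.HalfEdge) : ξ.1 (ξ.1 x) = x := ξ.2.1 x

theorem conf_ne (ξ : M.Conf) (x : M.HalfEdge) : ξ.1 x ≠ x := ξ.2.2 x

theorem conf_eq_iff (ξ : M.Conf) {x y : M.HalfEdge} : ξ.1 x = y ↔ ξ.1 y = x := by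
  constructor <;> rintro rfl <;> simp

theorem sum_conf (ξ : M.Conf) (g : M.HalfEdge → ℝ) : ∑ x, g (ξ.1 x) = ∑ x, g x :=
  Equiv.sum_comp ξ.1 g

/-- Relabelling of a configuration by a permutation of the half-edges. -/
def conj (π : Equiv.Perm M.HalfEdge) : M.Conf ≃ M.Conf where
  toFun ξ := ⟨π * ξ.1 * π⁻¹, fun x => by simp, fun x h => by
    have h' : ξ.1 (π⁻¹ x) = π⁻¹ x := by
      rw [Equiv.Perm.eq_inv_iff_eq]; simpa using h
    exact ξ.2.2 _ h'⟩
  invFun ξ := ⟨π⁻¹ * ξ.1 * π, fun x => by simp, fun x h => by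
    have h' : ξ.1 (π x) = π x := by
      rw [← Equiv.Perm.inv_eq_iff_eq]; simpa using h
    exact ξ.2.2 _ h'⟩
  left_inv ξ := by
    apply Subtype.ext; simp [mul_assoc]
  right_inv ξ := by
    apply Subtype.ext; simp [mul_assoc]

theorem conj_apply (π : Equiv.Perm M.HalfEdge) (ξ : M.Conf) (x : M.HalfEdge) :
    (conj π ξ).1 x = π (ξ.1 (π⁻¹ x)) := rfl

theorem conj_apply_perm (π : Equiv.Perm M.HalfEdge) (ξ : M.Conf) (x : M.HalfEdge) :
    (conj π ξ).1 (π x) = π (ξ.1 x) := by simp [conj_apply]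

theorem conj_apply_of_fixed {π : Equiv.Perm M.HalfEdge} (ξ : M.Conf) {x : M.HalfEdge}
    (h : π x = x) : (conj π ξ).1 x = π (ξ.1 x) := by
  conv_lhs => rw [← h]
  exact conj_apply_perm π ξ x

theorem conj_eq_self {π : Equiv.Perm M.HalfEdge} {ξ : M.Conf} (h : ∀ x, π (ξ.1 x) = ξ.1 (π x)) :
    conj π ξ = ξ := by
  apply Subtype.ext
  ext1 x
  rw [conj_apply, h]
  simp

/-! ### The sets of rewired half-edges -/

variable (M)

/-- The possible values of the set of rewired half-edges, given the configuration `ξ`. -/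
def rewirings (ξ : M.Conf) : Finset (Finset M.HalfEdge) :=
  Finset.univ.filter fun R => R.card = 2 * M.k ∧ ∀ x ∈ R, ξ.1 x ∈ R

variable {M}

theorem mem_rewirings {ξ : M.Conf} {R : Finset M.HalfEdge} :
    R ∈ M.rewirings ξ ↔ R.card = 2 * M.k ∧ ∀ x ∈ R, ξ.1 x ∈ R := by simp [rewirings]

theorem mem_repairings {ξ ζ : M.Conf} {R : Finset M.HalfEdge} :
    ζ ∈ M.repairings ξ R ↔ ∀ x, x ∉ R → ζ.1 x = ξ.1 x := by simp [repairings]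

theorem mem_edges {ξ : M.Conf} {e : Sym2 M.HalfEdge} :
    e ∈ M.edges ξ ↔ ∃ x, s(x, ξ.1 x) = e := by simp [edges]

theorem mem_cut_of_subset {ξ : M.Conf} {E : Finset (Sym2 M.HalfEdge)} (hE : E ⊆ M.edges ξ)
    {x : M.HalfEdge} : x ∈ M.cut E ↔ s(x, ξ.1 x) ∈ E := by
  simp only [cut, Finset.mem_filter, Finset.mem_univ, true_and]
  constructor
  · rintro ⟨e, he, hx⟩
    obtain ⟨y, rfl⟩ := mem_edges.1 (hE he)
    rcases Sym2.mem_iff.1 hx with rfl | rfl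
    · exact he
    · rwa [conf_conf, Sym2.eq_swap]
  · intro h
    exact ⟨_, h, Sym2.mem_mk_left _ _⟩

theorem cut_injOn (ξ : M.Conf) : Set.InjOn M.cut {E | E ⊆ M.edges ξ} := by
  intro E hE E' hE' h
  ext e
  constructor
  · intro he
    obtain ⟨x, rfl⟩ := mem_edges.1 (hE he)
    rwa [← mem_cut_of_subset hE', ← h, mem_cut_of_subset hE]
  · intro he
    obtain ⟨x, rfl⟩ := mem_edges.1 (hE' he)
    rwa [← mem_cut_of_subset hE, h, mem_cut_of_subset hE']

theorem card_cut {ξ : M.Conf} {E : Finset (Sym2 M.HalfEdge)} (hE : E ⊆ M.edges ξ) :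
    (M.cut E).card = 2 * E.card := by
  rw [Finset.card_eq_sum_card_fiberwise (f := fun x => s(x, ξ.1 x)) (t := E)
    (fun x hx => (mem_cut_of_subset hE).1 hx), mul_comm]
  refine Finset.sum_const_nat fun e he => ?_
  obtain ⟨x, rfl⟩ := mem_edges.1 (hE he)
  have : (M.cut E).filter (fun y => s(y, ξ.1 y) = s(x, ξ.1 x)) = {x, ξ.1 x} := by
    ext y
    simp only [Finset.mem_filter, Finset.mem_insert, Finset.mem_singleton, mem_cut_of_subset hE]
    constructor
    · rintro ⟨-, h⟩
      have : y ∈ s(x, ξ.1 x) := h ▸ Sym2.mem_mk_left _ _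
      simpa using this
    · rintro (rfl | rfl)
      · exact ⟨he, rfl⟩
      · rw [conf_conf, Sym2.eq_swap]
        exact ⟨he, rfl⟩
  rw [this, Finset.card_pair (conf_ne ξ x).symm]

theorem exists_cut_eq {ξ : M.Conf} {R : Finset M.HalfEdge} (hR : ∀ x ∈ R, ξ.1 x ∈ R) :
    ∃ E ⊆ M.edges ξ, M.cut E = R := by
  refine ⟨R.image fun x => s(x, ξ.1 x), ?_, ?_⟩
  · intro e he
    obtain ⟨x, -, rfl⟩ := Finset.mem_image.1 he
    exact mem_edges.2 ⟨x, rfl⟩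
  · ext x
    simp only [cut, Finset.mem_filter, Finset.mem_univ, true_and, Finset.mem_image]
    constructor
    · rintro ⟨e, ⟨y, hy, rfl⟩, hx⟩
      rcases Sym2.mem_iff.1 hx with rfl | rfl
      · exact hy
      · exact hR _ hy
    · intro hx
      exact ⟨_, ⟨x, hx, rfl⟩, Sym2.mem_mk_left _ _⟩

/-- Replaces the choice of `k` edges by the choice of an invariant set of `2k` half-edges. Cutting
is injective on sets of edges, so uniformity is preserved. -/
theorem image_cut (ξ : M.Conf) :
    ((M.edges ξ).powersetCard M.k).image M.cut = M.rewirings ξ := by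
  ext R
  simp only [Finset.mem_image, Finset.mem_powersetCard, mem_rewirings]
  constructor
  · rintro ⟨E, ⟨hE, hk⟩, rfl⟩
    refine ⟨by rw [card_cut hE, hk], fun x hx => ?_⟩
    rw [mem_cut_of_subset hE] at hx ⊢
    rwa [conf_conf, Sym2.eq_swap]
  · rintro ⟨hk, hR⟩
    obtain ⟨E, hE, rfl⟩ := exists_cut_eq hR
    rw [card_cut hE] at hk
    exact ⟨E, ⟨hE, by omega⟩, rfl⟩

theorem cut_injOn_powersetCard (ξ : M.Conf) :
    Set.InjOn M.cut ((M.edges ξ).powersetCard M.k : Set (Finset (Sym2 M.HalfEdge))) :=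
  (cut_injOn ξ).mono fun _ hE => (Finset.mem_powersetCard.1 hE).1

theorem card_rewirings (ξ : M.Conf) : (M.rewirings ξ).card = M.m.choose M.k := by
  rw [← image_cut, Finset.card_image_of_injOn (cut_injOn_powersetCard ξ),
    Finset.card_powersetCard, card_edges]

theorem rewirings_nonempty (ξ : M.Conf) : (M.rewirings ξ).Nonempty := by
  rw [← image_cut]
  exact (M.edgeChoices_nonempty ξ).image _

/-- The half-edges of `B` lie on distinct edges of `ξ`, so avoiding `B` excludes exactly `B.card` of
the `m` edges. -/
theorem card_rewirings_disjoint {ξ : M.Conf} {B : Finset M.HalfEdge}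
    (hB : ∀ x ∈ B, ξ.1 x ∉ B) :
    ((M.rewirings ξ).filter fun R => Disjoint R B).card = (M.m - B.card).choose M.k := by
  have hs : B.image (fun x => s(x, ξ.1 x)) ⊆ M.edges ξ := by
    intro e he
    obtain ⟨x, -, rfl⟩ := Finset.mem_image.1 he
    exact mem_edges.2 ⟨x, rfl⟩
  have hc : (B.image (fun x => s(x, ξ.1 x))).card = B.card := by
    refine Finset.card_image_of_injOn fun x hx y hy h => ?_
    rcases Sym2.eq_iff.1 h with h | h
    · exact h.1
    · exfalso
      apply hB _ hy
      rw [← h.1]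
      exact hx
  have h : (M.rewirings ξ).filter (fun R => Disjoint R B)
      = ((M.edges ξ \ B.image fun x => s(x, ξ.1 x)).powersetCard M.k).image M.cut := by
    ext R
    rw [← image_cut]
    simp only [Finset.mem_filter, Finset.mem_image, Finset.mem_powersetCard]
    constructor
    · rintro ⟨⟨E, ⟨hE, hk⟩, rfl⟩, hd⟩
      refine ⟨E, ⟨fun e he => Finset.mem_sdiff.2 ⟨hE he, fun hb => ?_⟩, hk⟩, rfl⟩
      obtain ⟨x, hx, rfl⟩ := Finset.mem_image.1 hb
      exact Finset.disjoint_left.1 hd ((mem_cut_of_subset hE).2 he) hx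
    · rintro ⟨E, ⟨hE, hk⟩, rfl⟩
      have hE' : E ⊆ M.edges ξ := hE.trans Finset.sdiff_subset
      refine ⟨⟨E, ⟨hE', hk⟩, rfl⟩, Finset.disjoint_left.2 fun x hx hxB => ?_⟩
      exact (Finset.mem_sdiff.1 (hE ((mem_cut_of_subset hE').1 hx))).2
        (Finset.mem_image_of_mem _ hxB)
  rw [h, Finset.card_image_of_injOn, Finset.card_powersetCard, Finset.card_sdiff_of_subset hs,
    card_edges, hc]
  exact (cut_injOn ξ).mono fun _ hE =>
    (Finset.mem_powersetCard.1 hE).1.trans Finset.sdiff_subset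

theorem map_mem_rewirings {π : Equiv.Perm M.HalfEdge} {ξ : M.Conf} {R : Finset M.HalfEdge} :
    R.map π.toEmbedding ∈ M.rewirings (conj π ξ) ↔ R ∈ M.rewirings ξ := by
  simp only [mem_rewirings, Finset.card_map, Finset.mem_map, Equiv.coe_toEmbedding,
    forall_exists_index, and_imp, forall_apply_eq_imp_iff₂, conj_apply_perm,
    EmbeddingLike.apply_eq_iff_eq, exists_eq_right]

theorem conj_mem_repairings {π : Equiv.Perm M.HalfEdge} {ξ ζ : M.Conf} {R : Finset M.HalfEdge} :
    conj π ζ ∈ M.repairings (conj π ξ) (R.map π.toEmbedding) ↔ ζ ∈ M.repairings ξ R := by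
  simp only [mem_repairings]
  constructor
  · intro h x hx
    have := h (π x) (by simpa using hx)
    rwa [conj_apply_perm, conj_apply_perm, EmbeddingLike.apply_eq_iff_eq] at this
  · intro h x hx
    rw [conj_apply, conj_apply, h]
    intro hx'
    exact hx (Finset.mem_map.2 ⟨_, hx', by simp⟩)

theorem repairings_congr {ξ ζ : M.Conf} {R : Finset M.HalfEdge} (h : ζ ∈ M.repairings ξ R) :
    M.repairings ζ R = M.repairings ξ R := by
  ext θ
  rw [mem_repairings] at h
  simp only [mem_repairings]
  exact forall₂_congr fun x hx => by rw [h x hx]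

theorem repairings_symm {ξ ζ : M.Conf} {R : Finset M.HalfEdge} :
    ζ ∈ M.repairings ξ R ↔ ξ ∈ M.repairings ζ R := by
  simp only [mem_repairings, eq_comm]

/-- Two involutions that agree off `R`, one of which preserves `R`, both preserve it. Thus a
rewiring step can be undone with the same `R`, which is what reversibility in `sum_ker` needs. -/
theorem mem_rewirings_of_repairings {ξ ζ : M.Conf} {R : Finset M.HalfEdge}
    (hR : R ∈ M.rewirings ξ) (h : ζ ∈ M.repairings ξ R) : R ∈ M.rewirings ζ := by
  rw [mem_rewirings] at hR ⊢
  refine ⟨hR.1, fun x hx => ?_⟩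
  by_contra hn
  rw [mem_repairings] at h
  have h1 := h _ hn
  rw [conf_conf, eq_comm, conf_eq_iff] at h1
  exact hn (h1 ▸ hR.2 x hx)

/-! ### The configuration kernel -/

/-- One step of the configuration dynamics, restricted to the event that the set of rewired
half-edges satisfies `c`. -/
noncomputable def ker (c : Finset M.HalfEdge → Prop) [DecidablePred c] :
    Module.End ℝ (M.Conf → ℝ) where
  toFun φ ξ := 𝔼 R ∈ M.rewirings ξ, if c R then 𝔼 ζ ∈ M.repairings ξ R, φ ζ else 0
  map_add' φ ψ := by
    ext ξ
    simp only [Pi.add_apply]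
    rw [← Finset.expect_add_distrib]
    refine Finset.expect_congr rfl fun R _ => ?_
    split_ifs
    · rw [Finset.expect_add_distrib]
    · simp
  map_smul' r φ := by
    ext ξ
    simp only [Pi.smul_apply, smul_eq_mul, RingHom.id_apply]
    rw [Finset.mul_expect]
    refine Finset.expect_congr rfl fun R _ => ?_
    split_ifs
    · rw [Finset.mul_expect]
    · simp

theorem ker_apply (c : Finset M.HalfEdge → Prop) [DecidablePred c] (φ : M.Conf → ℝ) (ξ : M.Conf) :
    ker c φ ξ = 𝔼 R ∈ M.rewirings ξ, if c R then 𝔼 ζ ∈ M.repairings ξ R, φ ζ else 0 := rfl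

theorem ker_mono {c c' : Finset M.HalfEdge → Prop} [DecidablePred c] [DecidablePred c']
    (hc : ∀ R, c R → c' R) {φ ψ : M.Conf → ℝ} (h : ∀ ζ, φ ζ ≤ ψ ζ) (h0 : ∀ ζ, 0 ≤ ψ ζ)
    (ξ : M.Conf) : ker c φ ξ ≤ ker c' ψ ξ := by
  rw [ker_apply, ker_apply]
  refine Finset.expect_le_expect fun R _ => ?_
  by_cases h1 : c R
  · rw [if_pos h1, if_pos (hc R h1)]
    exact Finset.expect_le_expect fun ζ _ => h ζ
  · rw [if_neg h1]
    split_ifs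
    · exact Finset.expect_nonneg fun ζ _ => h0 ζ
    · exact le_rfl

theorem ker_nonneg (c : Finset M.HalfEdge → Prop) [DecidablePred c] {φ : M.Conf → ℝ}
    (h : ∀ ζ, 0 ≤ φ ζ) (ξ : M.Conf) : 0 ≤ ker c φ ξ := by
  rw [ker_apply]
  refine Finset.expect_nonneg fun R _ => ?_
  split_ifs
  · exact Finset.expect_nonneg fun ζ _ => h ζ
  · exact le_rfl

theorem ker_congr {c : Finset M.HalfEdge → Prop} [DecidablePred c] {φ ψ : M.Conf → ℝ} {ξ : M.Conf}
    (h : ∀ R, c R → ∀ ζ, (∀ x, x ∉ R → ζ.1 x = ξ.1 x) → φ ζ = ψ ζ) : ker c φ ξ = ker c ψ ξ := by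
  rw [ker_apply, ker_apply]
  refine Finset.expect_congr rfl fun R _ => ?_
  split_ifs with hc
  · exact Finset.expect_congr rfl fun ζ hζ => h R hc ζ (mem_repairings.1 hζ)
  · rfl

/-- Cutting and pairing ignore the vertices, so a relabelling carries the choices of `R` and `ζ` to
choices of equal weight; only the restriction `c` could notice `π`. -/
theorem ker_conj {c : Finset M.HalfEdge → Prop} [DecidablePred c] {π : Equiv.Perm M.HalfEdge}
    (hc : ∀ R, c (R.map π.toEmbedding) ↔ c R) (φ : M.Conf → ℝ) (ξ : M.Conf) :
    ker c (fun ζ => φ (conj π ζ)) ξ = ker c φ (conj π ξ) := by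
  rw [ker_apply, ker_apply]
  refine Finset.expect_equiv (Equiv.finsetCongr π) (fun R => ?_) fun R _ => ?_
  · simp only [Equiv.finsetCongr_apply]
    exact map_mem_rewirings.symm
  · simp only [Equiv.finsetCongr_apply, hc]
    split_ifs
    · exact Finset.expect_equiv (conj π) (fun ζ => conj_mem_repairings.symm) fun _ _ => rfl
    · rfl

theorem ker_one (ξ : M.Conf) : ker (fun _ => True) (fun _ => 1) ξ = (1 : ℝ) := by
  rw [ker_apply]
  simp only [if_true]
  rw [Finset.expect_congr rfl fun R _ => Finset.expect_const (M.repairings_nonempty ξ R) (1 : ℝ)]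
  exact Finset.expect_const (rewirings_nonempty ξ) _

/-- Detailed balance: the number of admissible `R` does not depend on the configuration, and `ξ` and
`ζ` have the same repairings along `R`, so the transition weight is symmetric. -/
theorem sum_ker (φ : M.Conf → ℝ) : ∑ ξ, ker (fun _ => True) φ ξ = ∑ ξ, φ ξ := by
  have h1 : ∀ ξ, ker (fun _ => True) φ ξ = ∑ R, ∑ ζ,
      if R ∈ M.rewirings ξ ∧ ζ ∈ M.repairings ξ R then
        φ ζ / ((M.repairings ζ R).card : ℝ) / (M.m.choose M.k : ℝ) else 0 := by
    intro ξ
    rw [ker_apply, Finset.expect_eq_sum_div_card, Finset.sum_div, card_rewirings]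
    simp only [if_true]
    rw [← Finset.sum_subset (Finset.subset_univ (M.rewirings ξ))]
    · refine Finset.sum_congr rfl fun R hR => ?_
      rw [Finset.expect_eq_sum_div_card, Finset.sum_div, Finset.sum_div]
      rw [← Finset.sum_subset (Finset.subset_univ (M.repairings ξ R))]
      · refine Finset.sum_congr rfl fun ζ hζ => ?_
        rw [if_pos ⟨hR, hζ⟩, repairings_congr hζ]
      · intro ζ _ hζ
        rw [if_neg fun h => hζ h.2]
    · intro R _ hR
      exact Finset.sum_eq_zero fun ζ _ => if_neg fun h => hR h.1
  have h2 : ∀ (ξ ζ : M.Conf) R, (R ∈ M.rewirings ξ ∧ ζ ∈ M.repairings ξ R)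
      ↔ (R ∈ M.rewirings ζ ∧ ξ ∈ M.repairings ζ R) := fun ξ ζ R =>
    ⟨fun h => ⟨mem_rewirings_of_repairings h.1 h.2, repairings_symm.1 h.2⟩,
      fun h => ⟨mem_rewirings_of_repairings h.1 h.2, repairings_symm.1 h.2⟩⟩
  calc ∑ ξ, ker (fun _ => True) φ ξ
      = ∑ ξ, ∑ R, ∑ ζ, if R ∈ M.rewirings ζ ∧ ξ ∈ M.repairings ζ R then
        φ ζ / ((M.repairings ζ R).card : ℝ) / (M.m.choose M.k : ℝ) else 0 := by
        simp_rw [h1, h2]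
    _ = ∑ ζ, ∑ R, ∑ ξ, if R ∈ M.rewirings ζ ∧ ξ ∈ M.repairings ζ R then
        φ ζ / ((M.repairings ζ R).card : ℝ) / (M.m.choose M.k : ℝ) else 0 := by
        rw [Finset.sum_comm, Finset.sum_congr rfl fun R _ => Finset.sum_comm, Finset.sum_comm]
    _ = ∑ ζ, φ ζ := by
        refine Finset.sum_congr rfl fun ζ _ => ?_
        rw [← Finset.sum_subset (Finset.subset_univ (M.rewirings ζ))]
        · have : ∀ R ∈ M.rewirings ζ, (∑ ξ, if R ∈ M.rewirings ζ ∧ ξ ∈ M.repairings ζ R then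
              φ ζ / ((M.repairings ζ R).card : ℝ) / (M.m.choose M.k : ℝ) else 0)
              = φ ζ / (M.m.choose M.k : ℝ) := by
            intro R hR
            simp only [hR, true_and]
            rw [← Finset.sum_filter, Finset.sum_const, nsmul_eq_mul, Finset.filter_mem_eq_inter,
              Finset.univ_inter]
            have : ((M.repairings ζ R).card : ℝ) ≠ 0 := by
              exact_mod_cast (Finset.card_pos.2 (M.repairings_nonempty ζ R)).ne'
            field_simp
          rw [Finset.sum_congr rfl this, Finset.sum_const, nsmul_eq_mul, card_rewirings]
          have : (M.m.choose M.k : ℝ) ≠ 0 := by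
            exact_mod_cast (Nat.choose_pos M.k_le_m).ne'
          field_simp
        · intro R _ hR
          exact Finset.sum_eq_zero fun ζ _ => if_neg fun h => hR h.1

/-- Given that `u` is rewired, its new partner is `a` with probability at most `1 / (2k - 1)`. -/
theorem expect_repairings_partner_le {ξ : M.Conf} {R : Finset M.HalfEdge}
    (hR : R ∈ M.rewirings ξ) {u : M.HalfEdge} (hu : u ∈ R) (a : M.HalfEdge) :
    (𝔼 ζ ∈ M.repairings ξ R, if ζ.1 u = a then (1 : ℝ) else 0) ≤ 1 / (2 * M.k - 1) := by
  have hk : (0 : ℝ) < 2 * M.k - 1 := by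
    have : (2 : ℝ) ≤ M.k := by exact_mod_cast M.two_le_k
    linarith
  by_cases ha : a ∈ R.erase u
  · have hsym : ∀ b ∈ R.erase u, (𝔼 ζ ∈ M.repairings ξ R, if ζ.1 u = b then (1 : ℝ) else 0)
        = 𝔼 ζ ∈ M.repairings ξ R, if ζ.1 u = a then (1 : ℝ) else 0 := by
      intro b hb
      rw [Finset.mem_erase] at ha hb
      refine Finset.expect_equiv (conj (Equiv.swap a b)) (fun ζ => ?_) fun ζ _ => ?_
      · simp only [mem_repairings]
        have hfix : ∀ x, x ∉ R → Equiv.swap a b x = x := fun x hx =>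
          Equiv.swap_apply_of_ne_of_ne (fun h => hx (h ▸ ha.2)) fun h => hx (h ▸ hb.2)
        have hcl : ∀ x, x ∉ R → ξ.1 x ∉ R := fun x hx h => hx (by
          simpa using (mem_rewirings.1 hR).2 _ h)
        refine forall₂_congr fun x hx => ?_
        rw [conj_apply_of_fixed _ (hfix x hx)]
        conv_rhs => rw [← hfix _ (hcl x hx), EmbeddingLike.apply_eq_iff_eq]
      · rw [conj_apply_of_fixed _ (Equiv.swap_apply_of_ne_of_ne ha.1.symm hb.1.symm)]
        congr 1
        rw [eq_iff_iff, Equiv.swap_apply_eq_iff, Equiv.swap_apply_left]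
    have hsum : ∑ b ∈ R.erase u, (𝔼 ζ ∈ M.repairings ξ R, if ζ.1 u = b then (1 : ℝ) else 0)
        ≤ 1 := by
      rw [← Finset.expect_sum_comm]
      refine Finset.expect_le (M.repairings_nonempty ξ R) fun ζ _ => ?_
      rw [Finset.sum_ite_eq]
      split_ifs <;> norm_num
    rw [Finset.sum_congr rfl hsym, Finset.sum_const, nsmul_eq_mul, Finset.card_erase_of_mem hu,
      (mem_rewirings.1 hR).1] at hsum
    rw [le_div_iff₀ hk]
    have : ((2 * M.k - 1 : ℕ) : ℝ) = 2 * M.k - 1 := by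
      have := M.two_le_k
      push_cast [Nat.cast_sub (show 1 ≤ 2 * M.k by omega)]
      ring
    rw [this] at hsum
    linarith
  · rw [Finset.expect_eq_zero]
    · positivity
    · intro ζ hζ
      rw [if_neg]
      intro h
      apply ha
      rw [Finset.mem_erase, ← h]
      exact ⟨conf_ne ζ u, (mem_rewirings.1 (mem_rewirings_of_repairings hR hζ)).2 u hu⟩

/-! ### Equivariant Markov operators on configurations -/

theorem end_add (P : Module.End ℝ (M.Conf → ℝ)) (φ ψ : M.Conf → ℝ) (ξ : M.Conf) :
    P (fun ζ => φ ζ + ψ ζ) ξ = P φ ξ + P ψ ξ := by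
  change P (φ + ψ) ξ = _
  rw [map_add]
  rfl

theorem end_sub (P : Module.End ℝ (M.Conf → ℝ)) (φ ψ : M.Conf → ℝ) (ξ : M.Conf) :
    P (fun ζ => φ ζ - ψ ζ) ξ = P φ ξ - P ψ ξ := by
  change P (φ - ψ) ξ = _
  rw [map_sub]
  rfl

theorem end_const_mul (P : Module.End ℝ (M.Conf → ℝ)) (a : ℝ) (φ : M.Conf → ℝ) (ξ : M.Conf) :
    P (fun ζ => a * φ ζ) ξ = a * P φ ξ := by
  change P (a • φ) ξ = _
  rw [map_smul]
  rfl

theorem end_congr (P : Module.End ℝ (M.Conf → ℝ)) {φ ψ : M.Conf → ℝ} (h : ∀ ζ, φ ζ = ψ ζ)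
    (ξ : M.Conf) : P φ ξ = P ψ ξ := by
  rw [show φ = ψ from funext h]

theorem end_sum {ι : Type*} (P : Module.End ℝ (M.Conf → ℝ)) (s : Finset ι) (φ : ι → M.Conf → ℝ)
    (ξ : M.Conf) : P (fun ζ => ∑ i ∈ s, φ i ζ) ξ = ∑ i ∈ s, P (φ i) ξ := by
  have h : (fun ζ => ∑ i ∈ s, φ i ζ) = ∑ i ∈ s, φ i := by
    ext ζ
    simp
  rw [h, map_sum, Finset.sum_apply]

/-- Markov operators on configurations that commute with relabellings and preserve the uniform
distribution. -/
structure IsMarkov (P : Module.End ℝ (M.Conf → ℝ)) : Prop where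
  nonneg : ∀ φ : M.Conf → ℝ, (∀ ζ, 0 ≤ φ ζ) → ∀ ξ, 0 ≤ P φ ξ
  one : ∀ ξ, P (fun _ => 1) ξ = 1
  eqv : ∀ (π : Equiv.Perm M.HalfEdge) (φ : M.Conf → ℝ) (ξ : M.Conf),
    P (fun ζ => φ (conj π ζ)) ξ = P φ (conj π ξ)
  sum : ∀ φ : M.Conf → ℝ, ∑ ξ, P φ ξ = ∑ ξ, φ ξ

namespace IsMarkov

variable {P Q : Module.End ℝ (M.Conf → ℝ)}

theorem mono (hP : IsMarkov P) {φ ψ : M.Conf → ℝ} (h : ∀ ζ, φ ζ ≤ ψ ζ) (ξ : M.Conf) :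
    P φ ξ ≤ P ψ ξ := by
  have := hP.nonneg (fun ζ => ψ ζ - φ ζ) (fun ζ => sub_nonneg.2 (h ζ)) ξ
  rw [end_sub] at this
  linarith

theorem const (hP : IsMarkov P) (a : ℝ) (ξ : M.Conf) : P (fun _ => a) ξ = a := by
  have := end_const_mul P a (fun _ => 1) ξ
  simpa [hP.one] using this

theorem le_const (hP : IsMarkov P) {φ : M.Conf → ℝ} {a : ℝ} (h : ∀ ζ, φ ζ ≤ a) (ξ : M.Conf) :
    P φ ξ ≤ a := (hP.mono h ξ).trans (hP.const a ξ).le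

theorem abs_le (hP : IsMarkov P) (φ : M.Conf → ℝ) (ξ : M.Conf) :
    |P φ ξ| ≤ P (fun ζ => |φ ζ|) ξ := by
  rw [_root_.abs_le]
  constructor
  · have := hP.mono (φ := fun ζ => (-1) * |φ ζ|) (ψ := φ)
      (fun ζ => by linarith [neg_abs_le (φ ζ)]) ξ
    rw [end_const_mul] at this
    linarith
  · exact hP.mono (fun ζ => le_abs_self _) ξ

theorem one' : IsMarkov (1 : Module.End ℝ (M.Conf → ℝ)) where
  nonneg _ h ξ := h ξ
  one _ := rfl
  eqv _ _ _ := rfl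
  sum _ := rfl

theorem mul (hP : IsMarkov P) (hQ : IsMarkov Q) : IsMarkov (P * Q) where
  nonneg φ h ξ := hP.nonneg _ (hQ.nonneg φ h) ξ
  one ξ := by
    rw [Module.End.mul_apply, show Q (fun _ => 1) = fun _ => 1 from funext hQ.one, hP.one]
  eqv π φ ξ := by
    rw [Module.End.mul_apply, Module.End.mul_apply, ← hP.eqv]
    exact end_congr P (hQ.eqv π φ) ξ
  sum φ := by
    simp only [Module.End.mul_apply, hP.sum, hQ.sum]

theorem pow (hP : IsMarkov P) (j : ℕ) : IsMarkov (P ^ j) := by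
  induction j with
  | zero => exact one'
  | succ j ih => rw [pow_succ]; exact ih.mul hP

end IsMarkov

variable (M) in
/-- The transition operator of the configuration dynamics. -/
noncomputable def dyn : Module.End ℝ (M.Conf → ℝ) := ker fun _ => True

theorem isMarkov_dyn : IsMarkov M.dyn where
  nonneg _ h ξ := ker_nonneg _ h ξ
  one ξ := ker_one ξ
  eqv _ φ ξ := ker_conj (fun _ => Iff.rfl) φ ξ
  sum φ := sum_ker φ

/-! ### Hitting probabilities -/

/-- Probability that the walk driven by the operators `Ps` uses one of the half-edges in `D`, either
as a position or as the partner of a position. -/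
noncomputable def hit : List (Module.End ℝ (M.Conf → ℝ)) → Finset M.HalfEdge → M.Conf →
    M.HalfEdge → ℝ
  | [], _, _, _ => 0
  | P :: Ps, D, ξ, y => if y ∈ D then 1 else
      P (fun ζ => if ζ.1 y ∈ D then 1 else M.savg (ζ.1 y) (hit Ps D ζ)) ξ

/-- Probability that the walk driven by the operators `Ps` meets `c` as the partner of a position,
and uses no half-edge in `D` before. -/
noncomputable def firstHit : List (Module.End ℝ (M.Conf → ℝ)) → Finset M.HalfEdge → M.HalfEdge →
    M.Conf → M.HalfEdge → ℝ
  | [], _, _, _, _ => 0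
  | P :: Ps, D, c, ξ, y => if y ∈ D then 0 else
      P (fun ζ => if ζ.1 y = c then 1 else if ζ.1 y ∈ D then 0 else
        M.savg (ζ.1 y) (firstHit Ps D c ζ)) ξ

variable {Ps : List (Module.End ℝ (M.Conf → ℝ))}

theorem hit_mem_Icc (hPs : ∀ P ∈ Ps, IsMarkov P) (D : Finset M.HalfEdge) (ξ : M.Conf)
    (y : M.HalfEdge) : 0 ≤ hit Ps D ξ y ∧ hit Ps D ξ y ≤ 1 := by
  induction Ps generalizing ξ y with
  | nil => simp [hit]
  | cons P Ps ih =>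
    have hP := hPs P (by simp)
    have ih' := ih fun Q hQ => hPs Q (by simp [hQ])
    rw [hit]
    split_ifs
    · simp
    · constructor
      · refine hP.nonneg _ (fun ζ => ?_) ξ
        split_ifs
        · exact zero_le_one
        · exact savg_nonneg fun w _ => (ih' ζ w).1
      · refine hP.le_const (fun ζ => ?_) ξ
        split_ifs
        · exact le_rfl
        · exact savg_le fun w _ => (ih' ζ w).2

theorem firstHit_mem_Icc (hPs : ∀ P ∈ Ps, IsMarkov P) (D : Finset M.HalfEdge) (c : M.HalfEdge)
    (ξ : M.Conf) (y : M.HalfEdge) : 0 ≤ firstHit Ps D c ξ y ∧ firstHit Ps D c ξ y ≤ 1 := by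
  induction Ps generalizing ξ y with
  | nil => simp [firstHit]
  | cons P Ps ih =>
    have hP := hPs P (by simp)
    have ih' := ih fun Q hQ => hPs Q (by simp [hQ])
    rw [firstHit]
    split_ifs
    · simp
    · constructor
      · refine hP.nonneg _ (fun ζ => ?_) ξ
        split_ifs
        · exact zero_le_one
        · exact le_rfl
        · exact savg_nonneg fun w _ => (ih' ζ w).1
      · refine hP.le_const (fun ζ => ?_) ξ
        split_ifs
        · exact le_rfl
        · exact zero_le_one
        · exact savg_le fun w _ => (ih' ζ w).2

theorem hit_union_le (hPs : ∀ P ∈ Ps, IsMarkov P) (D D' : Finset M.HalfEdge) (ξ : M.Conf)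
    (y : M.HalfEdge) : hit Ps (D ∪ D') ξ y ≤ hit Ps D ξ y + hit Ps D' ξ y := by
  induction Ps generalizing ξ y with
  | nil => simp [hit]
  | cons P Ps ih =>
    have hP := hPs P (by simp)
    have hPs' : ∀ Q ∈ Ps, IsMarkov Q := fun Q hQ => hPs Q (by simp [hQ])
    have h1 := (hit_mem_Icc hPs D ξ y).1
    have h2 := (hit_mem_Icc hPs D' ξ y).1
    by_cases hy : y ∈ D
    · have : hit (P :: Ps) D ξ y = 1 := by rw [hit, if_pos hy]
      have := (hit_mem_Icc hPs (D ∪ D') ξ y).2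
      linarith
    by_cases hy' : y ∈ D'
    · have : hit (P :: Ps) D' ξ y = 1 := by rw [hit, if_pos hy']
      have := (hit_mem_Icc hPs (D ∪ D') ξ y).2
      linarith
    rw [hit, hit, hit, if_neg hy, if_neg hy', if_neg (by simp [hy, hy']), ← end_add]
    refine hP.mono (fun ζ => ?_) ξ
    have e1 : 0 ≤ M.savg (ζ.1 y) (hit Ps D ζ) := savg_nonneg fun w _ => (hit_mem_Icc hPs' D ζ w).1
    have e2 : 0 ≤ M.savg (ζ.1 y) (hit Ps D' ζ) :=
      savg_nonneg fun w _ => (hit_mem_Icc hPs' D' ζ w).1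
    by_cases h3 : ζ.1 y ∈ D
    · rw [if_pos (by simp [h3]), if_pos h3]
      split_ifs <;> linarith
    by_cases h4 : ζ.1 y ∈ D'
    · rw [if_pos (by simp [h4]), if_pos h4, if_neg h3]
      linarith
    rw [if_neg h3, if_neg h4, if_neg (by simp [h3, h4]), ← savg_add]
    exact savg_mono fun w _ => ih hPs' ζ w

theorem hit_cons_le {P : Module.End ℝ (M.Conf → ℝ)} (hP : IsMarkov P)
    (hPs : ∀ P ∈ Ps, IsMarkov P) (b : M.HalfEdge) (ξ : M.Conf) (y : M.HalfEdge) :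
    hit (P :: Ps) {b} ξ y ≤ (if y = b then 1 else 0) +
      P (fun ζ => (if ζ.1 y = b then 1 else 0) + M.savg (ζ.1 y) (hit Ps {b} ζ)) ξ := by
  have e : ∀ ζ : M.Conf, 0 ≤ M.savg (ζ.1 y) (hit Ps {b} ζ) := fun ζ =>
    savg_nonneg fun w _ => (hit_mem_Icc hPs _ ζ w).1
  have e2 : 0 ≤ P (fun ζ => (if ζ.1 y = b then 1 else 0) + M.savg (ζ.1 y) (hit Ps {b} ζ)) ξ := by
    refine hP.nonneg _ (fun ζ => ?_) ξ
    have := e ζ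
    split_ifs <;> linarith
  rw [hit]
  simp only [Finset.mem_singleton]
  split_ifs with h
  · linarith
  · rw [zero_add]
    refine hP.mono (fun ζ => ?_) ξ
    have := e ζ
    split_ifs <;> linarith

/-- Each step uses at most two half-edges, a position and its partner. -/
theorem sum_hit_target_le (hPs : ∀ P ∈ Ps, IsMarkov P) (ξ : M.Conf) (y : M.HalfEdge) :
    ∑ b, hit Ps {b} ξ y ≤ 2 * Ps.length := by
  induction Ps generalizing ξ y with
  | nil => simp [hit]
  | cons P Ps ih =>
    have hP := hPs P (by simp)
    have hPs' : ∀ Q ∈ Ps, IsMarkov Q := fun Q hQ => hPs Q (by simp [hQ])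
    refine (Finset.sum_le_sum fun b _ => hit_cons_le hP hPs' b ξ y).trans ?_
    rw [Finset.sum_add_distrib, ← end_sum, Finset.sum_ite_eq, if_pos (Finset.mem_univ _)]
    have : P (fun ζ => ∑ b, ((if ζ.1 y = b then 1 else 0) + M.savg (ζ.1 y) (hit Ps {b} ζ))) ξ
        ≤ 1 + 2 * Ps.length := by
      refine hP.le_const (fun ζ => ?_) ξ
      rw [Finset.sum_add_distrib, Finset.sum_ite_eq, if_pos (Finset.mem_univ _), ← savg_sum]
      have := savg_le (z := ζ.1 y) fun w _ => ih hPs' ζ w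
      linarith
    push_cast [List.length_cons]
    linarith

/-- Started from the counting measure, the walk has the counting measure as the law of every
position and of every partner, so each step contributes at most `2`. -/
theorem sum_hit_start_le (hPs : ∀ P ∈ Ps, IsMarkov P) (ξ : M.Conf) (b : M.HalfEdge) :
    ∑ y, hit Ps {b} ξ y ≤ 2 * Ps.length := by
  induction Ps generalizing ξ with
  | nil => simp [hit]
  | cons P Ps ih =>
    have hP := hPs P (by simp)
    have hPs' : ∀ Q ∈ Ps, IsMarkov Q := fun Q hQ => hPs Q (by simp [hQ])
    refine (Finset.sum_le_sum fun y _ => hit_cons_le hP hPs' b ξ y).trans ?_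
    rw [Finset.sum_add_distrib, ← end_sum, Finset.sum_ite_eq', if_pos (Finset.mem_univ _)]
    have : P (fun ζ => ∑ y, ((if ζ.1 y = b then 1 else 0) + M.savg (ζ.1 y) (hit Ps {b} ζ))) ξ
        ≤ 1 + 2 * Ps.length := by
      refine hP.le_const (fun ζ => ?_) ξ
      rw [sum_conf ζ fun z => (if z = b then 1 else 0) + M.savg z (hit Ps {b} ζ),
        Finset.sum_add_distrib, Finset.sum_ite_eq', if_pos (Finset.mem_univ _), sum_savg]
      have := ih hPs' ζ
      linarith
    push_cast [List.length_cons]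
    linarith

theorem firstHit_le_hit (hPs : ∀ P ∈ Ps, IsMarkov P) (D : Finset M.HalfEdge) (c : M.HalfEdge)
    (ξ : M.Conf) (y : M.HalfEdge) : firstHit Ps D c ξ y ≤ hit Ps {c} ξ y := by
  induction Ps generalizing ξ y with
  | nil => simp [hit, firstHit]
  | cons P Ps ih =>
    have hP := hPs P (by simp)
    have hPs' : ∀ Q ∈ Ps, IsMarkov Q := fun Q hQ => hPs Q (by simp [hQ])
    by_cases hy : y ∈ D
    · rw [firstHit, if_pos hy]
      exact (hit_mem_Icc hPs _ _ _).1
    by_cases hy' : y = c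
    · have : hit (P :: Ps) {c} ξ y = 1 := by rw [hit, if_pos (by simp [hy'])]
      rw [this]
      exact (firstHit_mem_Icc hPs _ _ _ _).2
    rw [firstHit, hit, if_neg hy, if_neg (by simpa using hy')]
    refine hP.mono (fun ζ => ?_) ξ
    simp only [Finset.mem_singleton]
    split_ifs
    · exact le_rfl
    · exact savg_nonneg fun w _ => (hit_mem_Icc hPs' _ ζ w).1
    · exact savg_mono fun w _ => ih hPs' ζ w

/-- Enlarging the forbidden set loses only walks that use `D'`. It serves to forbid every half-edge
moved by a relabelling, as `firstHit_conj` requires. -/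
theorem firstHit_le_add (hPs : ∀ P ∈ Ps, IsMarkov P) (D D' : Finset M.HalfEdge) (c : M.HalfEdge)
    (ξ : M.Conf) (y : M.HalfEdge) :
    firstHit Ps D c ξ y ≤ firstHit Ps (D ∪ D') c ξ y + hit Ps D' ξ y := by
  induction Ps generalizing ξ y with
  | nil => simp [hit, firstHit]
  | cons P Ps ih =>
    have hP := hPs P (by simp)
    have hPs' : ∀ Q ∈ Ps, IsMarkov Q := fun Q hQ => hPs Q (by simp [hQ])
    have h1 := (firstHit_mem_Icc hPs (D ∪ D') c ξ y).1
    have h2 := (hit_mem_Icc hPs D' ξ y).1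
    by_cases hy : y ∈ D
    · have : firstHit (P :: Ps) D c ξ y = 0 := by rw [firstHit, if_pos hy]
      linarith
    by_cases hy' : y ∈ D'
    · have : hit (P :: Ps) D' ξ y = 1 := by rw [hit, if_pos hy']
      have := (firstHit_mem_Icc hPs D c ξ y).2
      linarith
    rw [firstHit, firstHit, hit, if_neg hy, if_neg hy', if_neg (by simp [hy, hy']), ← end_add]
    refine hP.mono (fun ζ => ?_) ξ
    have e1 : 0 ≤ M.savg (ζ.1 y) (hit Ps D' ζ) :=
      savg_nonneg fun w _ => (hit_mem_Icc hPs' D' ζ w).1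
    have e2 : M.savg (ζ.1 y) (firstHit Ps D c ζ) ≤ 1 :=
      savg_le fun w _ => (firstHit_mem_Icc hPs' D c ζ w).2
    by_cases h3 : ζ.1 y = c
    · rw [if_pos h3, if_pos h3]
      split_ifs <;> linarith
    rw [if_neg h3, if_neg h3]
    by_cases h4 : ζ.1 y ∈ D
    · rw [if_pos h4, if_pos (by simp [h4])]
      split_ifs <;> linarith
    rw [if_neg h4]
    by_cases h5 : ζ.1 y ∈ D'
    · rw [if_pos h5, if_pos (by simp [h5])]
      linarith
    rw [if_neg h5, if_neg (by simp [h4, h5]), ← savg_add]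
    exact savg_mono fun w _ => ih hPs' ζ w

/-! ### Exchangeability of hitting probabilities -/

theorem perm_mem_iff {D : Finset M.HalfEdge} {π : Equiv.Perm M.HalfEdge}
    (hπ : ∀ x, x ∉ D → π x = x) (x : M.HalfEdge) : π x ∈ D ↔ x ∈ D := by
  constructor
  · intro h
    by_contra hx
    rw [hπ x hx] at h
    exact hx h
  · intro h
    by_contra hx
    have := hπ _ hx
    rw [EmbeddingLike.apply_eq_iff_eq] at this
    exact hx (this.symm ▸ h)

/-- Before it uses `D`, the walk cannot tell `ξ` from its relabelling, since `π` moves nothing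
outside `D`. When `D` is first met as a partner, `c` in one picture is `π c` in the other. -/
theorem firstHit_conj (hPs : ∀ P ∈ Ps, IsMarkov P) {D : Finset M.HalfEdge}
    {π : Equiv.Perm M.HalfEdge} (hπ : ∀ x, x ∉ D → π x = x) (c : M.HalfEdge)
    (ξ : M.Conf) (y : M.HalfEdge) :
    firstHit Ps D c ξ y = firstHit Ps D (π c) (conj π ξ) y := by
  induction Ps generalizing ξ y with
  | nil => simp [firstHit]
  | cons P Ps ih =>
    have hP := hPs P (by simp)
    have hPs' : ∀ Q ∈ Ps, IsMarkov Q := fun Q hQ => hPs Q (by simp [hQ])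
    rw [firstHit, firstHit]
    split_ifs with hy
    · rfl
    rw [← hP.eqv]
    refine end_congr P (fun ζ => ?_) ξ
    rw [conj_apply_of_fixed _ (hπ y hy)]
    simp only [EmbeddingLike.apply_eq_iff_eq, perm_mem_iff hπ]
    split_ifs with h1 h2
    · rfl
    · rfl
    · rw [hπ _ h2]
      exact savg_congr fun w _ => ih hPs' ζ w

/-- For a uniform initial configuration, a given half-edge is met with probability `O(1/ℓ)`. -/
theorem sum_firstHit_le (hPs : ∀ P ∈ Ps, IsMarkov P) (c y : M.HalfEdge) :
    M.ell * ∑ ξ, firstHit Ps {c} c ξ y ≤ Fintype.card M.Conf * (4 * Ps.length) := by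
  -- The transposition of `c` and `b` preserves the uniform distribution, so the target `c` may be
  -- replaced by any `b`. Summing over `b` produces the factor `ℓ`, while the expected number of
  -- half-edges used stays bounded by `sum_hit_target_le`.
  have h1 : ∀ b, ∑ ξ, firstHit Ps {c} c ξ y ≤ ∑ ξ, 2 * hit Ps {b} ξ y := by
    intro b
    have hπ : ∀ x, x ∉ ({c} ∪ {b} : Finset M.HalfEdge) → Equiv.swap c b x = x := by
      intro x hx
      simp only [Finset.mem_union, Finset.mem_singleton, not_or] at hx
      exact Equiv.swap_apply_of_ne_of_ne hx.1 hx.2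
    calc ∑ ξ, firstHit Ps {c} c ξ y
        ≤ ∑ ξ, (firstHit Ps ({c} ∪ {b}) c ξ y + hit Ps {b} ξ y) :=
          Finset.sum_le_sum fun ξ _ => firstHit_le_add hPs _ _ _ _ _
      _ = ∑ ξ, firstHit Ps ({c} ∪ {b}) b (conj (Equiv.swap c b) ξ) y + ∑ ξ, hit Ps {b} ξ y := by
          rw [Finset.sum_add_distrib]
          congr 1
          refine Finset.sum_congr rfl fun ξ _ => ?_
          rw [firstHit_conj hPs hπ, Equiv.swap_apply_left]
      _ = ∑ ξ, firstHit Ps ({c} ∪ {b}) b ξ y + ∑ ξ, hit Ps {b} ξ y := by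
          rw [Equiv.sum_comp (conj (Equiv.swap c b)) fun ξ => firstHit Ps ({c} ∪ {b}) b ξ y]
      _ ≤ ∑ ξ, hit Ps {b} ξ y + ∑ ξ, hit Ps {b} ξ y :=
          add_le_add_left (Finset.sum_le_sum fun ξ _ => firstHit_le_hit hPs _ _ _ _) _
      _ = _ := by rw [← Finset.mul_sum]; ring
  have h2 := Finset.sum_le_sum fun b (_ : b ∈ (Finset.univ : Finset M.HalfEdge)) => h1 b
  rw [Finset.sum_const, nsmul_eq_mul, Finset.card_univ, card_halfEdge, Finset.sum_comm] at h2
  refine h2.trans ?_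
  refine (Finset.sum_le_sum fun ξ _ => (show _ ≤ (4 * Ps.length : ℝ) from ?_)).trans ?_
  · rw [← Finset.mul_sum]
    linarith [sum_hit_target_le hPs ξ y]
  · rw [Finset.sum_const, nsmul_eq_mul, Finset.card_univ]

/-! ### Automorphisms of a configuration exchanging two edges -/

/-- The permutation exchanging the edges of `a` and `b`, when these half-edges lie on different
edges of `ξ`. -/
def edgeSwap (ξ : M.Conf) (a b : M.HalfEdge) : Equiv.Perm M.HalfEdge :=
  if ξ.1 a = b then Equiv.swap a b else Equiv.swap a b * Equiv.swap (ξ.1 a) (ξ.1 b)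

theorem edgeSwap_left (ξ : M.Conf) (a b : M.HalfEdge) : edgeSwap ξ a b a = b := by
  unfold edgeSwap
  split_ifs with h
  · exact Equiv.swap_apply_left _ _
  · rw [Equiv.Perm.mul_apply, Equiv.swap_apply_of_ne_of_ne (conf_ne ξ a).symm,
      Equiv.swap_apply_left]
    intro h'
    rw [eq_comm, conf_eq_iff] at h'
    exact h h'

theorem edgeSwap_right (ξ : M.Conf) (a b : M.HalfEdge) : edgeSwap ξ a b b = a := by
  unfold edgeSwap
  split_ifs with h
  · exact Equiv.swap_apply_right _ _
  · rw [Equiv.Perm.mul_apply, Equiv.swap_apply_of_ne_of_ne (Ne.symm h) (conf_ne ξ b).symm,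
      Equiv.swap_apply_right]

theorem edgeSwap_fixed (ξ : M.Conf) {a b x : M.HalfEdge} (h1 : x ≠ a) (h2 : x ≠ b)
    (h3 : x ≠ ξ.1 a) (h4 : x ≠ ξ.1 b) : edgeSwap ξ a b x = x := by
  unfold edgeSwap
  split_ifs
  · exact Equiv.swap_apply_of_ne_of_ne h1 h2
  · rw [Equiv.Perm.mul_apply, Equiv.swap_apply_of_ne_of_ne h3 h4,
      Equiv.swap_apply_of_ne_of_ne h1 h2]

theorem edgeSwap_comm (ξ : M.Conf) (a b : M.HalfEdge) : edgeSwap ξ a b = edgeSwap ξ b a := by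
  unfold edgeSwap
  by_cases h : ξ.1 a = b
  · rw [if_pos h, if_pos ((conf_eq_iff ξ).1 h), Equiv.swap_comm]
  · rw [if_neg h, if_neg fun h' => h ((conf_eq_iff ξ).1 h')]
    rw [Equiv.swap_comm a b, Equiv.swap_comm (ξ.1 a)]

theorem edgeSwap_conf_left (ξ : M.Conf) (a b : M.HalfEdge) :
    edgeSwap ξ a b (ξ.1 a) = ξ.1 b := by
  by_cases hab : a = b
  · subst hab
    rw [edgeSwap, if_neg (conf_ne ξ a), Equiv.swap_self, Equiv.swap_self]
    rfl
  unfold edgeSwap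
  split_ifs with h
  · rw [h, Equiv.swap_apply_right, ← h, conf_conf]
  · rw [Equiv.Perm.mul_apply, Equiv.swap_apply_left, Equiv.swap_apply_of_ne_of_ne]
    · intro h'
      rw [conf_eq_iff] at h'
      exact h h'
    · exact conf_ne ξ b

theorem edgeSwap_conf_right (ξ : M.Conf) (a b : M.HalfEdge) :
    edgeSwap ξ a b (ξ.1 b) = ξ.1 a := by
  rw [edgeSwap_comm, edgeSwap_conf_left]

/-- Moving both ends of each edge makes the permutation commute with `ξ`. A plain transposition
preserves only the uniform distribution; this gives a symmetry for one fixed configuration. -/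
theorem conj_edgeSwap (ξ : M.Conf) (a b : M.HalfEdge) : conj (edgeSwap ξ a b) ξ = ξ := by
  refine conj_eq_self fun x => ?_
  by_cases h1 : x = a
  · rw [h1, edgeSwap_left, edgeSwap_conf_left]
  by_cases h2 : x = b
  · rw [h2, edgeSwap_right, edgeSwap_conf_right]
  by_cases h3 : x = ξ.1 a
  · rw [h3, conf_conf, edgeSwap_left, edgeSwap_conf_left, conf_conf]
  by_cases h4 : x = ξ.1 b
  · rw [h4, conf_conf, edgeSwap_right, edgeSwap_conf_right, conf_conf]
  rw [edgeSwap_fixed ξ h1 h2 h3 h4, edgeSwap_fixed ξ]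
  · exact fun h => h3 ((conf_eq_iff ξ).1 h).symm
  · exact fun h => h4 ((conf_eq_iff ξ).1 h).symm
  · exact fun h => h1 (ξ.1.injective h)
  · exact fun h => h2 (ξ.1.injective h)

/-- The walk returns to the half-edge `y`, before using the edge of `y` again, with probability
`O(1/ℓ)`. -/
theorem firstHit_edge_le (hPs : ∀ P ∈ Ps, IsMarkov P) (ξ : M.Conf) (y w : M.HalfEdge) :
    M.ell * firstHit Ps {y, ξ.1 y} y ξ w ≤ 6 * Ps.length := by
  -- Exchange the edge of `y` with that of `b`; as `ξ` is unchanged, no average over configurations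
  -- is needed. Forbidding both ends of the edge of `b` costs two hitting terms, and the new target
  -- `b` a third, whence `6 = 3 · 2`.
  have h1 : ∀ b, firstHit Ps {y, ξ.1 y} y ξ w
      ≤ 2 * hit Ps {b} ξ w + hit Ps {ξ.1 b} ξ w := by
    intro b
    have hπ : ∀ x, x ∉ (({y, ξ.1 y} : Finset M.HalfEdge) ∪ ({b} ∪ {ξ.1 b})) →
        edgeSwap ξ y b x = x := by
      intro x hx
      simp only [Finset.mem_union, Finset.mem_insert, Finset.mem_singleton, not_or] at hx
      exact edgeSwap_fixed ξ hx.1.1 hx.2.1 hx.1.2 hx.2.2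
    have e1 := firstHit_le_add hPs {y, ξ.1 y} ({b} ∪ {ξ.1 b}) y ξ w
    have e2 := firstHit_conj hPs hπ y ξ w
    rw [conj_edgeSwap, edgeSwap_left] at e2
    have e3 := firstHit_le_hit hPs (({y, ξ.1 y} : Finset M.HalfEdge) ∪ ({b} ∪ {ξ.1 b})) b ξ w
    have e4 := hit_union_le hPs {b} {ξ.1 b} ξ w
    linarith
  have h2 := Finset.sum_le_sum fun b (_ : b ∈ (Finset.univ : Finset M.HalfEdge)) => h1 b
  rw [Finset.sum_const, nsmul_eq_mul, Finset.card_univ, card_halfEdge, Finset.sum_add_distrib,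
    ← Finset.mul_sum, sum_conf ξ fun b => hit Ps {b} ξ w] at h2
  linarith [sum_hit_target_le hPs ξ w]

/-! ### Repetition of vertices -/

/-- Probability that the walk driven by the operators `Ps` visits a vertex in `V`, or a vertex for
the second time. -/
noncomputable def revisit : List (Module.End ℝ (M.Conf → ℝ)) → Finset (Fin n) → M.Conf →
    M.HalfEdge → ℝ
  | [], _, _, _ => 0
  | P :: Ps, V, ξ, y => P (fun ζ => if (ζ.1 y).1 ∈ V then 1 else
      M.savg (ζ.1 y) (revisit Ps (insert (ζ.1 y).1 V) ζ)) ξ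

/-- Probability that the walk driven by the operators `Ps` visits `v`, before visiting a vertex in
`V` or any vertex for the second time. -/
noncomputable def visit (v : Fin n) : List (Module.End ℝ (M.Conf → ℝ)) → Finset (Fin n) → M.Conf →
    M.HalfEdge → ℝ
  | [], _, _, _ => 0
  | P :: Ps, V, ξ, y => P (fun ζ => if (ζ.1 y).1 = v then 1 else if (ζ.1 y).1 ∈ V then 0 else
      M.savg (ζ.1 y) (visit v Ps (insert (ζ.1 y).1 V) ζ)) ξ

theorem revisit_mem_Icc (hPs : ∀ P ∈ Ps, IsMarkov P) (V : Finset (Fin n)) (ξ : M.Conf)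
    (y : M.HalfEdge) : 0 ≤ revisit Ps V ξ y ∧ revisit Ps V ξ y ≤ 1 := by
  induction Ps generalizing V ξ y with
  | nil => simp [revisit]
  | cons P Ps ih =>
    have hP := hPs P (by simp)
    have ih' := ih fun Q hQ => hPs Q (by simp [hQ])
    rw [revisit]
    constructor
    · refine hP.nonneg _ (fun ζ => ?_) ξ
      split_ifs
      · exact zero_le_one
      · exact savg_nonneg fun w _ => (ih' _ ζ w).1
    · refine hP.le_const (fun ζ => ?_) ξ
      split_ifs
      · exact le_rfl
      · exact savg_le fun w _ => (ih' _ ζ w).2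

/-- A walk that fails only because of the extra vertex `v` visits `v` before any other repetition.
This isolates returns to the starting vertex. -/
theorem revisit_insert_le (hPs : ∀ P ∈ Ps, IsMarkov P) (v : Fin n) (V : Finset (Fin n))
    (ξ : M.Conf) (y : M.HalfEdge) :
    revisit Ps (insert v V) ξ y ≤ revisit Ps V ξ y + visit v Ps V ξ y := by
  induction Ps generalizing V ξ y with
  | nil => simp [revisit, visit]
  | cons P Ps ih =>
    have hP := hPs P (by simp)
    have hPs' : ∀ Q ∈ Ps, IsMarkov Q := fun Q hQ => hPs Q (by simp [hQ])
    rw [revisit, revisit, visit, ← end_add]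
    refine hP.mono (fun ζ => ?_) ξ
    have e1 : 0 ≤ M.savg (ζ.1 y) (revisit Ps (insert (ζ.1 y).1 V) ζ) :=
      savg_nonneg fun w _ => (revisit_mem_Icc hPs' _ ζ w).1
    by_cases h1 : (ζ.1 y).1 = v
    · rw [if_pos (by simp [h1]), if_pos h1]
      split_ifs <;> linarith
    by_cases h2 : (ζ.1 y).1 ∈ V
    · rw [if_pos (by simp [h2]), if_pos h2, if_neg h1, if_pos h2]
      linarith
    rw [if_neg h1, if_neg h2, if_neg (by simp [h1, h2]), if_neg h2, ← savg_add,
      Finset.insert_comm]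
    exact savg_mono fun w _ => ih hPs' _ ζ w

/-- The vertex of `y` is entered through a sibling of `y` or through `y` itself. In the second case
neither `y` nor `z` was used before: `y` would already be a visit, and `z` lies at a forbidden
vertex. With `z` the partner of `y`, this is the situation of `firstHit_edge_le`. -/
theorem visit_le (hPs : ∀ P ∈ Ps, IsMarkov P) {y z : M.HalfEdge} {V : Finset (Fin n)}
    (hz : z.1 ∈ V) (ξ : M.Conf) {w : M.HalfEdge} (hwz : w ≠ z) (hw : w.1 ≠ y.1) :
    visit y.1 Ps V ξ w
      ≤ ∑ c ∈ M.siblings y, firstHit Ps {c} c ξ w + firstHit Ps {y, z} y ξ w := by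
  induction Ps generalizing V ξ w with
  | nil => simp [visit, firstHit]
  | cons P Ps ih =>
    have hP := hPs P (by simp)
    have hPs' : ∀ Q ∈ Ps, IsMarkov Q := fun Q hQ => hPs Q (by simp [hQ])
    have hwy : w ≠ y := fun h => hw (by rw [h])
    have hwc : ∀ c ∈ M.siblings y, w ≠ c := fun c hc h => hw (by rw [h, (M.mem_siblings.1 hc).1])
    have e1 : ∀ c ∈ M.siblings y, firstHit (P :: Ps) {c} c ξ w
        = P (fun ζ => if ζ.1 w = c then 1 else M.savg (ζ.1 w) (firstHit Ps {c} c ζ)) ξ := by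
      intro c hc
      rw [firstHit, if_neg (by simpa using hwc c hc)]
      refine end_congr P (fun ζ => ?_) ξ
      split_ifs with h1 h2
      · rfl
      · exact absurd (Finset.mem_singleton.1 h2) h1
      · rfl
    rw [Finset.sum_congr rfl e1, ← end_sum, firstHit, if_neg (by simp [hwy, hwz]), ← end_add,
      visit]
    refine hP.mono (fun ζ => ?_) ξ
    have e2 : ∀ c, 0 ≤ M.savg (ζ.1 w) (firstHit Ps {c} c ζ) := fun c =>
      savg_nonneg fun w _ => (firstHit_mem_Icc hPs' _ _ ζ w).1
    have e3 : ∀ c, 0 ≤ (if ζ.1 w = c then 1 else M.savg (ζ.1 w) (firstHit Ps {c} c ζ)) := by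
      intro c
      split_ifs
      · exact zero_le_one
      · exact e2 c
    have e4 : 0 ≤ M.savg (ζ.1 w) (firstHit Ps {y, z} y ζ) :=
      savg_nonneg fun w _ => (firstHit_mem_Icc hPs' _ _ ζ w).1
    by_cases h1 : (ζ.1 w).1 = y.1
    · rw [if_pos h1]
      by_cases h2 : ζ.1 w = y
      · rw [if_pos h2]
        have := Finset.sum_nonneg fun c (_ : c ∈ M.siblings y) => e3 c
        linarith
      · have := Finset.single_le_sum (fun c _ => e3 c) (M.mem_siblings.2 ⟨h1, h2⟩)
        rw [if_pos rfl] at this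
        rw [if_neg h2]
        split_ifs <;> linarith
    · have h2 : ζ.1 w ≠ y := fun h => h1 (by rw [h])
      rw [if_neg h1, if_neg h2]
      by_cases h3 : (ζ.1 w).1 ∈ V
      · rw [if_pos h3]
        have := Finset.sum_nonneg fun c (_ : c ∈ M.siblings y) => e3 c
        split_ifs <;> linarith
      · have h4 : ζ.1 w ≠ z := fun h => h3 (by rw [h]; exact hz)
        have h5 : ∀ c ∈ M.siblings y, ζ.1 w ≠ c := fun c hc h =>
          h1 (by rw [h, (M.mem_siblings.1 hc).1])
        rw [if_neg h3, if_neg (by simp [h2, h4]),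
          Finset.sum_congr rfl fun c hc => if_neg (h5 c hc), ← savg_sum, ← savg_add]
        refine savg_mono fun w' hw' => ?_
        have hw'1 := (M.mem_siblings.1 hw').1
        refine ih hPs' (by simp [hz]) ζ (fun h => h3 ?_) (by rwa [hw'1])
        rw [← hw'1, h]
        exact hz

/-- A repetition takes place within the walk after its first step or involves the starting vertex.
Returns through siblings of `y` are left to be averaged over configurations; a return through `y` is
bounded for each `ζ`, by the exchange of edges. -/
theorem revisit_start_le {P : Module.End ℝ (M.Conf → ℝ)} (hP : IsMarkov P)
    (hPs : ∀ P ∈ Ps, IsMarkov P) (ξ : M.Conf) (y : M.HalfEdge) :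
    revisit (P :: Ps) {y.1} ξ y
      ≤ P (fun ζ => M.savg (ζ.1 y) fun w => revisit Ps {w.1} ζ w) ξ
        + (∑ c ∈ M.siblings y, firstHit (P :: Ps) {c} c ξ y + 6 * Ps.length / M.ell) := by
  have hell : (0 : ℝ) < M.ell := by exact_mod_cast M.ell_pos
  have e1 : ∀ c ∈ M.siblings y, firstHit (P :: Ps) {c} c ξ y
      = P (fun ζ => if ζ.1 y = c then 1 else M.savg (ζ.1 y) (firstHit Ps {c} c ζ)) ξ := by
    intro c hc
    have : y ≠ c := (M.mem_siblings.1 hc).2.symm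
    rw [firstHit, if_neg (by simpa using this)]
    refine end_congr P (fun ζ => ?_) ξ
    split_ifs with h1 h2
    · rfl
    · exact absurd (Finset.mem_singleton.1 h2) h1
    · rfl
  rw [Finset.sum_congr rfl e1, ← end_sum, ← hP.const (6 * Ps.length / M.ell : ℝ) ξ, ← end_add,
    ← end_add, revisit]
  refine hP.mono (fun ζ => ?_) ξ
  have e3 : ∀ c, 0 ≤ (if ζ.1 y = c then 1 else M.savg (ζ.1 y) (firstHit Ps {c} c ζ)) := by
    intro c
    split_ifs
    · exact zero_le_one
    · exact savg_nonneg fun w _ => (firstHit_mem_Icc hPs _ _ ζ w).1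
  have e4 : 0 ≤ M.savg (ζ.1 y) fun w => revisit Ps {w.1} ζ w :=
    savg_nonneg fun w _ => (revisit_mem_Icc hPs _ ζ w).1
  have e5 : (0 : ℝ) ≤ 6 * Ps.length / M.ell := by positivity
  by_cases h1 : (ζ.1 y).1 = y.1
  · rw [if_pos (by simp [h1])]
    have := Finset.single_le_sum (fun c _ => e3 c) (M.mem_siblings.2 ⟨h1, conf_ne ζ y⟩)
    rw [if_pos rfl] at this
    linarith
  · have h5 : ∀ c ∈ M.siblings y, ζ.1 y ≠ c := fun c hc h =>
      h1 (by rw [h, (M.mem_siblings.1 hc).1])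
    rw [if_neg (by simpa using h1), Finset.sum_congr rfl fun c hc => if_neg (h5 c hc), ← savg_sum,
      ← savg_const (ζ.1 y) (6 * Ps.length / M.ell : ℝ), ← savg_add, ← savg_add]
    refine savg_mono fun w hw => ?_
    obtain ⟨hw1, hw2⟩ := M.mem_siblings.1 hw
    have h6 := revisit_insert_le hPs y.1 {(ζ.1 y).1} ζ w
    have h7 := visit_le hPs (y := y) (z := ζ.1 y) (V := {(ζ.1 y).1}) (by simp) ζ hw2
      (by rwa [hw1])
    have h8 : firstHit Ps {y, ζ.1 y} y ζ w ≤ 6 * Ps.length / M.ell := by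
      rw [le_div_iff₀ hell, mul_comm]
      exact firstHit_edge_le hPs ζ y w
    rw [Finset.pair_comm, hw1]
    linarith

theorem sum_deg_eq : ∑ x : M.HalfEdge, ((M.siblings x).card : ℝ) = M.ell * M.nu := by
  have hell : (M.ell : ℝ) ≠ 0 := by exact_mod_cast M.ell_pos.ne'
  rw [nu, mul_div_cancel₀ _ hell]
  refine Finset.sum_congr rfl fun x _ => ?_
  rw [card_siblings, Nat.cast_sub (by have := M.two_le_d x.1; omega), Nat.cast_one]

theorem nu_nonneg : 0 ≤ M.nu := by
  have hell : (0 : ℝ) < M.ell := by exact_mod_cast M.ell_pos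
  have h := sum_deg_eq (M := M)
  have h2 : 0 ≤ ∑ x : M.HalfEdge, ((M.siblings x).card : ℝ) :=
    Finset.sum_nonneg fun x _ => Nat.cast_nonneg _
  rw [h] at h2
  exact nonneg_of_mul_nonneg_right h2 hell

/-- For a uniform initial state, the walk repeats a vertex with probability `O(1/ℓ)`. -/
theorem sum_revisit_le (hPs : ∀ P ∈ Ps, IsMarkov P) {L : ℕ} (hL : Ps.length ≤ L) :
    ∑ ξ, ∑ y, revisit Ps {y.1} ξ y
      ≤ Ps.length * (Fintype.card M.Conf * (4 * L * M.nu + 6 * L)) := by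
  have hell : (0 : ℝ) < M.ell := by exact_mod_cast M.ell_pos
  induction Ps with
  | nil => simp [revisit]
  | cons P Ps ih =>
    have hP := hPs P (by simp)
    have hPs' : ∀ Q ∈ Ps, IsMarkov Q := fun Q hQ => hPs Q (by simp [hQ])
    rw [List.length_cons] at hL
    have ih' := ih hPs' (by omega)
    have hLr : ((Ps.length : ℝ) + 1) ≤ L := by exact_mod_cast hL
    -- Stationarity: one step from a uniform configuration and half-edge leads to a uniform pair.
    have e1 : ∑ ξ, ∑ y, P (fun ζ => M.savg (ζ.1 y) fun w => revisit Ps {w.1} ζ w) ξ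
        = ∑ ξ, ∑ y, revisit Ps {y.1} ξ y := by
      simp_rw [← end_sum]
      rw [hP.sum]
      refine Finset.sum_congr rfl fun ζ _ => ?_
      rw [sum_conf ζ fun z => M.savg z fun w => revisit Ps {w.1} ζ w, sum_savg]
    -- Each sibling is met with mean probability at most `4L/ℓ`, and the numbers of siblings sum to
    -- `ℓ ν`.
    have e2 : ∑ ξ, ∑ y, ∑ c ∈ M.siblings y, firstHit (P :: Ps) {c} c ξ y
        ≤ Fintype.card M.Conf * (4 * L * M.nu) := by
      rw [Finset.sum_comm]
      have : ∀ y : M.HalfEdge, ∑ ξ, ∑ c ∈ M.siblings y, firstHit (P :: Ps) {c} c ξ y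
          ≤ (M.siblings y).card * (Fintype.card M.Conf * (4 * L) / M.ell) := by
        intro y
        rw [Finset.sum_comm]
        refine (Finset.sum_le_sum fun c _ =>
          (show _ ≤ (Fintype.card M.Conf * (4 * L) / M.ell : ℝ) from ?_)).trans ?_
        · rw [le_div_iff₀ hell, mul_comm]
          refine (sum_firstHit_le hPs c y).trans ?_
          rw [List.length_cons]
          push_cast
          gcongr
        · rw [Finset.sum_const, nsmul_eq_mul]
      refine (Finset.sum_le_sum fun y _ => this y).trans ?_
      rw [← Finset.sum_mul, sum_deg_eq]
      apply le_of_eq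
      field_simp
    have e3 : ∑ _ξ : M.Conf, ∑ _y : M.HalfEdge, (6 * Ps.length / M.ell : ℝ)
        ≤ Fintype.card M.Conf * (6 * L) := by
      simp only [Finset.sum_const, nsmul_eq_mul, Finset.card_univ, card_halfEdge]
      rw [mul_div_cancel₀ _ hell.ne']
      gcongr
      linarith
    refine (Finset.sum_le_sum fun ξ _ => Finset.sum_le_sum fun y _ =>
      revisit_start_le hP hPs' ξ y).trans ?_
    simp only [Finset.sum_add_distrib]
    rw [e1, List.length_cons]
    push_cast
    linarith

theorem savg_eq (z : M.HalfEdge) (g : M.HalfEdge → ℝ) :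
    M.savg z g = ((M.siblings z).card : ℝ)⁻¹ * ∑ w ∈ M.siblings z, g w := by
  rw [savg, Finset.expect_eq_sum_div_card, div_eq_inv_mul]

theorem end_savg (P : Module.End ℝ (M.Conf → ℝ)) (z : M.HalfEdge) (h : M.Conf → M.HalfEdge → ℝ)
    (ξ : M.Conf) : P (fun ζ => M.savg z (h ζ)) ξ = M.savg z fun w => P (fun ζ => h ζ w) ξ := by
  simp only [savg_eq]
  rw [end_const_mul, end_sum]

/-! ### Expectations along the dynamic walk -/

/-- The expectation of `f (X_j)` for the walk started from the configuration `ξ` and the half-edge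
`y`. -/
noncomputable def walkExp (f : M.HalfEdge → ℝ) : ℕ → M.Conf → M.HalfEdge → ℝ
  | 0, _, y => f y
  | j + 1, ξ, y => M.dyn (fun ζ => M.savg (ζ.1 y) (walkExp f j ζ)) ξ

/-- Each step preserves the counting measure, whatever the configuration. Hence a centred `f` stays
centred along the walk, as `symmetrization` requires. -/
theorem sum_walkExp (f : M.HalfEdge → ℝ) (j : ℕ) (ξ : M.Conf) :
    ∑ y, walkExp f j ξ y = ∑ y, f y := by
  induction j generalizing ξ with
  | zero => rfl
  | succ j ih =>
    simp only [walkExp]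
    rw [← end_sum, ← isMarkov_dyn.const (∑ y, f y) ξ]
    refine end_congr _ (fun ζ => ?_) ξ
    rw [sum_conf ζ fun z => M.savg z (walkExp f j ζ), sum_savg, ih]

theorem abs_walkExp_le {f : M.HalfEdge → ℝ} {K : ℝ} (hf : ∀ y, |f y| ≤ K) (j : ℕ) (ξ : M.Conf)
    (y : M.HalfEdge) : |walkExp f j ξ y| ≤ K := by
  induction j generalizing ξ y with
  | zero => exact hf y
  | succ j ih =>
    rw [walkExp]
    refine (isMarkov_dyn.abs_le _ ξ).trans (isMarkov_dyn.le_const (fun ζ => ?_) ξ)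
    exact (abs_savg_le _ _).trans (savg_le fun w _ => ih ζ w)

theorem mem_replicate_isMarkov {j : ℕ} : ∀ P ∈ List.replicate j M.dyn, IsMarkov P := by
  intro P hP
  rw [List.eq_of_mem_replicate hP]
  exact isMarkov_dyn

/-- Relabelling half-edges in `D` affects the walk only if it uses a half-edge in `D`. -/
theorem abs_walkExp_conj_sub_le {f : M.HalfEdge → ℝ} {K : ℝ} (hf : ∀ y, |f y| ≤ K)
    {D : Finset M.HalfEdge} {π : Equiv.Perm M.HalfEdge} (hπ : ∀ x, x ∉ D → π x = x) (j : ℕ)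
    (ξ : M.Conf) (y : M.HalfEdge) :
    |walkExp f j (conj π ξ) y - walkExp f j ξ y|
      ≤ 2 * K * hit (List.replicate j M.dyn) D ξ y := by
  induction j generalizing ξ y with
  | zero => simp [walkExp, hit]
  | succ j ih =>
    have hK : ∀ (i : ℕ) (ζ ζ' : M.Conf) (w w' : M.HalfEdge),
        |walkExp f i ζ w - walkExp f i ζ' w'| ≤ 2 * K := by
      intro i ζ ζ' w w'
      have h1 := abs_le.1 (abs_walkExp_le hf i ζ w)
      have h2 := abs_le.1 (abs_walkExp_le hf i ζ' w')
      rw [abs_le]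
      constructor <;> linarith
    rw [List.replicate_succ, hit]
    split_ifs with hy
    · rw [mul_one]
      exact hK _ _ _ _ _
    · simp only [walkExp]
      rw [← isMarkov_dyn.eqv, ← end_sub, ← end_const_mul]
      refine (isMarkov_dyn.abs_le _ ξ).trans (isMarkov_dyn.mono (fun ζ => ?_) ξ)
      rw [conj_apply_of_fixed _ (hπ y hy)]
      split_ifs with h1
      · have hs : ∀ (z : M.HalfEdge) (θ : M.Conf), |M.savg z (walkExp f j θ)| ≤ K := fun z θ =>
          (abs_savg_le _ _).trans (savg_le fun w _ => abs_walkExp_le hf j θ w)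
        have h2 := abs_le.1 (hs (π (ζ.1 y)) (conj π ζ))
        have h3 := abs_le.1 (hs (ζ.1 y) ζ)
        rw [abs_le]
        constructor <;> linarith
      · rw [hπ _ h1, ← savg_sub, ← savg_const_mul]
        exact (abs_savg_le _ _).trans (savg_mono fun w _ => ih ζ w)

/-! ### Returns to the initial edge -/

/-- For the walk that starts from a sibling of `a` with the configuration `ζ`, the probability of
using `a` or its partner `ξ a` within `j` steps, summed over `a`. -/
noncomputable def returns (j : ℕ) (ξ ζ : M.Conf) : ℝ :=
  ∑ a, M.savg a (hit (List.replicate j M.dyn) {a, ξ.1 a} ζ)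

theorem returns_nonneg (j : ℕ) (ξ ζ : M.Conf) : 0 ≤ returns j ξ ζ :=
  Finset.sum_nonneg fun _ _ => savg_nonneg fun _ _ => (hit_mem_Icc mem_replicate_isMarkov _ _ _).1

/-- Every later position shares its vertex with the preceding partner, so `D` cannot be used without
a partner at a vertex of `V`. -/
theorem hit_le_revisit {Ps : List (Module.End ℝ (M.Conf → ℝ))} (hPs : ∀ P ∈ Ps, IsMarkov P)
    {D : Finset M.HalfEdge} {V : Finset (Fin n)} (hD : ∀ x ∈ D, x.1 ∈ V) (ξ : M.Conf)
    {y : M.HalfEdge} (hy : y ∉ D) : hit Ps D ξ y ≤ revisit Ps V ξ y := by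
  induction Ps generalizing V ξ y with
  | nil => simp [hit, revisit]
  | cons P Ps ih =>
    have hP := hPs P (by simp)
    have hPs' : ∀ Q ∈ Ps, IsMarkov Q := fun Q hQ => hPs Q (by simp [hQ])
    rw [hit, if_neg hy, revisit]
    refine hP.mono (fun ζ => ?_) ξ
    by_cases h1 : (ζ.1 y).1 ∈ V
    · rw [if_pos h1]
      split_ifs
      · exact le_rfl
      · exact savg_le fun w _ => (hit_mem_Icc hPs' _ _ _).2
    · rw [if_neg h1, if_neg fun h => h1 (hD _ h)]
      refine savg_mono fun w hw => ?_
      refine ih hPs' (fun x hx => by simp [hD x hx]) ζ fun h => h1 ?_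
      rw [← (M.mem_siblings.1 hw).1]
      exact hD _ h

/-- Prepend the crossing of the edge from `ξ a` to `a` to the walk from a sibling of `a`. A later
use of `a` or `ξ a` then repeats a vertex of this longer walk, and `sum_revisit_le` applies. -/
theorem sum_pow_returns_le (i j : ℕ) :
    ∑ ξ, (M.dyn ^ i) (returns j ξ) ξ
      ≤ Fintype.card M.Conf * ((j + 1) ^ 2 * (4 * M.nu + 6)) := by
  have hnu := M.nu_nonneg
  rcases j with _ | j
  · have : ∀ ξ : M.Conf, (M.dyn ^ i) (returns 0 ξ) ξ = 0 := by
      intro ξ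
      rw [show returns 0 ξ = fun _ => 0 from ?_, (isMarkov_dyn.pow i).const]
      ext ζ
      simp [returns, hit, savg_const]
    rw [Finset.sum_eq_zero fun ξ _ => this ξ]
    positivity
  -- The first crossing takes place in `ξ` itself, hence `1`; the `i` idle steps merge with the
  -- first dynamic step of the walk into `dyn ^ (i + 1)`.
  have hPs : ∀ P ∈ (1 : Module.End ℝ (M.Conf → ℝ)) :: M.dyn ^ (i + 1) :: List.replicate j M.dyn,
      IsMarkov P := by
    intro P hP
    simp only [List.mem_cons] at hP
    rcases hP with rfl | rfl | hP
    · exact IsMarkov.one'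
    · exact isMarkov_dyn.pow _
    · exact mem_replicate_isMarkov P hP
  have h1 : ∀ ξ : M.Conf, (M.dyn ^ i) (returns (j + 1) ξ) ξ
      ≤ ∑ y, revisit (1 :: M.dyn ^ (i + 1) :: List.replicate j M.dyn) {y.1} ξ y := by
    intro ξ
    change (M.dyn ^ i) (fun ζ => ∑ a,
      M.savg a (hit (List.replicate (j + 1) M.dyn) {a, ξ.1 a} ζ)) ξ ≤ _
    rw [end_sum, ← sum_conf ξ]
    refine Finset.sum_le_sum fun y _ => ?_
    rw [conf_conf, end_savg, revisit, Module.End.one_apply]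
    split_ifs with hl
    · refine savg_le fun w _ => (isMarkov_dyn.pow i).le_const (fun ζ => ?_) ξ
      exact (hit_mem_Icc mem_replicate_isMarkov _ _ _).2
    · refine savg_mono fun w hw => ?_
      obtain ⟨hw1, hw2⟩ := M.mem_siblings.1 hw
      have hwD : w ∉ ({ξ.1 y, y} : Finset M.HalfEdge) := by
        simp only [Finset.mem_insert, Finset.mem_singleton, not_or]
        refine ⟨hw2, fun h => hl ?_⟩
        rw [← hw1, h]
        simp
      have e : (M.dyn ^ i) (fun ζ => hit (List.replicate (j + 1) M.dyn) {ξ.1 y, y} ζ w) ξ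
          = hit (M.dyn ^ (i + 1) :: List.replicate j M.dyn) {ξ.1 y, y} ξ w := by
        rw [hit, if_neg hwD, pow_succ, Module.End.mul_apply]
        refine end_congr _ (fun ζ => ?_) ξ
        rw [List.replicate_succ, hit, if_neg hwD]
      rw [e]
      refine hit_le_revisit (fun P hP => hPs P (by simp only [List.mem_cons] at hP ⊢; tauto))
        (fun x hx => ?_) ξ hwD
      simp only [Finset.mem_insert, Finset.mem_singleton] at hx ⊢
      rcases hx with rfl | rfl <;> simp
  refine (Finset.sum_le_sum fun ξ _ => h1 ξ).trans
    ((sum_revisit_le hPs (le_refl _)).trans (le_of_eq ?_))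
  simp only [List.length_cons, List.length_replicate]
  push_cast
  ring

/-! ### The partner of a rewired half-edge is almost uniform -/

/-- Symmetrisation: `g ζ (ζ u)` is replaced by the average of `g` over the partner of `u`. -/
theorem symmetrization {T : Module.End ℝ (M.Conf → ℝ)} {S : Finset M.HalfEdge}
    (hT0 : ∀ φ : M.Conf → ℝ, (∀ ζ, 0 ≤ φ ζ) → ∀ ξ, 0 ≤ T φ ξ)
    (hTS : ∀ π : Equiv.Perm M.HalfEdge, (∀ x ∈ S, π x = x) → ∀ (φ : M.Conf → ℝ) (ξ : M.Conf),
      T (fun ζ => φ (conj π ζ)) ξ = T φ (conj π ξ))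
    {u : M.HalfEdge} (hu : u ∈ S) {g : M.Conf → M.HalfEdge → ℝ} {K : ℝ}
    (hK : ∀ ζ a, |g ζ a| ≤ K) (hg : ∀ ζ, ∑ a, g ζ a = 0) (ξ : M.Conf) {U : Finset M.HalfEdge}
    (hU : U = S ∪ S.image ξ.1) :
    ((M.ell : ℝ) - U.card) * |T (fun ζ => g ζ (ζ.1 u)) ξ|
      ≤ M.ell * (K * T (fun ζ => if ζ.1 u ∈ U then 1 else 0) ξ)
        + T (fun ζ => K * U.card
            + ∑ b, |g (conj (edgeSwap ξ (ζ.1 u) b) ζ) b - g ζ b|) ξ := by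
  have hmono : ∀ φ ψ : M.Conf → ℝ, (∀ ζ, φ ζ ≤ ψ ζ) → T φ ξ ≤ T ψ ξ := by
    intro φ ψ h
    have := hT0 (fun ζ => ψ ζ - φ ζ) (fun ζ => sub_nonneg.2 (h ζ)) ξ
    rw [end_sub] at this
    linarith
  have habs : ∀ φ ψ : M.Conf → ℝ, (∀ ζ, |φ ζ| ≤ ψ ζ) → |T φ ξ| ≤ T ψ ξ := by
    intro φ ψ h
    rw [abs_le]
    constructor
    · have := hmono (fun ζ => (-1) * ψ ζ) φ fun ζ => by linarith [(abs_le.1 (h ζ)).1]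
      rw [end_const_mul] at this
      linarith
    · exact hmono _ _ fun ζ => (abs_le.1 (h ζ)).2
  have hcard : ((M.ell : ℝ) - U.card) = (Uᶜ : Finset M.HalfEdge).card := by
    rw [Finset.card_compl, card_halfEdge, Nat.cast_sub]
    rw [← card_halfEdge]
    exact Finset.card_le_univ U
  -- This is why `U` contains the partners of `S`: off `U`, an exchange of edges moves nothing in
  -- `S`.
  have hfix : ∀ a ∉ U, ∀ b ∉ U, ∀ x ∈ S, edgeSwap ξ a b x = x := by
    intro a ha b hb x hx
    simp only [hU, Finset.mem_union, Finset.mem_image, not_or, not_exists, not_and] at ha hb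
    refine edgeSwap_fixed ξ (fun h => ha.1 (h ▸ hx)) (fun h => hb.1 (h ▸ hx))
      (fun h => ha.2 x hx (by rw [h, conf_conf])) (fun h => hb.2 x hx (by rw [h, conf_conf]))
  have hsplit : T (fun ζ => g ζ (ζ.1 u)) ξ
      = T (fun ζ => if ζ.1 u ∈ U then g ζ (ζ.1 u) else 0) ξ
        + ∑ b ∈ Uᶜ, T (fun ζ => if ζ.1 u = b then g ζ b else 0) ξ := by
    rw [← end_sum, ← end_add]
    refine end_congr _ (fun ζ => ?_) ξ
    rw [Finset.sum_ite_eq]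
    by_cases h : ζ.1 u ∈ U <;> simp [h]
  -- The exchange fixes `ξ` and commutes with `T`, so the partners `a` and `b` of `u` are equally
  -- likely, up to relabelling `ζ`.
  have hswap : ∀ a ∈ Uᶜ, ∀ b ∈ Uᶜ, T (fun ζ => if ζ.1 u = b then g ζ b else 0) ξ
      = T (fun ζ => if ζ.1 u = a then g (conj (edgeSwap ξ a b) ζ) b else 0) ξ := by
    intro a ha b hb
    rw [Finset.mem_compl] at ha hb
    conv_lhs => rw [← conj_edgeSwap ξ a b, ← hTS _ (hfix a ha b hb)]
    refine end_congr _ (fun ζ => ?_) ξ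
    rw [conj_apply_of_fixed _ (hfix a ha b hb u hu)]
    congr 1
    rw [eq_iff_iff]
    refine ⟨fun h => (edgeSwap ξ a b).injective (h.trans (edgeSwap_left ξ a b).symm), ?_⟩
    rintro rfl
    exact edgeSwap_left ξ _ b
  -- Summation over `a` leaves only `a = ζ u`, and `b` has become a free variable.
  have hmain : ((M.ell : ℝ) - U.card) * ∑ b ∈ Uᶜ, T (fun ζ => if ζ.1 u = b then g ζ b else 0) ξ
      = T (fun ζ => if ζ.1 u ∈ U then 0 else
          ∑ b ∈ Uᶜ, g (conj (edgeSwap ξ (ζ.1 u) b) ζ) b) ξ := by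
    rw [hcard, ← nsmul_eq_mul, ← Finset.sum_const]
    rw [Finset.sum_congr rfl fun a ha => Finset.sum_congr rfl fun b hb => hswap a ha b hb]
    simp only [← end_sum]
    refine end_congr _ (fun ζ => ?_) ξ
    have : ∀ a, (∑ b ∈ Uᶜ, if ζ.1 u = a then g (conj (edgeSwap ξ a b) ζ) b else 0)
        = if ζ.1 u = a then ∑ b ∈ Uᶜ, g (conj (edgeSwap ξ a b) ζ) b else 0 := by
      intro a
      split_ifs <;> simp
    simp only [this]
    rw [Finset.sum_ite_eq]
    by_cases h : ζ.1 u ∈ U <;> simp [h]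
  have e1 : |T (fun ζ => if ζ.1 u ∈ U then g ζ (ζ.1 u) else 0) ξ|
      ≤ K * T (fun ζ => if ζ.1 u ∈ U then 1 else 0) ξ := by
    rw [← end_const_mul]
    refine habs _ _ fun ζ => ?_
    split_ifs
    · rw [mul_one]
      exact hK _ _
    · simp
  have hK0 : 0 ≤ K := (abs_nonneg _).trans (hK ξ u)
  have e2 : |T (fun ζ => if ζ.1 u ∈ U then 0 else
          ∑ b ∈ Uᶜ, g (conj (edgeSwap ξ (ζ.1 u) b) ζ) b) ξ|
      ≤ T (fun ζ => K * U.card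
            + ∑ b, |g (conj (edgeSwap ξ (ζ.1 u) b) ζ) b - g ζ b|) ξ := by
    refine habs _ _ fun ζ => ?_
    have hnn : 0 ≤ ∑ b, |g (conj (edgeSwap ξ (ζ.1 u) b) ζ) b - g ζ b| :=
      Finset.sum_nonneg fun _ _ => abs_nonneg _
    split_ifs
    · rw [abs_zero]
      positivity
    -- Since `g ζ` has sum zero, its sum off `U` is of size at most `K * U.card`; what remains is
    -- the effect of the relabelling.
    · have h1 : ∑ b ∈ Uᶜ, g ζ b = -∑ b ∈ U, g ζ b := by
        have := Finset.sum_add_sum_compl U (g ζ)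
        rw [hg] at this
        linarith
      have h2 : ∑ b ∈ Uᶜ, g (conj (edgeSwap ξ (ζ.1 u) b) ζ) b
          = -∑ b ∈ U, g ζ b
            + ∑ b ∈ Uᶜ, (g (conj (edgeSwap ξ (ζ.1 u) b) ζ) b - g ζ b) := by
        rw [Finset.sum_sub_distrib, h1]
        ring
      rw [h2]
      refine (abs_add_le _ _).trans (add_le_add ?_ ?_)
      · rw [abs_neg]
        refine (Finset.abs_sum_le_sum_abs _ _).trans ((Finset.sum_le_sum fun b _ => hK ζ b).trans ?_)
        rw [Finset.sum_const, nsmul_eq_mul, mul_comm]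
      · refine (Finset.abs_sum_le_sum_abs _ _).trans ?_
        exact Finset.sum_le_sum_of_subset_of_nonneg (Finset.subset_univ _)
          fun _ _ _ => abs_nonneg _
  have e3 : (0 : ℝ) ≤ (M.ell : ℝ) - U.card := by rw [hcard]; positivity
  have e4 : ((M.ell : ℝ) - U.card) * |T (fun ζ => if ζ.1 u ∈ U then g ζ (ζ.1 u) else 0) ξ|
      ≤ M.ell * (K * T (fun ζ => if ζ.1 u ∈ U then 1 else 0) ξ) := by
    refine mul_le_mul ?_ e1 (abs_nonneg _) (by positivity)
    have : (0 : ℝ) ≤ U.card := by positivity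
    linarith
  rw [hsplit]
  calc ((M.ell : ℝ) - U.card) * |T (fun ζ => if ζ.1 u ∈ U then g ζ (ζ.1 u) else 0) ξ
        + ∑ b ∈ Uᶜ, T (fun ζ => if ζ.1 u = b then g ζ b else 0) ξ|
      ≤ ((M.ell : ℝ) - U.card) * (|T (fun ζ => if ζ.1 u ∈ U then g ζ (ζ.1 u) else 0) ξ|
        + |∑ b ∈ Uᶜ, T (fun ζ => if ζ.1 u = b then g ζ b else 0) ξ|) :=
        mul_le_mul_of_nonneg_left (abs_add_le _ _) e3
    _ = ((M.ell : ℝ) - U.card) * |T (fun ζ => if ζ.1 u ∈ U then g ζ (ζ.1 u) else 0) ξ|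
        + |((M.ell : ℝ) - U.card) * ∑ b ∈ Uᶜ, T (fun ζ => if ζ.1 u = b then g ζ b else 0) ξ| := by
        rw [mul_add, abs_mul, abs_of_nonneg e3]
    _ ≤ _ := by
        rw [hmain]
        exact add_le_add e4 e2

/-! ### Dynamics restricted by which half-edges are rewired -/

/-- One step of the configuration dynamics without rewiring half-edges in `B`. -/
noncomputable def avoid (B : Finset M.HalfEdge) : Module.End ℝ (M.Conf → ℝ) :=
  ker fun R => Disjoint R B

/-- One step of the configuration dynamics without rewiring half-edges in `B`, but rewiring `u`. -/
noncomputable def avoidRewire (B : Finset M.HalfEdge) (u : M.HalfEdge) :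
    Module.End ℝ (M.Conf → ℝ) :=
  ker fun R => Disjoint R B ∧ u ∈ R

theorem avoid_eq_add (B : Finset M.HalfEdge) (u : M.HalfEdge) (φ : M.Conf → ℝ) (ξ : M.Conf) :
    avoid B φ ξ = avoid (insert u B) φ ξ + avoidRewire B u φ ξ := by
  simp only [avoid, avoidRewire, ker_apply]
  rw [← Finset.expect_add_distrib]
  refine Finset.expect_congr rfl fun R _ => ?_
  by_cases h1 : Disjoint R B <;> by_cases h2 : u ∈ R <;> simp [h1, h2]

/-- Operators describing `j` steps of the dynamics restricted to an event that depends only on which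
half-edges in `S` are rewired, and excludes that `u` is rewired. -/
structure IsRestriction (S : Finset M.HalfEdge) (u : M.HalfEdge) (j : ℕ)
    (T : Module.End ℝ (M.Conf → ℝ)) : Prop where
  nonneg : ∀ φ : M.Conf → ℝ, (∀ ζ, 0 ≤ φ ζ) → ∀ ξ, 0 ≤ T φ ξ
  le : ∀ φ : M.Conf → ℝ, (∀ ζ, 0 ≤ φ ζ) → ∀ ξ, T φ ξ ≤ (M.dyn ^ j) φ ξ
  eqv : ∀ π : Equiv.Perm M.HalfEdge, (∀ x ∈ S, π x = x) → ∀ (φ : M.Conf → ℝ) (ξ : M.Conf),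
    T (fun ζ => φ (conj π ζ)) ξ = T φ (conj π ξ)
  keep : ∀ (a : M.HalfEdge) (ξ : M.Conf),
    T (fun ζ => if ζ.1 u = a then 1 else 0) ξ ≤ if ξ.1 u = a then 1 else 0

theorem isRestriction_one (S : Finset M.HalfEdge) (u : M.HalfEdge) : IsRestriction S u 0 1 where
  nonneg _ h ξ := h ξ
  le _ _ _ := le_rfl
  eqv _ _ _ _ := rfl
  keep _ _ := le_rfl

theorem mem_map_iff_of_fixed {π : Equiv.Perm M.HalfEdge} {x : M.HalfEdge} (h : π x = x)
    (R : Finset M.HalfEdge) : x ∈ R.map π.toEmbedding ↔ x ∈ R := by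
  conv_lhs => rw [← h]
  simp

theorem disjoint_map_iff {π : Equiv.Perm M.HalfEdge} {B : Finset M.HalfEdge}
    (h : ∀ x ∈ B, π x = x) (R : Finset M.HalfEdge) :
    Disjoint (R.map π.toEmbedding) B ↔ Disjoint R B := by
  rw [Finset.disjoint_right, Finset.disjoint_right]
  exact forall₂_congr fun x hx => by rw [mem_map_iff_of_fixed (h x hx)]

theorem ker_le_dyn (c : Finset M.HalfEdge → Prop) [DecidablePred c] {φ ψ : M.Conf → ℝ}
    (h : ∀ ζ, φ ζ ≤ ψ ζ) (h0 : ∀ ζ, 0 ≤ ψ ζ) (ξ : M.Conf) : ker c φ ξ ≤ M.dyn ψ ξ := by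
  rw [dyn]
  exact ker_mono (fun _ _ => trivial) h h0 ξ

theorem dyn_pow_le {T : Module.End ℝ (M.Conf → ℝ)} {j : ℕ}
    (hT0 : ∀ φ : M.Conf → ℝ, (∀ ζ, 0 ≤ φ ζ) → ∀ ξ, 0 ≤ T φ ξ)
    (hT : ∀ φ : M.Conf → ℝ, (∀ ζ, 0 ≤ φ ζ) → ∀ ξ, T φ ξ ≤ (M.dyn ^ j) φ ξ)
    (c : Finset M.HalfEdge → Prop) [DecidablePred c] (φ : M.Conf → ℝ) (hφ : ∀ ζ, 0 ≤ φ ζ)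
    (ξ : M.Conf) : (ker c * T) φ ξ ≤ (M.dyn ^ (j + 1)) φ ξ := by
  rw [Module.End.mul_apply, pow_succ', Module.End.mul_apply]
  exact ker_le_dyn c (fun ζ => hT φ hφ ζ) (fun ζ => (hT0 φ hφ ζ).trans (hT φ hφ ζ)) ξ

/-- Prepends a step in which `u` is kept: `u ∈ B` preserves its partner, and `B ⊆ S` preserves
equivariance under permutations fixing `S`. -/
theorem IsRestriction.avoid_mul {S : Finset M.HalfEdge} {u : M.HalfEdge} {j : ℕ}
    {T : Module.End ℝ (M.Conf → ℝ)} (hT : IsRestriction S u j T) {B : Finset M.HalfEdge}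
    (hB : B ⊆ S) (hu : u ∈ B) : IsRestriction S u (j + 1) (avoid B * T) where
  nonneg φ h ξ := by
    rw [Module.End.mul_apply, avoid]
    exact ker_nonneg _ (hT.nonneg φ h) ξ
  le φ h ξ := by
    rw [avoid]
    exact dyn_pow_le hT.nonneg hT.le _ φ h ξ
  eqv π hπ φ ξ := by
    rw [Module.End.mul_apply, Module.End.mul_apply, avoid,
      ← ker_conj (disjoint_map_iff fun x hx => hπ x (hB hx))]
    exact end_congr _ (hT.eqv π hπ φ) ξ
  keep a ξ := by
    rw [Module.End.mul_apply, avoid]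
    have h1 : (0 : ℝ) ≤ if ξ.1 u = a then 1 else 0 := by split_ifs <;> norm_num
    calc ker (fun R => Disjoint R B) (T fun ζ => if ζ.1 u = a then 1 else 0) ξ
        ≤ ker (fun R => Disjoint R B) (fun ζ => if ζ.1 u = a then 1 else 0) ξ :=
          ker_mono (fun _ h => h) (fun ζ => hT.keep a ζ)
            (fun ζ => by split_ifs <;> norm_num) ξ
      _ = ker (fun R => Disjoint R B) (fun _ => if ξ.1 u = a then 1 else 0) ξ :=
          ker_congr fun R hR ζ hζ => by
            simp only [hζ u (Finset.disjoint_right.1 hR hu)]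
      _ ≤ M.dyn (fun _ => if ξ.1 u = a then 1 else 0) ξ :=
          ker_le_dyn _ (fun _ => le_rfl) (fun _ => h1) ξ
      _ = _ := isMarkov_dyn.const _ ξ

theorem avoidRewire_partner_le (B : Finset M.HalfEdge) (u a : M.HalfEdge) (ξ : M.Conf) :
    avoidRewire B u (fun ζ => if ζ.1 u = a then 1 else 0) ξ ≤ 1 / (2 * M.k - 1) := by
  rw [avoidRewire, ker_apply]
  refine Finset.expect_le (rewirings_nonempty ξ) fun R hR => ?_
  split_ifs with h
  · exact expect_repairings_partner_le hR h.2 a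
  · have : (2 : ℝ) ≤ M.k := by exact_mod_cast M.two_le_k
    exact div_nonneg zero_le_one (by linarith)

/-- After crossing a rewired edge, the walk is almost uniformly distributed, up to the probability
of returning to that edge. -/
theorem abs_avoidRewire_le {S B : Finset M.HalfEdge} {u : M.HalfEdge} {i : ℕ}
    {T : Module.End ℝ (M.Conf → ℝ)} (hT : IsRestriction S u i T) (hB : B ⊆ S) (hu : u ∈ S) {s : ℕ}
    (hs : S.card ≤ s) (hsl : 4 * s ≤ M.ell) {f : M.HalfEdge → ℝ} {K : ℝ} (hf : ∀ y, |f y| ≤ K)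
    (hf0 : ∑ y, f y = 0) (j : ℕ) (ξ : M.Conf) :
    |avoidRewire B u (T fun ζ => M.savg (ζ.1 u) (walkExp f j ζ)) ξ|
      ≤ 2 * K * (2 * s / (2 * M.k - 1)
        + (2 * s + 8 * j + 2 * (M.dyn ^ (i + 1)) (returns j ξ) ξ) / M.ell) := by
  have hell : (0 : ℝ) < M.ell := by exact_mod_cast M.ell_pos
  have hk : (0 : ℝ) < 2 * M.k - 1 := by
    have : (2 : ℝ) ≤ M.k := by exact_mod_cast M.two_le_k
    linarith
  have hK0 : 0 ≤ K := (abs_nonneg _).trans (hf u)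
  obtain ⟨U, hU⟩ : ∃ U, U = S ∪ S.image ξ.1 := ⟨_, rfl⟩
  have hUc : U.card ≤ 2 * s := by
    rw [hU]
    refine (Finset.card_union_le _ _).trans ?_
    have := Finset.card_image_le (s := S) (f := ξ.1)
    omega
  have hUr : (U.card : ℝ) ≤ 2 * s := by exact_mod_cast hUc
  have hslr : (4 * s : ℝ) ≤ M.ell := by exact_mod_cast hsl
  have h := symmetrization (T := avoidRewire B u * T) (S := S)
    (fun φ hφ ξ => by
      rw [Module.End.mul_apply, avoidRewire]
      exact ker_nonneg _ (hT.nonneg φ hφ) ξ)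
    (fun π hπ φ ξ => by
      rw [Module.End.mul_apply, Module.End.mul_apply, avoidRewire, ← ker_conj (π := π)]
      · exact end_congr _ (hT.eqv π hπ φ) ξ
      · intro R
        rw [disjoint_map_iff fun x hx => hπ x (hB hx), mem_map_iff_of_fixed (hπ u hu)])
    hu (g := fun ζ a => M.savg a (walkExp f j ζ)) (K := K)
    (fun ζ a => (abs_savg_le _ _).trans (savg_le fun w _ => abs_walkExp_le hf j ζ w))
    (fun ζ => by rw [sum_savg, sum_walkExp, hf0]) ξ hU
  -- When `u` is rewired, each given partner has probability at most `1/(2k - 1)`; by `keep` the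
  -- steps in `T` do not change this partner.
  have e1 : (avoidRewire B u * T) (fun ζ => if ζ.1 u ∈ U then 1 else 0) ξ
      ≤ 2 * s / (2 * M.k - 1) := by
    have h1 : ∀ a, (avoidRewire B u * T) (fun ζ => if ζ.1 u = a then 1 else 0) ξ
        ≤ 1 / (2 * M.k - 1) := by
      intro a
      rw [Module.End.mul_apply]
      refine le_trans ?_ (avoidRewire_partner_le B u a ξ)
      rw [avoidRewire]
      exact ker_mono (fun _ h => h) (fun ζ => hT.keep a ζ)
        (fun ζ => by split_ifs <;> norm_num) ξ
    have h2 : (avoidRewire B u * T) (fun ζ => if ζ.1 u ∈ U then 1 else 0) ξ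
        = ∑ a ∈ U, (avoidRewire B u * T) (fun ζ => if ζ.1 u = a then 1 else 0) ξ := by
      rw [← end_sum]
      refine end_congr _ (fun ζ => ?_) ξ
      rw [Finset.sum_ite_eq]
    rw [h2]
    refine (Finset.sum_le_sum fun a _ => h1 a).trans ?_
    rw [Finset.sum_const, nsmul_eq_mul, mul_one_div]
    gcongr
  -- The relabelling matters only if the walk uses `b`, `ξ b`, `a` or `ξ a`. Summed over `b`, the
  -- fixed targets `a` and `ξ a` cost at most `2j` each, and the first two make up `returns`.
  have e2 : ∀ ζ : M.Conf, ∑ b, |M.savg b (walkExp f j (conj (edgeSwap ξ (ζ.1 u) b) ζ))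
      - M.savg b (walkExp f j ζ)| ≤ 2 * K * (returns j ξ ζ + 4 * j) := by
    intro ζ
    obtain ⟨a, ha⟩ : ∃ a, a = ζ.1 u := ⟨_, rfl⟩
    rw [← ha]
    have h1 : ∀ b, |M.savg b (walkExp f j (conj (edgeSwap ξ a b) ζ)) - M.savg b (walkExp f j ζ)|
        ≤ 2 * K * (M.savg b (hit (List.replicate j M.dyn) {b, ξ.1 b} ζ)
          + M.savg b (hit (List.replicate j M.dyn) {a} ζ)
          + M.savg b (hit (List.replicate j M.dyn) {ξ.1 a} ζ)) := by
      intro b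
      rw [← savg_sub, ← savg_add, ← savg_add, ← savg_const_mul]
      refine (abs_savg_le _ _).trans (savg_mono fun w _ => ?_)
      have hπ : ∀ x, x ∉ (({b, ξ.1 b} : Finset M.HalfEdge) ∪ {a}) ∪ {ξ.1 a} →
          edgeSwap ξ a b x = x := by
        intro x hx
        simp only [Finset.mem_union, Finset.mem_insert, Finset.mem_singleton, not_or] at hx
        exact edgeSwap_fixed ξ hx.1.2 hx.1.1.1 hx.2 hx.1.1.2
      refine (abs_walkExp_conj_sub_le hf hπ j ζ w).trans ?_
      refine mul_le_mul_of_nonneg_left ?_ (by positivity)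
      refine (hit_union_le mem_replicate_isMarkov _ _ ζ w).trans ?_
      gcongr
      exact hit_union_le mem_replicate_isMarkov _ _ ζ w
    refine (Finset.sum_le_sum fun b _ => h1 b).trans ?_
    rw [← Finset.mul_sum, Finset.sum_add_distrib, Finset.sum_add_distrib, sum_savg, sum_savg]
    have h2 := sum_hit_start_le (mem_replicate_isMarkov (M := M) (j := j)) ζ a
    have h3 := sum_hit_start_le (mem_replicate_isMarkov (M := M) (j := j)) ζ (ξ.1 a)
    rw [List.length_replicate] at h2 h3
    refine mul_le_mul_of_nonneg_left ?_ (by positivity)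
    rw [returns]
    linarith
  have e3 : (avoidRewire B u * T) (fun ζ => K * U.card
      + ∑ b, |M.savg b (walkExp f j (conj (edgeSwap ξ (ζ.1 u) b) ζ))
        - M.savg b (walkExp f j ζ)|) ξ
      ≤ K * (2 * s + 8 * j + 2 * (M.dyn ^ (i + 1)) (returns j ξ) ξ) := by
    rw [avoidRewire]
    refine (dyn_pow_le hT.nonneg hT.le _ _ (fun ζ => ?_) ξ).trans ?_
    · exact add_nonneg (by positivity) (Finset.sum_nonneg fun _ _ => abs_nonneg _)
    · have h1 := (isMarkov_dyn.pow (i + 1)).mono (φ := fun ζ => K * U.card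
          + ∑ b, |M.savg b (walkExp f j (conj (edgeSwap ξ (ζ.1 u) b) ζ))
            - M.savg b (walkExp f j ζ)|)
          (ψ := fun ζ => K * (2 * s + 8 * j) + 2 * K * returns j ξ ζ) (fun ζ => by
            have h2 := e2 ζ
            have h3 := mul_le_mul_of_nonneg_left hUr hK0
            linarith) ξ
      refine h1.trans (le_of_eq ?_)
      rw [end_add, (isMarkov_dyn.pow (i + 1)).const, end_const_mul]
      ring
  rw [Module.End.mul_apply] at h
  -- At least half of the half-edges lie outside `U`, because `U.card ≤ 2s ≤ ℓ/2`.
  have e5 : (M.ell : ℝ) / 2 ≤ M.ell - U.card := by linarith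
  have e6 := mul_le_mul_of_nonneg_right e5
    (abs_nonneg (avoidRewire B u (T fun ζ => M.savg (ζ.1 u) (walkExp f j ζ)) ξ))
  have e7 := mul_le_mul_of_nonneg_left (mul_le_mul_of_nonneg_left e1 hK0) hell.le
  have e8 : (M.ell : ℝ) / 2 * |avoidRewire B u (T fun ζ => M.savg (ζ.1 u) (walkExp f j ζ)) ξ|
      ≤ M.ell * (K * (2 * s / (2 * M.k - 1)))
        + K * (2 * s + 8 * j + 2 * (M.dyn ^ (i + 1)) (returns j ξ) ξ) :=
    e6.trans (h.trans (add_le_add e7 e3))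
  have e9 : |avoidRewire B u (T fun ζ => M.savg (ζ.1 u) (walkExp f j ζ)) ξ|
      ≤ (M.ell * (K * (2 * s / (2 * M.k - 1)))
        + K * (2 * s + 8 * j + 2 * (M.dyn ^ (i + 1)) (returns j ξ) ξ)) / (M.ell / 2) := by
    rw [le_div_iff₀ (by positivity), mul_comm]
    exact e8
  refine e9.trans (le_of_eq ?_)
  field_simp

end DynConfModel

/-! ### Expectations with respect to a probability mass function on a finite type -/

/-- Expectation with respect to a probability mass function on a finite type. -/
noncomputable def pmfExp {α : Type*} [Fintype α] (p : PMF α) (F : α → ℝ) : ℝ :=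
  ∑ a, (p a).toReal * F a

section pmfExp

variable {α β : Type*} [Fintype α] [Fintype β]

theorem pmfExp_congr {p : PMF α} {F G : α → ℝ} (h : ∀ a ∈ p.support, F a = G a) :
    pmfExp p F = pmfExp p G := by
  refine Finset.sum_congr rfl fun a _ => ?_
  by_cases ha : p a = 0
  · simp [ha]
  · rw [h a ((p.mem_support_iff a).2 ha)]

theorem pmfExp_bind (p : PMF α) (f : α → PMF β) (F : β → ℝ) :
    pmfExp (p.bind f) F = pmfExp p fun a => pmfExp (f a) F := by
  simp only [pmfExp, PMF.bind_apply, tsum_fintype]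
  have h : ∀ b, (∑ a, p a * f a b).toReal = ∑ a, (p a).toReal * (f a b).toReal := by
    intro b
    rw [ENNReal.toReal_sum fun a _ => ENNReal.mul_ne_top (p.apply_ne_top a) ((f a).apply_ne_top b)]
    simp only [ENNReal.toReal_mul]
  simp only [h, Finset.sum_mul, Finset.mul_sum]
  rw [Finset.sum_comm]
  simp only [mul_assoc]

theorem pmfExp_pure (a : α) (F : α → ℝ) : pmfExp (PMF.pure a) F = F a := by
  classical
  rw [pmfExp, Finset.sum_eq_single a]
  · simp
  · intro b _ hb
    simp [PMF.pure_apply, hb]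
  · simp

theorem pmfExp_map (p : PMF α) (f : α → β) (F : β → ℝ) :
    pmfExp (p.map f) F = pmfExp p fun a => F (f a) := by
  rw [← PMF.bind_pure_comp, pmfExp_bind]
  simp only [Function.comp, pmfExp_pure]

theorem pmfExp_uniformOfFinset {s : Finset α} (hs : s.Nonempty) (F : α → ℝ) :
    pmfExp (PMF.uniformOfFinset s hs) F = 𝔼 a ∈ s, F a := by
  classical
  rw [pmfExp, Finset.expect_eq_sum_div_card, Finset.sum_div,
    ← Finset.sum_subset (Finset.subset_univ s)]
  · refine Finset.sum_congr rfl fun a ha => ?_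
    rw [PMF.uniformOfFinset_apply_of_mem hs ha, ENNReal.toReal_inv, ENNReal.toReal_natCast,
      div_eq_inv_mul]
  · intro a _ ha
    rw [PMF.uniformOfFinset_apply_of_notMem hs ha]
    simp

theorem pmfExp_add (p : PMF α) (F G : α → ℝ) :
    pmfExp p (fun a => F a + G a) = pmfExp p F + pmfExp p G := by
  simp only [pmfExp, mul_add, Finset.sum_add_distrib]

theorem pmfExp_sub (p : PMF α) (F G : α → ℝ) :
    pmfExp p (fun a => F a - G a) = pmfExp p F - pmfExp p G := by
  simp only [pmfExp, mul_sub, Finset.sum_sub_distrib]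

theorem pmfExp_sum {ι : Type*} (s : Finset ι) (p : PMF α) (F : ι → α → ℝ) :
    pmfExp p (fun a => ∑ i ∈ s, F i a) = ∑ i ∈ s, pmfExp p (F i) := by
  simp only [pmfExp, Finset.mul_sum]
  exact Finset.sum_comm

theorem pmfExp_const_mul (p : PMF α) (c : ℝ) (F : α → ℝ) :
    pmfExp p (fun a => c * F a) = c * pmfExp p F := by
  simp only [pmfExp, Finset.mul_sum]
  exact Finset.sum_congr rfl fun a _ => by ring

theorem pmfExp_const (p : PMF α) (c : ℝ) : pmfExp p (fun _ => c) = c := by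
  rw [pmfExp, ← Finset.sum_mul]
  have h : ∑ a, (p a).toReal = 1 := by
    rw [← ENNReal.toReal_sum fun a _ => p.apply_ne_top a, ← tsum_fintype (L := .unconditional α),
      p.tsum_coe, ENNReal.toReal_one]
  rw [h, one_mul]

end pmfExp

namespace DynConfModel

variable {n : ℕ} {M : DynConfModel n}

/-! ### The law of the trajectory -/

theorem pmfExp_step (ξ : M.Conf) (y : M.HalfEdge) (F : M.State → ℝ) :
    pmfExp (M.step ξ y) F = 𝔼 R ∈ M.rewirings ξ, 𝔼 ζ ∈ M.repairings ξ R,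
      M.savg (ζ.1 y) fun z => F (ζ, R, z) := by
  rw [step, pmfExp_bind, pmfExp_uniformOfFinset, ← image_cut,
    Finset.expect_image (cut_injOn_powersetCard ξ)]
  refine Finset.expect_congr rfl fun E _ => ?_
  rw [pmfExp_bind, pmfExp_uniformOfFinset]
  refine Finset.expect_congr rfl fun ζ _ => ?_
  rw [pmfExp_map, pmfExp_uniformOfFinset, savg]

theorem mem_support_step {ξ : M.Conf} {y : M.HalfEdge} {s : M.State}
    (h : s ∈ (M.step ξ y).support) : s.1 ∈ M.repairings ξ s.2.1 := by
  simp only [step, PMF.mem_support_bind_iff, PMF.support_map, Set.mem_image,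
    PMF.mem_support_uniformOfFinset_iff] at h
  obtain ⟨E, -, ζ, hζ, z, -, rfl⟩ := h
  exact hζ

namespace Path

variable {t : ℕ}

/-- The walk has not moved along a previously rewired edge. -/
def Alive (w : M.Path t) : Prop :=
  ∀ s : Fin t, Path.pos w s.castSucc ∉ Path.rewiredUpTo w s.succ

/-- The positions before the last one, most recent first. -/
def past (w : M.Path t) : List M.HalfEdge :=
  (List.ofFn fun i : Fin t => Path.pos w i.castSucc).reverse

/-- The last position. -/
def cur (w : M.Path t) : M.HalfEdge := Path.pos w (Fin.last t)

/-- The last configuration. -/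
def conf (w : M.Path t) : M.Conf := (w (Fin.last t)).1

/-- All half-edges rewired so far. -/
def rewiredSet (w : M.Path t) : Set M.HalfEdge := Path.rewiredUpTo w (Fin.last t)

/-- Extension of a trajectory by one state. -/
def extend (w : M.Path t) (s : M.State) : M.Path (t + 1) := (Fin.snoc w s : Fin (t + 2) → M.State)

theorem extend_castSucc (w : M.Path t) (s : M.State) (i : Fin (t + 1)) :
    extend w s i.castSucc = w i := Fin.snoc_castSucc (α := fun _ => M.State) s w i

theorem extend_last (w : M.Path t) (s : M.State) : extend w s (Fin.last (t + 1)) = s :=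
  Fin.snoc_last (α := fun _ => M.State) s w

theorem rewiredUpTo_extend_castSucc (w : M.Path t) (s : M.State) (i : Fin (t + 1)) :
    Path.rewiredUpTo (extend w s) i.castSucc = Path.rewiredUpTo w i := by
  ext h
  simp only [rewiredUpTo, Set.mem_ofPred_eq, rewired]
  constructor
  · rintro ⟨r, hr0, hri, hh⟩
    induction r using Fin.lastCases with
    | last => exact absurd (lt_of_le_of_lt hri (Fin.castSucc_lt_last i)) (lt_irrefl _)
    | cast r =>
      rw [extend_castSucc] at hh
      exact ⟨r, Fin.castSucc_lt_castSucc_iff.1 hr0, Fin.castSucc_le_castSucc_iff.1 hri, hh⟩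
  · rintro ⟨r, hr0, hri, hh⟩
    refine ⟨r.castSucc, Fin.castSucc_lt_castSucc_iff.2 hr0,
      Fin.castSucc_le_castSucc_iff.2 hri, ?_⟩
    rwa [extend_castSucc]

theorem rewiredSet_extend (w : M.Path t) (s : M.State) :
    rewiredSet (extend w s) = rewiredSet w ∪ (s.2.1 : Set M.HalfEdge) := by
  ext h
  simp only [rewiredSet, rewiredUpTo, Set.mem_ofPred_eq, rewired, Set.mem_union, Finset.mem_coe]
  constructor
  · rintro ⟨r, hr0, hri, hh⟩
    induction r using Fin.lastCases with
    | last =>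
      rw [extend_last] at hh
      exact Or.inr hh
    | cast r =>
      rw [extend_castSucc] at hh
      exact Or.inl ⟨r, Fin.castSucc_lt_castSucc_iff.1 hr0, Fin.le_last r, hh⟩
  · rintro (⟨r, hr0, hri, hh⟩ | hh)
    · refine ⟨r.castSucc, Fin.castSucc_lt_castSucc_iff.2 hr0, Fin.le_last _, ?_⟩
      rwa [extend_castSucc]
    · exact ⟨Fin.last _, Fin.last_pos, le_rfl, by rwa [extend_last]⟩

theorem cur_extend (w : M.Path t) (s : M.State) : cur (extend w s) = s.2.2 := by
  rw [cur, pos, extend_last]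

theorem conf_extend (w : M.Path t) (s : M.State) : conf (extend w s) = s.1 := by
  rw [conf, extend_last]

theorem pos_extend_castSucc (w : M.Path t) (s : M.State) (i : Fin (t + 1)) :
    Path.pos (extend w s) i.castSucc = Path.pos w i := by
  rw [pos, extend_castSucc, pos]

theorem past_extend (w : M.Path t) (s : M.State) : past (extend w s) = cur w :: past w := by
  rw [past, List.ofFn_succ', List.concat_eq_append, List.reverse_concat']
  simp only [pos_extend_castSucc]
  rfl

/-- The new condition concerns the old position, checked against all rewirings including the new
one, because `tau` compares `X_{s-1}` with `R_{≤ s}`. -/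
theorem alive_extend (w : M.Path t) (s : M.State) :
    Alive (extend w s) ↔ Alive w ∧ cur w ∉ rewiredSet w ∧ cur w ∉ s.2.1 := by
  have h : cur w ∉ rewiredSet (extend w s) ↔ cur w ∉ rewiredSet w ∧ cur w ∉ s.2.1 := by
    rw [rewiredSet_extend]
    simp
  rw [← h, Alive, Fin.forall_fin_succ']
  simp only [pos_extend_castSucc, Fin.succ_castSucc, rewiredUpTo_extend_castSucc, Fin.succ_last]
  rfl

/-- Every recorded time is at most `t`, and the infimum of the empty set is `⊤`. -/
theorem le_tau_iff (w : M.Path t) : (t : ℕ∞) < Path.tau w ↔ Alive w := by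
  constructor
  · intro h s hs
    refine absurd (lt_of_lt_of_le h (sInf_le ⟨s, hs, rfl⟩)) (not_lt.2 ?_)
    exact_mod_cast s.2
  · intro h
    have : {r : ℕ∞ | ∃ s : Fin t,
        Path.pos w s.castSucc ∈ Path.rewiredUpTo w s.succ ∧ r = ((s : ℕ) + 1 : ℕ)} = ∅ := by
      ext r
      simp only [Set.mem_ofPred_eq, Set.mem_empty_iff_false, iff_false, not_exists, not_and]
      exact fun s hs => absurd hs (h s)
    rw [tau, this, sInf_empty]
    exact ENat.natCast_lt_top t

end Path

open DynConfModel.Path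

/-- Expectation for the chain started from `(η, x)`, for functions of the trajectory up to `t`. -/
noncomputable def pathExp (η : M.Conf) (x : M.HalfEdge) (t : ℕ) (F : M.Path t → ℝ) : ℝ :=
  pmfExp (M.pathLaw η x t) F

theorem pathExp_zero (η : M.Conf) (x : M.HalfEdge) (F : M.Path 0 → ℝ) :
    pathExp η x 0 F = F fun _ => (η, ∅, x) := by
  rw [pathExp, pathLaw, pmfExp_pure]

theorem pathExp_succ (η : M.Conf) (x : M.HalfEdge) (t : ℕ) (F : M.Path (t + 1) → ℝ) :
    pathExp η x (t + 1) F = pathExp η x t fun w => 𝔼 R ∈ M.rewirings (conf w),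
      𝔼 ζ ∈ M.repairings (conf w) R, M.savg (ζ.1 (cur w)) fun z => F (extend w (ζ, R, z)) := by
  rw [pathExp, pathLaw, pmfExp_bind, pathExp]
  refine pmfExp_congr fun w _ => ?_
  rw [pmfExp_map, pmfExp_step]
  rfl

/-- A half-edge that was never rewired keeps its initial partner. -/
theorem conf_eq_of_not_mem_rewiredSet {η : M.Conf} {x : M.HalfEdge} {t : ℕ} {w : M.Path t}
    (hw : w ∈ (M.pathLaw η x t).support) {h : M.HalfEdge} (hh : h ∉ rewiredSet w) :
    (conf w).1 h = η.1 h := by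
  induction t generalizing h with
  | zero =>
    rw [pathLaw, PMF.mem_support_pure_iff] at hw
    rw [hw]
    rfl
  | succ t ih =>
    rw [pathLaw, PMF.mem_support_bind_iff] at hw
    obtain ⟨w', hw', hw⟩ := hw
    rw [PMF.support_map, Set.mem_image] at hw
    obtain ⟨s, hs, rfl⟩ := hw
    change h ∉ rewiredSet (extend w' s) at hh
    change (conf (extend w' s)).1 h = _
    rw [rewiredSet_extend] at hh
    simp only [Set.mem_union, Finset.mem_coe, not_or] at hh
    rw [conf_extend, mem_repairings.1 (mem_support_step hs) h hh.2]
    exact ih hw' hh.1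

/-! ### The walk on the initial configuration -/

/-- Expectation for the walk on the fixed configuration `η`, for functions of the past positions
(most recent first) and the current position. -/
noncomputable def staticExp (η : M.Conf) : ℕ → List M.HalfEdge → M.HalfEdge →
    (List M.HalfEdge → M.HalfEdge → ℝ) → ℝ
  | 0, l, y, F => F l y
  | s + 1, l, y, F => M.savg (η.1 y) fun w => staticExp η s (y :: l) w F

/-- The definition peels off the first step; this form peels off the last, as the extension of
trajectories does. -/
theorem staticExp_succ (η : M.Conf) (s : ℕ) (l : List M.HalfEdge) (y : M.HalfEdge)
    (F : List M.HalfEdge → M.HalfEdge → ℝ) :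
    staticExp η (s + 1) l y F
      = staticExp η s l y fun l' y' => M.savg (η.1 y') fun w => F (y' :: l') w := by
  induction s generalizing l y with
  | zero => rfl
  | succ s ih =>
    rw [staticExp]
    conv_rhs => rw [staticExp]
    exact savg_congr fun w _ => ih (y :: l) w

theorem staticExp_sub (η : M.Conf) (s : ℕ) (l : List M.HalfEdge) (y : M.HalfEdge)
    (F G : List M.HalfEdge → M.HalfEdge → ℝ) :
    staticExp η s l y (fun l y => F l y - G l y) = staticExp η s l y F - staticExp η s l y G := by
  induction s generalizing l y with
  | zero => rfl
  | succ s ih =>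
    simp only [staticExp]
    rw [← savg_sub]
    exact savg_congr fun w _ => ih (y :: l) w

theorem staticExp_sum {ι : Type*} (I : Finset ι) (η : M.Conf) (s : ℕ) (l : List M.HalfEdge)
    (y : M.HalfEdge) (F : ι → List M.HalfEdge → M.HalfEdge → ℝ) :
    staticExp η s l y (fun l y => ∑ i ∈ I, F i l y) = ∑ i ∈ I, staticExp η s l y (F i) := by
  induction s generalizing l y with
  | zero => rfl
  | succ s ih =>
    simp only [staticExp]
    rw [← savg_sum]
    exact savg_congr fun w _ => ih (y :: l) w

theorem staticExp_mono (η : M.Conf) (s : ℕ) (l : List M.HalfEdge) (y : M.HalfEdge)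
    {F G : List M.HalfEdge → M.HalfEdge → ℝ}
    (h : ∀ l' y', l'.length = l.length + s → F l' y' ≤ G l' y') :
    staticExp η s l y F ≤ staticExp η s l y G := by
  induction s generalizing l y with
  | zero => exact h l y rfl
  | succ s ih =>
    simp only [staticExp]
    refine savg_mono fun w _ => ih (y :: l) w fun l' y' hl => h l' y' ?_
    rw [hl, List.length_cons]
    omega

theorem staticExp_const (η : M.Conf) (s : ℕ) (l : List M.HalfEdge) (y : M.HalfEdge) (c : ℝ) :
    staticExp η s l y (fun _ _ => c) = c := by
  induction s generalizing l y with
  | zero => rfl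
  | succ s ih =>
    rw [staticExp, savg_congr fun w _ => ih (y :: l) w, savg_const]

theorem abs_staticExp_le (η : M.Conf) (s : ℕ) (l : List M.HalfEdge) (y : M.HalfEdge)
    {F G : List M.HalfEdge → M.HalfEdge → ℝ}
    (h : ∀ l' y', l'.length = l.length + s → |F l' y'| ≤ G l' y') :
    |staticExp η s l y F| ≤ staticExp η s l y G := by
  induction s generalizing l y with
  | zero => exact h l y rfl
  | succ s ih =>
    simp only [staticExp]
    refine (abs_savg_le _ _).trans (savg_mono fun w _ => ih (y :: l) w fun l' y' hl => h l' y' ?_)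
    rw [hl, List.length_cons]
    omega

/-- For `l = [x_{s-1}, …, x_0]`, the dynamics of the configuration during `s` steps, restricted to
the event that `x_j` is not rewired up to time `j + 1` and that `B` is not rewired at all. -/
noncomputable def chainOp : List M.HalfEdge → Finset M.HalfEdge → Module.End ℝ (M.Conf → ℝ)
  | [], _ => 1
  | y :: l, B => chainOp l (insert y B) * avoid (insert y B)

open Classical in
/-- As long as no rewired edge is used, the walk is the walk on the initial configuration. -/
theorem pathExp_alive (η : M.Conf) (x : M.HalfEdge) (s : ℕ)
    (B : List M.HalfEdge → M.HalfEdge → Finset M.HalfEdge)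
    (F : List M.HalfEdge → M.HalfEdge → M.Conf → ℝ) :
    pathExp η x s (fun w => if Alive w ∧ ∀ h ∈ B (past w) (cur w), h ∉ rewiredSet w then
      F (past w) (cur w) (conf w) else 0)
      = staticExp η s [] x fun l y => chainOp l (B l y) (F l y) η := by
  induction s generalizing B F with
  | zero =>
    rw [pathExp_zero, if_pos]
    · rfl
    · refine ⟨fun i => i.elim0, fun h _ => ?_⟩
      rintro ⟨r, hr0, hr, -⟩
      exact absurd (lt_of_lt_of_le hr0 hr) (by simp)
  | succ s ih =>
    -- Integrates out the last step. The new position `z` becomes a summation index, since the set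
    -- to be avoided depends on it, and the current position joins that set.
    have key : pathExp η x (s + 1)
        (fun w => if Alive w ∧ ∀ h ∈ B (past w) (cur w), h ∉ rewiredSet w then
          F (past w) (cur w) (conf w) else 0)
        = pathExp η x s fun w => ∑ z, if Alive w ∧
            ∀ h ∈ insert (cur w) (B (cur w :: past w) z), h ∉ rewiredSet w then
            (if z ∈ M.siblings (η.1 (cur w)) then ((M.siblings (η.1 (cur w))).card : ℝ)⁻¹ else 0) *
            avoid (insert (cur w) (B (cur w :: past w) z)) (F (cur w :: past w) z) (conf w)
            else 0 := by
      rw [pathExp_succ]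
      refine pmfExp_congr fun w hw => ?_
      have hη := fun h => conf_eq_of_not_mem_rewiredSet hw (h := h)
      obtain ⟨y, hy⟩ : ∃ y, y = cur w := ⟨_, rfl⟩
      obtain ⟨l, hl⟩ : ∃ l, l = past w := ⟨_, rfl⟩
      obtain ⟨Q, hQ⟩ : ∃ Q, Q = rewiredSet w := ⟨_, rfl⟩
      simp only [alive_extend, past_extend, cur_extend, conf_extend, rewiredSet_extend,
        Finset.forall_mem_insert]
      rw [← hy, ← hl, ← hQ]
      rw [← hQ] at hη
      by_cases hA : Alive w ∧ y ∉ Q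
      · obtain ⟨hA1, hA2⟩ := hA
        simp only [hA1, hA2, not_false_eq_true, true_and]
        have e1 : ∀ R ∈ M.rewirings (conf w), ∀ ζ ∈ M.repairings (conf w) R,
            (M.savg (ζ.1 y) fun z => if y ∉ R ∧ ∀ h ∈ B (y :: l) z, h ∉ Q ∪ (R : Set M.HalfEdge)
              then F (y :: l) z ζ else 0)
            = M.savg (η.1 y) fun z => if (∀ h ∈ B (y :: l) z, h ∉ Q) then
                if Disjoint R (insert y (B (y :: l) z)) then F (y :: l) z ζ else 0 else 0 := by
          intro R _ ζ hζ
          have e2 : ∀ z, (if y ∉ R ∧ ∀ h ∈ B (y :: l) z, h ∉ Q ∪ (R : Set M.HalfEdge)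
              then F (y :: l) z ζ else 0) = if (∀ h ∈ B (y :: l) z, h ∉ Q) then
                if Disjoint R (insert y (B (y :: l) z)) then F (y :: l) z ζ else 0 else 0 := by
            intro z
            rw [← ite_and]
            congr 1
            rw [eq_iff_iff, Finset.disjoint_right]
            simp only [Finset.forall_mem_insert, Set.mem_union, Finset.mem_coe, not_or]
            constructor
            · rintro ⟨h1, h2⟩
              exact ⟨fun h hh => (h2 h hh).1, h1, fun h hh => (h2 h hh).2⟩
            · rintro ⟨h1, h2, h3⟩
              exact ⟨h2, fun h hh => ⟨h1 h hh, h3 h hh⟩⟩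
          simp only [e2]
          -- If `y` is rewired both sides vanish, so it does not matter that its partner need no
          -- longer be `η y`.
          by_cases hyR : y ∈ R
          · have : ∀ z, ¬ Disjoint R (insert y (B (y :: l) z)) := fun z hd =>
              Finset.disjoint_left.1 hd hyR (Finset.mem_insert_self _ _)
            simp only [this, if_false, ite_self, savg_const]
          · rw [mem_repairings.1 hζ y hyR, hη y hA2]
        rw [Finset.expect_congr rfl fun R hR => Finset.expect_congr rfl fun ζ hζ => e1 R hR ζ hζ]
        simp only [savg_eq, ← Finset.mul_expect, Finset.expect_sum_comm]
        rw [Finset.mul_sum, ← Finset.sum_subset (Finset.subset_univ (M.siblings (η.1 y)))]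
        · refine Finset.sum_congr rfl fun z hz => ?_
          simp only [hz, if_true]
          split_ifs with h1
          · congr 1
            rw [avoid, ker_apply]
            refine Finset.expect_congr rfl fun R _ => ?_
            split_ifs
            · rfl
            · simp
          · simp
        · intro z _ hz
          simp [hz]
      · have h1 : ∀ p : Prop, ¬ (Alive w ∧ (y ∉ Q ∧ p)) := fun p h => hA ⟨h.1, h.2.1⟩
        simp only [h1, false_and, if_false, savg_const, Finset.expect_const_zero, Finset.sum_const_zero]
    rw [key, pathExp, pmfExp_sum]
    have ih' := fun z => ih (fun l y => insert y (B (y :: l) z)) (fun l y ζ =>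
      (if z ∈ M.siblings (η.1 y) then ((M.siblings (η.1 y)).card : ℝ)⁻¹ else 0) *
            avoid (insert y (B (y :: l) z)) (F (y :: l) z) ζ)
    simp only [pathExp] at ih'
    rw [Finset.sum_congr rfl fun z _ => ih' z, ← staticExp_sum, staticExp_succ]
    congr 1
    ext l y
    rw [savg_eq, Finset.mul_sum, ← Finset.sum_subset (Finset.subset_univ (M.siblings (η.1 y)))]
    · refine Finset.sum_congr rfl fun z hz => ?_
      rw [end_const_mul, if_pos hz, chainOp, Module.End.mul_apply]
    · intro z _ hz
      rw [end_const_mul, if_neg hz, zero_mul]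

theorem avoid_nonneg (B : Finset M.HalfEdge) {φ : M.Conf → ℝ} (h : ∀ ζ, 0 ≤ φ ζ) (ξ : M.Conf) :
    0 ≤ avoid B φ ξ := by
  rw [avoid]
  exact ker_nonneg _ h ξ

theorem avoid_le_dyn (B : Finset M.HalfEdge) {φ : M.Conf → ℝ} (h : ∀ ζ, 0 ≤ φ ζ) (ξ : M.Conf) :
    avoid B φ ξ ≤ M.dyn φ ξ := by
  rw [avoid]
  exact ker_le_dyn _ (fun _ => le_rfl) h ξ

theorem chainOp_nonneg (l : List M.HalfEdge) (B : Finset M.HalfEdge) {φ : M.Conf → ℝ}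
    (h : ∀ ζ, 0 ≤ φ ζ) (ξ : M.Conf) : 0 ≤ chainOp l B φ ξ := by
  induction l generalizing B φ with
  | nil => exact h ξ
  | cons y l ih =>
    rw [chainOp, Module.End.mul_apply]
    exact ih _ fun ζ => avoid_nonneg _ h ζ

theorem chainOp_mono (l : List M.HalfEdge) (B : Finset M.HalfEdge) {φ ψ : M.Conf → ℝ}
    (h : ∀ ζ, φ ζ ≤ ψ ζ) (ξ : M.Conf) : chainOp l B φ ξ ≤ chainOp l B ψ ξ := by
  have := chainOp_nonneg l B (φ := fun ζ => ψ ζ - φ ζ) (fun ζ => sub_nonneg.2 (h ζ)) ξ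
  rw [end_sub] at this
  linarith

theorem chainOp_le (l : List M.HalfEdge) (B : Finset M.HalfEdge) {φ : M.Conf → ℝ}
    (h : ∀ ζ, 0 ≤ φ ζ) (ξ : M.Conf) : chainOp l B φ ξ ≤ (M.dyn ^ l.length) φ ξ := by
  induction l generalizing B φ with
  | nil => exact le_rfl
  | cons y l ih =>
    rw [chainOp, Module.End.mul_apply, List.length_cons, pow_succ, Module.End.mul_apply]
    refine (ih _ fun ζ => avoid_nonneg _ h ζ).trans ?_
    exact (isMarkov_dyn.pow _).mono (fun ζ => avoid_le_dyn _ h ζ) ξ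

theorem abs_chainOp_le (l : List M.HalfEdge) (B : Finset M.HalfEdge) {φ ψ : M.Conf → ℝ}
    (h : ∀ ζ, |φ ζ| ≤ ψ ζ) (ξ : M.Conf) : |chainOp l B φ ξ| ≤ (M.dyn ^ l.length) ψ ξ := by
  refine le_trans ?_ (chainOp_le l B (fun ζ => (abs_nonneg _).trans (h ζ)) ξ)
  rw [abs_le]
  constructor
  · have := chainOp_mono l B (φ := fun ζ => (-1) * ψ ζ) (ψ := φ)
      (fun ζ => by linarith [(abs_le.1 (h ζ)).1]) ξ
    rw [end_const_mul] at this
    linarith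
  · exact chainOp_mono l B (fun ζ => (abs_le.1 (h ζ)).2) ξ

/-! ### The walk after the first use of a rewired edge -/

/-- Expected number of returns, for walks of `j` steps started after `i + 1` steps of the
configuration dynamics. -/
noncomputable def returnExp (i j : ℕ) (ξ : M.Conf) : ℝ := (M.dyn ^ (i + 1)) (returns j ξ) ξ

theorem returnExp_nonneg (i j : ℕ) (ξ : M.Conf) : 0 ≤ returnExp i j ξ :=
  (isMarkov_dyn.pow _).nonneg _ (fun _ => returns_nonneg _ _ _) ξ

/-- The difference carries the event that `u` has been rewired, decomposed by the last time this
happens: `T` describes the steps after it, which keep `u`, and the `p` steps before it are dominated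
by `dyn ^ p`. -/
theorem abs_chainOp_sub_le {S : Finset M.HalfEdge} {u : M.HalfEdge} (hu : u ∈ S) {s : ℕ}
    (hs : S.card ≤ s) (hsl : 4 * s ≤ M.ell) {f : M.HalfEdge → ℝ} {K : ℝ} (hf : ∀ y, |f y| ≤ K)
    (hf0 : ∑ y, f y = 0) (j : ℕ) (η : M.Conf) (l : List M.HalfEdge) (hl : ∀ x ∈ l, x ∈ S)
    {B : Finset M.HalfEdge} (hB : B ⊆ S) {i : ℕ} {T : Module.End ℝ (M.Conf → ℝ)}
    (hT : IsRestriction S u i T) :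
    |chainOp l B (avoid B (T fun ζ => M.savg (ζ.1 u) (walkExp f j ζ))) η
      - chainOp l (insert u B)
        (avoid (insert u B) (T fun ζ => M.savg (ζ.1 u) (walkExp f j ζ))) η|
      ≤ ∑ p ∈ Finset.range (l.length + 1), 2 * K * (2 * s / (2 * M.k - 1)
        + (2 * s + 8 * j + 2 * (M.dyn ^ p) (returnExp (i + l.length - p) j) η) / M.ell) := by
  induction l generalizing B i T with
  | nil =>
    simp only [List.length_nil, zero_add, Finset.sum_range_one, chainOp, Module.End.one_apply,
      pow_zero, add_zero, Nat.sub_zero]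
    rw [avoid_eq_add B u, add_sub_cancel_left]
    exact abs_avoidRewire_le hT hB hu hs hsl hf hf0 j η
  | cons y l ih =>
    have hyS : y ∈ S := hl y (by simp)
    have hT' := hT.avoid_mul (Finset.insert_subset hu hB) (Finset.mem_insert_self u B)
    have ih' := ih (fun x hx => hl x (by simp [hx])) (Finset.insert_subset hyS hB) hT'
    -- If `u` is rewired in the step preceding `T`, this is its last rewiring; otherwise the step is
    -- absorbed into `T`.
    have hsplit : chainOp (y :: l) B (avoid B (T fun ζ => M.savg (ζ.1 u) (walkExp f j ζ))) η
        - chainOp (y :: l) (insert u B)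
          (avoid (insert u B) (T fun ζ => M.savg (ζ.1 u) (walkExp f j ζ))) η
        = (chainOp l (insert y B) (avoid (insert y B)
            ((avoid (insert u B) * T) fun ζ => M.savg (ζ.1 u) (walkExp f j ζ))) η
          - chainOp l (insert u (insert y B)) (avoid (insert u (insert y B))
            ((avoid (insert u B) * T) fun ζ => M.savg (ζ.1 u) (walkExp f j ζ))) η)
          + chainOp (y :: l) B
            (avoidRewire B u (T fun ζ => M.savg (ζ.1 u) (walkExp f j ζ))) η := by
      have h1 : avoid B (T fun ζ => M.savg (ζ.1 u) (walkExp f j ζ))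
          = fun ξ => avoid (insert u B) (T fun ζ => M.savg (ζ.1 u) (walkExp f j ζ)) ξ
            + avoidRewire B u (T fun ζ => M.savg (ζ.1 u) (walkExp f j ζ)) ξ :=
        funext fun ξ => avoid_eq_add B u _ ξ
      rw [h1, end_add, Finset.insert_comm u y B]
      simp only [chainOp, Module.End.mul_apply]
      ring
    rw [hsplit, List.length_cons, Finset.sum_range_succ]
    refine (abs_add_le _ _).trans (add_le_add ?_ ?_)
    · refine ih'.trans (le_of_eq (Finset.sum_congr rfl fun p _ => ?_))
      rw [show i + 1 + l.length = i + (l.length + 1) by omega]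
    · have h1 := abs_chainOp_le (y :: l) B
        (fun ξ => abs_avoidRewire_le hT hB hu hs hsl hf hf0 j ξ) η
      refine h1.trans (le_of_eq ?_)
      rw [List.length_cons, show i + (l.length + 1) - (l.length + 1) = i by omega]
      have hM := isMarkov_dyn (M := M) |>.pow (l.length + 1)
      have e : ∀ ξ : M.Conf, 2 * K * (2 * s / (2 * M.k - 1)
          + (2 * s + 8 * j + 2 * (M.dyn ^ (i + 1)) (returns j ξ) ξ) / M.ell)
          = 2 * K * (2 * s / (2 * M.k - 1) + (2 * s + 8 * j) / M.ell)
            + (2 * K * 2 / M.ell) * returnExp i j ξ := by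
        intro ξ
        rw [returnExp]
        ring
      rw [end_congr _ e, end_add, hM.const, end_const_mul]
      ring

open Classical in
/-- Given that a rewired edge has been used, the walk is almost uniformly distributed. -/
theorem abs_pathExp_not_alive_le {f : M.HalfEdge → ℝ} {K : ℝ} (hf : ∀ y, |f y| ≤ K)
    (hf0 : ∑ y, f y = 0) {L : ℕ} (hL : 4 * L ≤ M.ell) (η : M.Conf) (x : M.HalfEdge) (t j : ℕ)
    (htj : t + j ≤ L) :
    |pathExp η x t fun w => if Alive w then 0 else walkExp f j (conf w) (cur w)|
      ≤ ∑ s ∈ Finset.range t, ∑ p ∈ Finset.range (s + 1), 2 * K * (2 * L / (2 * M.k - 1)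
        + (2 * L + 8 * ((t + j - s - 1 : ℕ) : ℝ)
          + 2 * (M.dyn ^ p) (returnExp (s - p) (t + j - s - 1)) η) / M.ell) := by
  -- The horizon `t + j` is fixed: one step fewer in the trajectory is one more in `walkExp`.
  induction t generalizing j with
  | zero =>
    have h : Alive (fun _ => (η, ∅, x) : M.Path 0) := fun i => Fin.elim0 i
    rw [pathExp_zero, if_pos h]
    simp
  | succ t ih =>
    -- The first use of a rewired edge at step `t + 1` means being alive at `t` with the current
    -- position rewired by time `t + 1`. This is written as survival up to `t` minus the part where
    -- the position was never rewired.
    have h1 : pathExp η x (t + 1)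
        (fun w => if Alive w then 0 else walkExp f j (conf w) (cur w))
        = pathExp η x t fun w => (if Alive w then 0 else walkExp f (j + 1) (conf w) (cur w))
          + ((if Alive w ∧ ∀ h ∈ (∅ : Finset M.HalfEdge), h ∉ rewiredSet w then
              avoid ∅ (fun ζ => M.savg (ζ.1 (cur w)) (walkExp f j ζ)) (conf w) else 0)
            - if Alive w ∧ ∀ h ∈ ({cur w} : Finset M.HalfEdge), h ∉ rewiredSet w then
              avoid {cur w} (fun ζ => M.savg (ζ.1 (cur w)) (walkExp f j ζ)) (conf w) else 0) := by
      rw [pathExp_succ]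
      refine pmfExp_congr fun w _ => ?_
      simp only [alive_extend, cur_extend, conf_extend]
      by_cases hA : Alive w
      · by_cases hy : cur w ∈ rewiredSet w
        · simp [hA, hy, avoid, ker_apply]
        · simp only [hA, hy, not_false_eq_true, true_and, if_true, Finset.notMem_empty,
            false_imp_iff, implies_true, Finset.mem_singleton, forall_eq, zero_add, avoid,
            ker_apply]
          rw [← Finset.expect_sub_distrib]
          refine Finset.expect_congr rfl fun R _ => ?_
          by_cases hR : cur w ∈ R
          · simp [hR]
          · simp [hR, savg_const]
      · simp [hA, walkExp, dyn, ker_apply]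
    rw [h1, pathExp, pmfExp_add, pmfExp_sub]
    have h2 := pathExp_alive η x t (fun _ _ => ∅)
      (fun _ y => avoid ∅ (fun ζ => M.savg (ζ.1 y) (walkExp f j ζ)))
    have h3 := pathExp_alive η x t (fun _ y => {y})
      (fun _ y => avoid {y} (fun ζ => M.savg (ζ.1 y) (walkExp f j ζ)))
    rw [pathExp] at h2 h3
    rw [h2, h3, ← staticExp_sub, Finset.sum_range_succ]
    refine (abs_add_le _ _).trans (add_le_add ?_ ?_)
    · refine (ih (j + 1) (by omega)).trans (le_of_eq (Finset.sum_congr rfl fun s _ => ?_))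
      rw [show t + (j + 1) - s - 1 = t + 1 + j - s - 1 by omega]
    · rw [show t + 1 + j - t - 1 = j by omega]
      refine (abs_staticExp_le η t [] x (G := fun _ _ => _) fun l y hl => ?_).trans
        (staticExp_const η t [] x _).le
      rw [List.length_nil, zero_add] at hl
      have := abs_chainOp_sub_le (S := insert y l.toFinset) (u := y) (by simp) (s := L) (by
          refine (Finset.card_insert_le _ _).trans ?_
          have := List.toFinset_card_le l
          omega) hL hf hf0 j η l (fun z hz => by simp [hz]) (B := ∅) (by simp) (i := 0) (T := 1)
          (isRestriction_one _ _)
      simp only [Module.End.one_apply, zero_add, hl] at this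
      exact this

/-! ### The tail of the first use of a rewired edge -/

/-- Probability that none of `j` given edges is rewired in one step. -/
noncomputable def keepProb (M : DynConfModel n) (j : ℕ) : ℝ :=
  ((M.m - j).choose M.k : ℝ) / (M.m.choose M.k : ℝ)

theorem avoid_one {ξ : M.Conf} {B : Finset M.HalfEdge} (hB : ∀ x ∈ B, ξ.1 x ∉ B) :
    avoid B (fun _ => 1) ξ = M.keepProb B.card := by
  rw [avoid, ker_apply]
  have : ∀ R, (if Disjoint R B then 𝔼 _ζ ∈ M.repairings ξ R, (1 : ℝ) else 0)
      = if Disjoint R B then 1 else 0 := by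
    intro R
    rw [Finset.expect_const (M.repairings_nonempty ξ R)]
  simp only [this]
  rw [Finset.expect_eq_sum_div_card, card_rewirings, ← Finset.sum_filter, Finset.sum_const,
    nsmul_eq_mul, mul_one, card_rewirings_disjoint hB, keepProb]

theorem keepProb_one : M.keepProb 1 = 1 - M.alpha := by
  have hm := M.m_pos
  have hk := M.k_le_m
  have hmr : (M.m : ℝ) ≠ 0 := by exact_mod_cast hm.ne'
  have hc : (M.m.choose M.k : ℝ) ≠ 0 := by exact_mod_cast (Nat.choose_pos hk).ne'
  obtain ⟨m', hm'⟩ : ∃ m', M.m = m' + 1 := ⟨M.m - 1, by omega⟩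
  have h := Nat.choose_mul_succ_eq m' M.k
  rw [keepProb, alpha, div_eq_iff hc, hm', Nat.add_sub_cancel]
  rw [hm'] at hmr hk
  have h' : ((m'.choose M.k * (m' + 1) : ℕ) : ℝ)
      = (((m' + 1).choose M.k * (m' + 1 - M.k) : ℕ) : ℝ) := by rw [h]
  push_cast [Nat.cast_sub hk] at h'
  push_cast at hmr ⊢
  field_simp
  linarith

theorem alpha_pos : 0 < M.alpha := by
  have : (0 : ℝ) < M.k := by
    have := M.two_le_k
    exact_mod_cast (by omega : 0 < M.k)
  have : (0 : ℝ) < M.m := by exact_mod_cast M.m_pos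
  rw [alpha]
  positivity

theorem alpha_le_one : M.alpha ≤ 1 := by
  have : (0 : ℝ) < M.m := by exact_mod_cast M.m_pos
  rw [alpha, div_le_one this]
  exact_mod_cast M.k_le_m

theorem chainOp_one_mem_Icc (l : List M.HalfEdge) (B : Finset M.HalfEdge) (η : M.Conf) :
    0 ≤ chainOp l B (fun _ => 1) η ∧ chainOp l B (fun _ => 1) η ≤ 1 := by
  refine ⟨chainOp_nonneg l B (fun _ => zero_le_one) η, ?_⟩
  refine (chainOp_le l B (fun _ => zero_le_one) η).trans ?_
  rw [(isMarkov_dyn.pow _).const]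

/-- The last step must at least spare `y`, which has probability `1 - α` in every configuration. -/
theorem chainOp_one_le (y : M.HalfEdge) (l : List M.HalfEdge) (B : Finset M.HalfEdge)
    (η : M.Conf) : chainOp (y :: l) B (fun _ => 1) η ≤ 1 - M.alpha := by
  rw [chainOp, Module.End.mul_apply]
  have h1 : ∀ ζ : M.Conf, avoid (insert y B) (fun _ => 1) ζ ≤ (1 - M.alpha) * 1 := by
    intro ζ
    have h2 : avoid (insert y B) (fun _ => 1) ζ ≤ avoid {y} (fun _ => 1) ζ := by
      rw [avoid, avoid]
      refine ker_mono (fun R hR => ?_) (fun _ => le_rfl) (fun _ => zero_le_one) ζ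
      exact hR.mono_right (by simp)
    refine h2.trans (le_of_eq ?_)
    rw [avoid_one (by simp [conf_ne]), Finset.card_singleton, keepProb_one, mul_one]
  refine (chainOp_mono l _ h1 η).trans ?_
  rw [end_const_mul]
  have := (chainOp_one_mem_Icc l (insert y B) η).2
  have := sub_nonneg.2 M.alpha_le_one
  nlinarith

/-- The half-edges of `B` are never rewired along the chain, so they keep their partners in `η`. In
particular distinct edges remain distinct, and `avoid_one` applies at each step. -/
theorem chainOp_congr (l : List M.HalfEdge) (B : Finset M.HalfEdge) {φ ψ : M.Conf → ℝ} {η : M.Conf}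
    (h : ∀ ζ : M.Conf, (∀ x ∈ B, ζ.1 x = η.1 x) → φ ζ = ψ ζ) :
    chainOp l B φ η = chainOp l B ψ η := by
  induction l generalizing B φ ψ with
  | nil => exact h η fun _ _ => rfl
  | cons y l ih =>
    rw [chainOp, Module.End.mul_apply, Module.End.mul_apply]
    refine ih _ fun ζ hζ => ?_
    rw [avoid]
    refine ker_congr fun R hR θ hθ => h θ fun x hx => ?_
    have hx' : x ∈ insert y B := Finset.mem_insert_of_mem hx
    rw [hθ x (Finset.disjoint_right.1 hR hx'), hζ x hx']

/-- The half-edges in `l` lie on distinct edges of `η`. -/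
def DistinctEdges (η : M.Conf) (l : List M.HalfEdge) : Prop :=
  l.Nodup ∧ ∀ x ∈ l, ∀ y ∈ l, η.1 x ≠ y

/-- The final step must keep `B.card + 1` edges, and each earlier step one more. -/
theorem chainOp_one_eq {η : M.Conf} (l : List M.HalfEdge) (B : Finset M.HalfEdge)
    (hl : l.Nodup) (hlB : ∀ x ∈ l, x ∉ B)
    (h : ∀ x, (x ∈ l ∨ x ∈ B) → ∀ y, (y ∈ l ∨ y ∈ B) → η.1 x ≠ y) :
    chainOp l B (fun _ => 1) η
      = ∏ j ∈ Finset.range l.length, M.keepProb (B.card + j + 1) := by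
  induction l generalizing B with
  | nil => rfl
  | cons y l ih =>
    rw [List.nodup_cons] at hl
    have hyB := hlB y (by simp)
    rw [chainOp, Module.End.mul_apply]
    have h1 : chainOp l (insert y B) (avoid (insert y B) fun _ => 1) η
        = chainOp l (insert y B) (fun _ => M.keepProb (B.card + 1) * 1) η := by
      refine chainOp_congr l _ fun ζ hζ => ?_
      rw [avoid_one, Finset.card_insert_of_notMem hyB, mul_one]
      intro x hx hx'
      rw [hζ x hx] at hx'
      simp only [Finset.mem_insert] at hx hx'
      refine h x ?_ _ ?_ rfl
      · rcases hx with rfl | hx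
        · simp
        · exact Or.inr hx
      · rcases hx' with hx' | hx'
        · simp [hx']
        · exact Or.inr hx'
    rw [h1, end_const_mul, ih (insert y B) hl.2, Finset.card_insert_of_notMem hyB,
      List.length_cons, Finset.prod_range_succ', mul_comm]
    · congr 1
      refine Finset.prod_congr rfl fun j _ => ?_
      rw [show B.card + 1 + j + 1 = B.card + (j + 1) + 1 by omega]
    · intro x hx
      simp only [Finset.mem_insert, not_or]
      refine ⟨?_, hlB x (by simp [hx])⟩
      rintro rfl
      exact hl.1 hx
    · intro x hx z hz
      refine h x ?_ z ?_
      · simp only [Finset.mem_insert, List.mem_cons] at hx ⊢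
        tauto
      · simp only [Finset.mem_insert, List.mem_cons] at hz ⊢
        tauto

open Classical in
/-- The walk on `η` uses an edge twice only if it visits a vertex twice. -/
theorem staticExp_not_distinct_le (η : M.Conf) (s : ℕ) {l : List M.HalfEdge} {y : M.HalfEdge}
    {V : Finset (Fin n)} (h1 : DistinctEdges η (y :: l)) (h2 : ∀ x ∈ y :: l, x.1 ∈ V)
    (h3 : ∀ x ∈ l, (η.1 x).1 ∈ V) :
    staticExp η s l y (fun l' _ => if DistinctEdges η l' then 0 else 1)
      ≤ revisit (List.replicate s 1) V η y := by
  induction s generalizing l y V with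
  | zero =>
    have : DistinctEdges η l :=
      ⟨(List.nodup_cons.1 h1.1).2, fun x hx z hz => h1.2 x (by simp [hx]) z (by simp [hz])⟩
    rw [staticExp, if_pos this]
    exact le_rfl
  | succ s ih =>
    rw [staticExp, List.replicate_succ, revisit, Module.End.one_apply]
    split_ifs with hV
    · refine savg_le fun w _ => (staticExp_mono η s _ w (G := fun _ _ => 1) fun l' _ _ => ?_).trans
        (staticExp_const η s _ w 1).le
      split_ifs <;> norm_num
    · refine savg_mono fun w hw => ?_
      obtain ⟨hw1, hw2⟩ := M.mem_siblings.1 hw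
      have hwV : w.1 ∉ V := by rwa [hw1]
      have hne : ∀ x ∈ y :: l, η.1 x ≠ w := by
        intro x hx hxw
        rcases List.mem_cons.1 hx with rfl | hx
        · exact hw2 hxw.symm
        · exact hwV (hxw ▸ h3 x hx)
      refine ih ⟨?_, ?_⟩ ?_ ?_
      · exact List.nodup_cons.2 ⟨fun h => hwV (h2 w h), h1.1⟩
      · intro x hx z hz
        rcases List.mem_cons.1 hx with rfl | hx' <;> rcases List.mem_cons.1 hz with rfl | hz'
        · exact conf_ne η _
        · exact fun h => hne z hz' ((conf_eq_iff η).1 h)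
        · exact hne x hx'
        · exact h1.2 x hx' z hz'
      · intro x hx
        rcases List.mem_cons.1 hx with rfl | hx
        · rw [hw1]
          exact Finset.mem_insert_self _ _
        · exact Finset.mem_insert_of_mem (h2 x hx)
      · intro x hx
        rcases List.mem_cons.1 hx with rfl | hx
        · exact Finset.mem_insert_self _ _
        · exact Finset.mem_insert_of_mem (h3 x hx)

theorem prob_eq (η : M.Conf) (x : M.HalfEdge) (t : ℕ) (A : Set (M.Path t)) :
    M.prob η x t A = pathExp η x t (A.indicator fun _ => 1) := by
  rw [prob, PMF.toOuterMeasure_apply_fintype, ENNReal.toReal_sum]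
  · refine Finset.sum_congr rfl fun w _ => ?_
    by_cases h : w ∈ A <;> simp [h]
  · intro w _
    by_cases h : w ∈ A
    · simpa [h] using PMF.apply_ne_top _ _
    · simp [h]

theorem prob_tau_gt (η : M.Conf) (x : M.HalfEdge) (t : ℕ) :
    M.prob η x t {w | (t : ℕ∞) < Path.tau w}
      = staticExp η t [] x fun l _ => chainOp l ∅ (fun _ => 1) η := by
  classical
  rw [prob_eq, ← pathExp_alive η x t (fun _ _ => ∅) (fun _ _ _ => 1)]
  refine pmfExp_congr fun w _ => ?_
  simp [Set.indicator_apply, le_tau_iff]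

/-- The tail of the first use of a rewired edge, up to the probability that the walk on the initial
configuration repeats a vertex. -/
theorem abs_prob_tau_gt_sub_le (η : M.Conf) (x : M.HalfEdge) (t : ℕ) :
    |M.prob η x t {w | (t : ℕ∞) < Path.tau w} - ∏ j ∈ Finset.range t, M.keepProb (j + 1)|
      ≤ revisit (List.replicate t 1) {x.1} η x := by
  classical
  have hp : ∀ j, 0 ≤ M.keepProb j ∧ M.keepProb j ≤ 1 := by
    intro j
    rw [keepProb]
    refine ⟨by positivity, div_le_one_of_le₀ ?_ (by positivity)⟩
    exact_mod_cast Nat.choose_le_choose _ (Nat.sub_le _ _)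
  have hP0 : 0 ≤ ∏ j ∈ Finset.range t, M.keepProb (j + 1) :=
    Finset.prod_nonneg fun j _ => (hp _).1
  have hP1 : ∏ j ∈ Finset.range t, M.keepProb (j + 1) ≤ 1 :=
    Finset.prod_le_one (fun j _ => (hp _).1) fun j _ => (hp _).2
  rw [prob_tau_gt, ← staticExp_const η t [] x (∏ j ∈ Finset.range t, M.keepProb (j + 1)),
    ← staticExp_sub]
  refine (abs_staticExp_le η t [] x fun l y hl => ?_).trans
    (staticExp_not_distinct_le η t (l := []) (y := x) ⟨by simp, by simp [conf_ne]⟩ (by simp)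
      (by simp))
  rw [List.length_nil, zero_add] at hl
  split_ifs with h
  · rw [chainOp_one_eq l ∅ h.1 (by simp) (by simpa using h.2), hl]
    simp
  · have := chainOp_one_mem_Icc l ∅ η
    rw [abs_le]
    constructor <;> linarith

/-- Gives the lower bound `α` for the probability by which conditioning on `τ ≤ t` divides. -/
theorem prob_tau_gt_le (η : M.Conf) (x : M.HalfEdge) {t : ℕ} (ht : 1 ≤ t) :
    M.prob η x t {w | (t : ℕ∞) < Path.tau w} ≤ 1 - M.alpha := by
  rw [prob_tau_gt]
  refine (staticExp_mono η t [] x (G := fun _ _ => 1 - M.alpha) fun l y hl => ?_).trans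
    (staticExp_const η t [] x _).le
  rcases l with _ | ⟨z, l⟩
  · simp at hl
    omega
  · exact chainOp_one_le z l ∅ η

/-! ### Closeness to uniformity after the first use of a rewired edge -/

/-- The bound for the distance from uniformity on the event that a rewired edge has been used. -/
noncomputable def mixErr (t : ℕ) (η : M.Conf) : ℝ :=
  ∑ s ∈ Finset.range t, ∑ p ∈ Finset.range (s + 1), 2 * 2 * (2 * t / (2 * M.k - 1)
    + (2 * t + 8 * ((t - s - 1 : ℕ) : ℝ)
      + 2 * (M.dyn ^ p) (returnExp (s - p) (t - s - 1)) η) / M.ell)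

theorem k_pos : (0 : ℝ) < 2 * M.k - 1 := by
  have : (2 : ℝ) ≤ M.k := by exact_mod_cast M.two_le_k
  linarith

theorem mixErr_nonneg (t : ℕ) (η : M.Conf) : 0 ≤ mixErr t η := by
  refine Finset.sum_nonneg fun s _ => Finset.sum_nonneg fun p _ => ?_
  have h1 := M.k_pos
  have h2 := (isMarkov_dyn.pow p).nonneg _ (returnExp_nonneg (s - p) (t - s - 1)) η
  positivity

/-- At most `t²` pairs `(s, p)` contribute `O(t²(1 + ν)/(αℓ))` each; stationarity removes the powers
`dyn ^ p`. The constants are `104 = 4 (4 + 10) + 8 · 6` and `32 = 8 · 4`. -/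
theorem sum_mixErr_le (t : ℕ) :
    ∑ η : M.Conf, mixErr t η
      ≤ Fintype.card M.Conf * (t ^ 4 * (104 + 32 * M.nu) / (M.alpha * M.ell)) := by
  have hell : (0 : ℝ) < M.ell := by exact_mod_cast M.ell_pos
  have hk := M.k_pos
  have hα := M.alpha_pos
  have hα1 := M.alpha_le_one
  have hν := M.nu_nonneg
  have hkα : M.alpha * M.ell = 2 * M.k := by
    have hm : (M.m : ℝ) ≠ 0 := by exact_mod_cast M.m_pos.ne'
    rw [alpha, ell_eq]
    push_cast
    field_simp
  have h1 : ∀ s ∈ Finset.range t, ∀ p ∈ Finset.range (s + 1),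
      ∑ η : M.Conf, 2 * 2 * (2 * t / (2 * M.k - 1) + (2 * t + 8 * ((t - s - 1 : ℕ) : ℝ)
        + 2 * (M.dyn ^ p) (returnExp (s - p) (t - s - 1)) η) / M.ell)
      ≤ Fintype.card M.Conf * (t ^ 2 * (104 + 32 * M.nu) / (M.alpha * M.ell)) := by
    intro s hs p _
    rw [Finset.mem_range] at hs
    have ht1 : (1 : ℝ) ≤ t := by exact_mod_cast (by omega : 1 ≤ t)
    have hj : (((t - s - 1 : ℕ) : ℝ) + 1) ≤ t := by exact_mod_cast (by omega : t - s - 1 + 1 ≤ t)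
    have hj0 : (0 : ℝ) ≤ ((t - s - 1 : ℕ) : ℝ) := Nat.cast_nonneg _
    have e1 := sum_pow_returns_le (M := M) (s - p + 1) (t - s - 1)
    have e2 : ∑ η, (M.dyn ^ p) (returnExp (s - p) (t - s - 1)) η
        ≤ Fintype.card M.Conf * (t ^ 2 * (4 * M.nu + 6)) := by
      rw [(isMarkov_dyn.pow p).sum]
      refine e1.trans ?_
      gcongr
    have e3 : ∑ η : M.Conf, 2 * 2 * (2 * t / (2 * M.k - 1) + (2 * t + 8 * ((t - s - 1 : ℕ) : ℝ)
        + 2 * (M.dyn ^ p) (returnExp (s - p) (t - s - 1)) η) / M.ell)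
        = Fintype.card M.Conf * (4 * (2 * t / (2 * M.k - 1)
          + (2 * t + 8 * ((t - s - 1 : ℕ) : ℝ)) / M.ell))
          + 8 / M.ell * ∑ η, (M.dyn ^ p) (returnExp (s - p) (t - s - 1)) η := by
      rw [Finset.mul_sum, ← nsmul_eq_mul, ← Finset.card_univ, ← Finset.sum_const,
        ← Finset.sum_add_distrib]
      refine Finset.sum_congr rfl fun η _ => ?_
      ring
    -- Uses `2k ≤ 2 (2k - 1)` and `t ≤ t²`, so that all terms acquire the common factor `t²/(αℓ)`.
    have e4 : 2 * t / (2 * M.k - 1) ≤ 4 * (t : ℝ) ^ 2 / (M.alpha * M.ell) := by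
      rw [hkα]
      have hk2 : (2 : ℝ) ≤ M.k := by exact_mod_cast M.two_le_k
      rw [div_le_div_iff₀ hk (by linarith)]
      nlinarith [mul_nonneg (sub_nonneg.2 ht1) (by linarith : (0 : ℝ) ≤ t)]
    have e5 : ∀ a : ℝ, 0 ≤ a → a / M.ell ≤ a / (M.alpha * M.ell) := by
      intro a ha
      gcongr
      nlinarith
    have htt : (t : ℝ) ≤ t ^ 2 := by nlinarith
    have e6 : (2 * t + 8 * ((t - s - 1 : ℕ) : ℝ)) / M.ell
        ≤ 10 * (t : ℝ) ^ 2 / (M.alpha * M.ell) := by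
      refine (e5 _ (by positivity)).trans ?_
      gcongr
      linarith
    have e7 : 8 / (M.ell : ℝ) * ∑ η, (M.dyn ^ p) (returnExp (s - p) (t - s - 1)) η
        ≤ Fintype.card M.Conf * (8 * (t ^ 2 * (4 * M.nu + 6)) / (M.alpha * M.ell)) := by
      refine (mul_le_mul_of_nonneg_left e2 (by positivity)).trans ?_
      have := mul_le_mul_of_nonneg_left (e5 (8 * (t ^ 2 * (4 * M.nu + 6))) (by positivity))
        (Nat.cast_nonneg (α := ℝ) (Fintype.card M.Conf))
      refine le_trans (le_of_eq ?_) this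
      ring
    rw [e3]
    have e8 := mul_le_mul_of_nonneg_left (add_le_add e4 e6)
      (Nat.cast_nonneg (α := ℝ) (Fintype.card M.Conf))
    calc _ = 4 * (Fintype.card M.Conf * (2 * t / (2 * M.k - 1)
          + (2 * t + 8 * ((t - s - 1 : ℕ) : ℝ)) / M.ell))
          + 8 / M.ell * ∑ η, (M.dyn ^ p) (returnExp (s - p) (t - s - 1)) η := by ring
      _ ≤ 4 * (Fintype.card M.Conf * (4 * (t : ℝ) ^ 2 / (M.alpha * M.ell)
          + 10 * (t : ℝ) ^ 2 / (M.alpha * M.ell)))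
          + Fintype.card M.Conf * (8 * (t ^ 2 * (4 * M.nu + 6)) / (M.alpha * M.ell)) := by
          linarith
      _ = _ := by ring
  simp only [mixErr]
  rw [Finset.sum_comm]
  have h2 : ∀ s ∈ Finset.range t, ∑ η : M.Conf, ∑ p ∈ Finset.range (s + 1),
      2 * 2 * (2 * t / (2 * M.k - 1) + (2 * t + 8 * ((t - s - 1 : ℕ) : ℝ)
        + 2 * (M.dyn ^ p) (returnExp (s - p) (t - s - 1)) η) / M.ell)
      ≤ t * (Fintype.card M.Conf * (t ^ 2 * (104 + 32 * M.nu) / (M.alpha * M.ell))) := by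
    intro s hs
    rw [Finset.sum_comm]
    refine (Finset.sum_le_sum (h1 s hs)).trans ?_
    rw [Finset.sum_const, Finset.card_range, nsmul_eq_mul]
    rw [Finset.mem_range] at hs
    have : ((s + 1 : ℕ) : ℝ) ≤ t := by exact_mod_cast hs
    gcongr
  refine (Finset.sum_le_sum h2).trans (le_of_eq ?_)
  rw [Finset.sum_const, Finset.card_range, nsmul_eq_mul]
  ring

theorem not_lt_tau_iff {t : ℕ} (w : M.Path t) : Path.tau w ≤ (t : ℕ∞) ↔ ¬ Alive w := by
  rw [← not_lt, le_tau_iff]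

open Classical in
theorem prob_tau_le (η : M.Conf) (x : M.HalfEdge) (t : ℕ) :
    M.prob η x t {w | Path.tau w ≤ (t : ℕ∞)}
      = 1 - M.prob η x t {w | (t : ℕ∞) < Path.tau w} := by
  rw [prob_eq, prob_eq, eq_sub_iff_add_eq, pathExp, pathExp, ← pmfExp_add]
  refine Eq.trans (pmfExp_congr (fun w _ => ?_)) (pmfExp_const (M.pathLaw η x t) 1)
  by_cases h : Alive w <;> simp [not_lt_tau_iff, le_tau_iff, h]

open Classical in
theorem prob_pos_inter (η : M.Conf) (x : M.HalfEdge) (t : ℕ) (A : Set (M.Path t))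
    (y : M.HalfEdge) :
    M.prob η x t ({w | Path.pos w (Fin.last t) = y} ∩ A)
      = pathExp η x t fun w => if w ∈ A then (if cur w = y then 1 else 0) else 0 := by
  rw [prob_eq]
  refine pmfExp_congr fun w _ => ?_
  have hc : Path.pos w (Fin.last t) = cur w := rfl
  by_cases h1 : w ∈ A <;> by_cases h2 : cur w = y <;>
    simp [hc, h1, h2]

open Classical in
theorem sum_mul_prob_pos_inter (η : M.Conf) (x : M.HalfEdge) (t : ℕ) (A : Set (M.Path t))
    (f : M.HalfEdge → ℝ) :
    ∑ y, f y * M.prob η x t ({w | Path.pos w (Fin.last t) = y} ∩ A)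
      = pathExp η x t fun w => if w ∈ A then f (cur w) else 0 := by
  simp only [prob_pos_inter, pathExp]
  simp only [← pmfExp_const_mul]
  rw [← pmfExp_sum]
  refine pmfExp_congr fun w _ => ?_
  by_cases h1 : w ∈ A <;> simp [h1]

theorem sum_prob_pos_inter (η : M.Conf) (x : M.HalfEdge) (t : ℕ) (A : Set (M.Path t)) :
    ∑ y, M.prob η x t ({w | Path.pos w (Fin.last t) = y} ∩ A) = M.prob η x t A := by
  classical
  have h := sum_mul_prob_pos_inter η x t A fun _ => 1
  simp only [one_mul] at h
  rw [h, prob_eq]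
  exact pmfExp_congr fun w _ => by simp [Set.indicator_apply]

/-- Distance from uniformity, given that a rewired edge has been used. -/
theorem tvDist_condLaw_le (η : M.Conf) (x : M.HalfEdge) {t : ℕ} (ht : 1 ≤ t)
    (hL : 4 * t ≤ M.ell) :
    tvDist (M.condLaw η x t {w | Path.tau w ≤ (t : ℕ∞)}) M.unif ≤ mixErr t η / M.alpha := by
  classical
  have hell : (0 : ℝ) < M.ell := by exact_mod_cast M.ell_pos
  have hα := M.alpha_pos
  obtain ⟨A, hA⟩ : ∃ A : Set (M.Path t), A = {w | Path.tau w ≤ (t : ℕ∞)} := ⟨_, rfl⟩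
  obtain ⟨q, hq⟩ : ∃ q, q = M.prob η x t A := ⟨_, rfl⟩
  obtain ⟨p, hp⟩ : ∃ p : M.HalfEdge → ℝ,
    p = fun y => M.prob η x t ({w | Path.pos w (Fin.last t) = y} ∩ A) := ⟨_, rfl⟩
  have hqα : M.alpha ≤ q := by
    rw [hq, hA, prob_tau_le]
    linarith [prob_tau_gt_le η x ht]
  have hq0 : 0 < q := hα.trans_le hqα
  obtain ⟨σ, hσ⟩ : ∃ σ : M.HalfEdge → ℝ, σ = fun y => if 0 ≤ p y - q / M.ell then 1 else -1 :=
    ⟨_, rfl⟩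
  have hσ1 : ∀ y, |σ y| ≤ 1 := by
    intro y
    rw [hσ]
    dsimp only
    split_ifs <;> simp
  have hσp : ∀ y, |p y - q / M.ell| = σ y * (p y - q / M.ell) := by
    intro y
    rw [hσ]
    dsimp only
    split_ifs with h
    · rw [abs_of_nonneg h, one_mul]
    · rw [abs_of_neg (not_le.1 h)]
      ring
  -- The sign of the deviation realises the `ℓ¹` norm. Centring it makes the estimate for mean-zero
  -- functions applicable, with `K = 2`, and does not affect the pairing because `p` has total mass
  -- `q`.
  obtain ⟨f, hf⟩ : ∃ f : M.HalfEdge → ℝ, f = fun y => σ y - (∑ z, σ z) / M.ell := ⟨_, rfl⟩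
  have hmean : |(∑ z, σ z) / M.ell| ≤ 1 := by
    rw [abs_div, abs_of_pos hell, div_le_one hell]
    refine (Finset.abs_sum_le_sum_abs _ _).trans ((Finset.sum_le_sum fun z _ => hσ1 z).trans ?_)
    rw [Finset.sum_const, Finset.card_univ, card_halfEdge]
    simp
  have hf1 : ∀ y, |f y| ≤ 2 := by
    intro y
    rw [hf]
    refine (abs_sub _ _).trans ?_
    linarith [hσ1 y]
  have hf0 : ∑ y, f y = 0 := by
    rw [hf, Finset.sum_sub_distrib, Finset.sum_const, Finset.card_univ, card_halfEdge,
      nsmul_eq_mul]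
    field_simp
    ring
  have hsum : ∑ y, p y = q := by
    rw [hp, hq]
    exact sum_prob_pos_inter η x t A
  have h1 : ∑ y, |p y - q / M.ell|
      = pathExp η x t fun w => if Alive w then 0 else walkExp f 0 (conf w) (cur w) := by
    have e1 : ∑ y, |p y - q / M.ell| = ∑ y, f y * p y := by
      rw [Finset.sum_congr rfl fun y _ => hσp y]
      simp only [mul_sub, hf, sub_mul, Finset.sum_sub_distrib]
      rw [← Finset.sum_mul, ← Finset.mul_sum, hsum]
      ring
    rw [e1, hp, sum_mul_prob_pos_inter]
    refine pmfExp_congr fun w _ => ?_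
    have hw : w ∈ A ↔ ¬ Alive w := by
      rw [hA]
      exact not_lt_tau_iff w
    by_cases h : Alive w <;> simp [hw, h, walkExp]
  have h2 : ∑ y, |p y - q / M.ell| ≤ mixErr t η := by
    rw [h1]
    refine (le_abs_self _).trans ?_
    have := abs_pathExp_not_alive_le hf1 hf0 hL η x t 0 (by omega)
    simp only [add_zero] at this
    rw [mixErr]
    exact this
  have h3 : tvDist (M.condLaw η x t A) M.unif = (1 / 2) * ((∑ y, |p y - q / M.ell|) / q) := by
    rw [tvDist, Finset.sum_div]
    congr 1
    refine Finset.sum_congr rfl fun y _ => ?_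
    have : M.condLaw η x t A y - M.unif y = (p y - q / M.ell) / q := by
      rw [condLaw, unif, ← hq, hp]
      field_simp
    rw [this, abs_div, abs_of_pos hq0]
  rw [← hA, h3]
  have h4 : (∑ y, |p y - q / M.ell|) / q ≤ mixErr t η / M.alpha := by
    gcongr
    exact mixErr_nonneg t η
  have h5 : 0 ≤ mixErr t η / M.alpha := div_nonneg (mixErr_nonneg t η) hα.le
  linarith

/-! ### Balls in the initial configuration -/

/-- The half-edges at vertices within distance `i` of the vertex of `x`. -/
def ball (η : M.Conf) (x : M.HalfEdge) : ℕ → Finset M.HalfEdge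
  | 0 => Finset.univ.filter fun w => w.1 = x.1
  | i + 1 => Finset.univ.filter fun w => w ∈ ball η x i ∨ ∃ y ∈ ball η x i, w.1 = (η.1 y).1

theorem mem_ball_succ {η : M.Conf} {x w : M.HalfEdge} {i : ℕ} :
    w ∈ ball η x (i + 1) ↔ w ∈ ball η x i ∨ ∃ y ∈ ball η x i, w.1 = (η.1 y).1 := by
  simp [ball]

theorem mem_ball_of_vertex {η : M.Conf} {x w c : M.HalfEdge} {i : ℕ} (h : w.1 = c.1)
    (hc : c ∈ ball η x i) : w ∈ ball η x i := by
  induction i with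
  | zero =>
    simp only [ball, Finset.mem_filter, Finset.mem_univ, true_and] at hc ⊢
    rw [h, hc]
  | succ i ih =>
    rw [mem_ball_succ] at hc ⊢
    rcases hc with hc | ⟨y, hy, hc⟩
    · exact Or.inl (ih hc)
    · exact Or.inr ⟨y, hy, h.trans hc⟩

theorem ball_subset_succ (η : M.Conf) (x : M.HalfEdge) (i : ℕ) :
    ball η x i ⊆ ball η x (i + 1) := fun _ hw => mem_ball_succ.2 (Or.inl hw)

theorem conf_mem_ball_succ {η : M.Conf} {x y : M.HalfEdge} {i : ℕ} (h : y ∈ ball η x i) :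
    η.1 y ∈ ball η x (i + 1) := mem_ball_succ.2 (Or.inr ⟨y, h, rfl⟩)

/-- One step of the walk increases the radius of the ball known to contain it by one. -/
theorem staticExp_eq_zero {η : M.Conf} {x : M.HalfEdge} {F : List M.HalfEdge → M.HalfEdge → ℝ}
    {s i : ℕ} {l : List M.HalfEdge} {y : M.HalfEdge} (hy : y ∈ ball η x i)
    (hF : ∀ l' y', y' ∈ ball η x (i + s) → F l' y' = 0) : staticExp η s l y F = 0 := by
  induction s generalizing l y i with
  | zero => exact hF l y hy
  | succ s ih =>
    rw [staticExp, ← savg_const (η.1 y) 0]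
    refine savg_congr fun w hw => ih (i := i + 1) ?_ ?_
    · exact mem_ball_of_vertex (M.mem_siblings.1 hw).1 (conf_mem_ball_succ hy)
    · intro l' y' h
      exact hF l' y' (by rwa [show i + (s + 1) = i + 1 + s by omega])

theorem prob_pos_alive_eq_zero {η : M.Conf} {x y : M.HalfEdge} {t : ℕ} (hy : y ∉ ball η x t) :
    M.prob η x t ({w | Path.pos w (Fin.last t) = y} ∩ {w | (t : ℕ∞) < Path.tau w}) = 0 := by
  classical
  have h := pathExp_alive η x t (fun _ _ => ∅) (fun _ z _ => if z = y then 1 else 0)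
  rw [prob_pos_inter]
  refine Eq.trans (pmfExp_congr fun w _ => ?_) (h.trans (staticExp_eq_zero (x := x) (i := 0) ?_ ?_))
  · simp [le_tau_iff]
  · simp [ball]
  · intro l z hz
    rw [zero_add] at hz
    have hzy : z ≠ y := fun h => hy (h ▸ hz)
    simp only [hzy, if_false]
    exact congrFun (map_zero (chainOp l ∅)) η

/-- Distance from uniformity, given that no rewired edge has been used. -/
theorem le_tvDist_condLaw (η : M.Conf) (x : M.HalfEdge) (t : ℕ)
    (hpos : 0 < M.prob η x t {w | (t : ℕ∞) < Path.tau w}) :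
    1 - ((ball η x t).card : ℝ) / M.ell
      ≤ tvDist (M.condLaw η x t {w | (t : ℕ∞) < Path.tau w}) M.unif := by
  have hell : (0 : ℝ) < M.ell := by exact_mod_cast M.ell_pos
  obtain ⟨c, hc⟩ : ∃ c, c = M.condLaw η x t {w | (t : ℕ∞) < Path.tau w} := ⟨_, rfl⟩
  have hsum : ∑ y, c y = 1 := by
    rw [hc]
    simp only [condLaw]
    rw [← Finset.sum_div, sum_prob_pos_inter, div_self hpos.ne']
  have hc0 : ∀ y ∈ (ball η x t)ᶜ, c y = 0 := by
    intro y hy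
    rw [hc, condLaw, prob_pos_alive_eq_zero (Finset.mem_compl.1 hy), zero_div]
  have hsumB : ∑ y ∈ ball η x t, c y = 1 := by
    rw [← Finset.sum_add_sum_compl (ball η x t), Finset.sum_eq_zero hc0, add_zero] at hsum
    exact hsum
  have hcard : ((ball η x t)ᶜ.card : ℝ) = M.ell - (ball η x t).card := by
    rw [Finset.card_compl, card_halfEdge, Nat.cast_sub]
    rw [← card_halfEdge]
    exact Finset.card_le_univ _
  rw [← hc, tvDist, ← Finset.sum_add_sum_compl (ball η x t)]
  have h1 : 1 - ((ball η x t).card : ℝ) / M.ell ≤ ∑ y ∈ ball η x t, |c y - M.unif y| := by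
    refine le_trans (le_of_eq ?_) (Finset.sum_le_sum fun y _ => le_abs_self _)
    rw [Finset.sum_sub_distrib, hsumB]
    simp [unif, div_eq_mul_inv]
  have h2 : 1 - ((ball η x t).card : ℝ) / M.ell ≤ ∑ y ∈ (ball η x t)ᶜ, |c y - M.unif y| := by
    refine le_of_eq ?_
    have : ∀ y ∈ (ball η x t)ᶜ, |c y - M.unif y| = 1 / M.ell := by
      intro y hy
      rw [hc0 y hy, zero_sub, abs_neg, unif, abs_of_pos (by positivity)]
    rw [Finset.sum_congr rfl this, Finset.sum_const, nsmul_eq_mul, hcard]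
    field_simp
  linarith

/-- Building the ball reveals only partners of half-edges in smaller balls, and these partners lie
in the ball, so the swap touches none of the revealed pairs. -/
theorem ball_conj {η : M.Conf} {x b c : M.HalfEdge} {i : ℕ} (hb : b ∉ ball η x i)
    (hc : c ∉ ball η x i) : ball (conj (Equiv.swap c b) η) x i = ball η x i := by
  induction i with
  | zero => rfl
  | succ i ih =>
    have hb' : b ∉ ball η x i := fun h => hb (ball_subset_succ η x i h)
    have hc' : c ∉ ball η x i := fun h => hc (ball_subset_succ η x i h)
    ext w
    rw [mem_ball_succ, mem_ball_succ, ih hb' hc']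
    have : ∀ y ∈ ball η x i, (conj (Equiv.swap c b) η).1 y = η.1 y := by
      intro y hy
      have hy' := conf_mem_ball_succ hy
      rw [conj_apply_of_fixed, Equiv.swap_apply_of_ne_of_ne]
      · exact fun h => hc (h ▸ hy')
      · exact fun h => hb (h ▸ hy')
      · exact Equiv.swap_apply_of_ne_of_ne (fun h => hc' (h ▸ hy)) fun h => hb' (h ▸ hy)
    refine or_congr Iff.rfl (exists_congr fun y => and_congr_right fun hy => ?_)
    rw [this y hy]

theorem conj_swap_conj_swap (η : M.Conf) (b c : M.HalfEdge) :
    conj (Equiv.swap c b) (conj (Equiv.swap c b) η) = η := by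
  apply Subtype.ext
  ext1 y
  simp [conj_apply]

/-- The half-edges outside of a ball that are paired with a half-edge in the ball. -/
def boundary (η : M.Conf) (x : M.HalfEdge) (i : ℕ) : Finset M.HalfEdge :=
  Finset.univ.filter fun c => c ∉ ball η x i ∧ η.1 c ∈ ball η x i

theorem mem_boundary {η : M.Conf} {x c : M.HalfEdge} {i : ℕ} :
    c ∈ boundary η x i ↔ c ∉ ball η x i ∧ η.1 c ∈ ball η x i := by
  simp [boundary]

theorem card_boundary_le (η : M.Conf) (x : M.HalfEdge) (i : ℕ) :
    (boundary η x i).card ≤ (ball η x i).card := by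
  refine Finset.card_le_card_of_injOn η.1 (fun c hc => ?_) η.1.injective.injOn
  exact (mem_boundary.1 (Finset.mem_coe.1 hc)).2

/-- By exchangeability, all half-edges are equally likely to be in the boundary of a ball. -/
theorem sum_mem_boundary_le (x c : M.HalfEdge) (i : ℕ) :
    (M.ell : ℝ) * ∑ η : M.Conf, (if 2 * (ball η x i).card ≤ M.ell ∧ c ∈ boundary η x i
        then 1 else 0)
      ≤ 2 * ∑ η : M.Conf, if 2 * (ball η x i).card ≤ M.ell then ((ball η x i).card : ℝ) else 0 := by
  obtain ⟨a, ha⟩ : ∃ a : ℝ, a = ∑ η : M.Conf,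
    (if 2 * (ball η x i).card ≤ M.ell ∧ c ∈ boundary η x i then 1 else 0) := ⟨_, rfl⟩
  obtain ⟨s, hs⟩ : ∃ s : ℝ, s = ∑ η : M.Conf,
    if 2 * (ball η x i).card ≤ M.ell then ((ball η x i).card : ℝ) else 0 := ⟨_, rfl⟩
  -- Swapping `b` and `c` preserves a ball that contains neither, and exchanges their roles on its
  -- boundary.
  have hsym : ∀ b, ∑ η : M.Conf, (if (2 * (ball η x i).card ≤ M.ell ∧ c ∈ boundary η x i)
        ∧ b ∉ ball η x i then (1 : ℝ) else 0)
      = ∑ η : M.Conf, if (2 * (ball η x i).card ≤ M.ell ∧ b ∈ boundary η x i)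
        ∧ c ∉ ball η x i then 1 else 0 := by
    intro b
    have key : ∀ η : M.Conf, ((2 * (ball η x i).card ≤ M.ell ∧ c ∈ boundary η x i)
        ∧ b ∉ ball η x i) → ((2 * (ball (conj (Equiv.swap c b) η) x i).card ≤ M.ell
          ∧ b ∈ boundary (conj (Equiv.swap c b) η) x i)
          ∧ c ∉ ball (conj (Equiv.swap c b) η) x i) := by
      rintro η ⟨⟨h1, h2⟩, h3⟩
      rw [mem_boundary] at h2 ⊢
      rw [ball_conj h3 h2.1]
      refine ⟨⟨h1, h3, ?_⟩, h2.1⟩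
      rw [conj_apply, Equiv.swap_inv, Equiv.swap_apply_right, Equiv.swap_apply_of_ne_of_ne]
      · exact h2.2
      · exact conf_ne η c
      · exact fun h => h3 (h ▸ h2.2)
    have key' : ∀ η : M.Conf, ((2 * (ball (conj (Equiv.swap c b) η) x i).card ≤ M.ell
          ∧ b ∈ boundary (conj (Equiv.swap c b) η) x i)
          ∧ c ∉ ball (conj (Equiv.swap c b) η) x i) →
          ((2 * (ball η x i).card ≤ M.ell ∧ c ∈ boundary η x i) ∧ b ∉ ball η x i) := by
      rintro η ⟨⟨h1, h2⟩, h3⟩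
      rw [mem_boundary] at h2
      have hb := ball_conj h2.1 h3
      rw [conj_swap_conj_swap] at hb
      rw [mem_boundary, hb]
      refine ⟨⟨h1, h3, ?_⟩, h2.1⟩
      have h4 := h2.2
      rw [conj_apply, Equiv.swap_inv, Equiv.swap_apply_right] at h4
      by_cases hcb : η.1 c = b
      · rw [hcb, Equiv.swap_apply_right] at h4
        exact absurd h4 h3
      · rwa [Equiv.swap_apply_of_ne_of_ne (conf_ne η c) hcb] at h4
    rw [← Equiv.sum_comp (conj (Equiv.swap c b)) fun η : M.Conf =>
      if (2 * (ball η x i).card ≤ M.ell ∧ b ∈ boundary η x i) ∧ c ∉ ball η x i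
        then (1 : ℝ) else 0]
    refine Finset.sum_congr rfl fun η _ => ?_
    by_cases h : (2 * (ball η x i).card ≤ M.ell ∧ c ∈ boundary η x i) ∧ b ∉ ball η x i
    · rw [if_pos h, if_pos (key η h)]
    · rw [if_neg h, if_neg fun h' => h (key' η h')]
  -- Sum over all `b`. For `b` outside the ball the symmetry yields at most the size of the
  -- boundary; at most `ℓ/2` values of `b` lie inside, and their contribution is absorbed on the
  -- left.
  have h1 : (M.ell : ℝ) * a ≤ s + M.ell / 2 * a := by
    calc (M.ell : ℝ) * a = ∑ _b : M.HalfEdge, a := by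
          rw [Finset.sum_const, Finset.card_univ, card_halfEdge, nsmul_eq_mul]
      _ = ∑ b : M.HalfEdge, ((∑ η : M.Conf, if (2 * (ball η x i).card ≤ M.ell
            ∧ c ∈ boundary η x i) ∧ b ∉ ball η x i then (1 : ℝ) else 0)
          + ∑ η : M.Conf, if (2 * (ball η x i).card ≤ M.ell
            ∧ c ∈ boundary η x i) ∧ b ∈ ball η x i then (1 : ℝ) else 0) := by
          refine Finset.sum_congr rfl fun b _ => ?_
          rw [ha, ← Finset.sum_add_distrib]
          refine Finset.sum_congr rfl fun η _ => ?_
          by_cases h : b ∈ ball η x i <;> simp [h]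
      _ = ∑ η : M.Conf, ∑ b, (if (2 * (ball η x i).card ≤ M.ell
            ∧ b ∈ boundary η x i) ∧ c ∉ ball η x i then (1 : ℝ) else 0)
          + ∑ η : M.Conf, ∑ b, (if (2 * (ball η x i).card ≤ M.ell
            ∧ c ∈ boundary η x i) ∧ b ∈ ball η x i then (1 : ℝ) else 0) := by
          rw [Finset.sum_add_distrib, Finset.sum_congr rfl fun b _ => hsym b, Finset.sum_comm]
          congr 1
          exact Finset.sum_comm
      _ ≤ s + M.ell / 2 * a := by
          rw [hs, ha, Finset.mul_sum]
          refine add_le_add (Finset.sum_le_sum fun η _ => ?_) (Finset.sum_le_sum fun η _ => ?_)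
          · by_cases h : 2 * (ball η x i).card ≤ M.ell
            · simp only [h, true_and, if_true]
              calc ∑ b, (if b ∈ boundary η x i ∧ c ∉ ball η x i then (1 : ℝ) else 0)
                  ≤ ∑ b, if b ∈ boundary η x i then (1 : ℝ) else 0 := by
                    refine Finset.sum_le_sum fun b _ => ?_
                    by_cases h1 : b ∈ boundary η x i <;> by_cases h2 : c ∉ ball η x i <;>
                      simp [h1, h2]
                _ = ((boundary η x i).card : ℝ) := by
                    rw [Finset.sum_ite_mem, Finset.univ_inter]
                    simp
                _ ≤ _ := by exact_mod_cast card_boundary_le η x i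
            · simp [h]
          · by_cases h : 2 * (ball η x i).card ≤ M.ell ∧ c ∈ boundary η x i
            · simp only [h, true_and, if_true, mul_one, and_self]
              rw [Finset.sum_ite_mem, Finset.univ_inter]
              have : ((2 * (ball η x i).card : ℕ) : ℝ) ≤ M.ell := by exact_mod_cast h.1
              push_cast at this
              simp only [Finset.sum_const, nsmul_eq_mul, mul_one]
              linarith
            · simp only [h, false_and, if_false, Finset.sum_const_zero, mul_zero, le_refl]
  rw [← ha, ← hs]
  linarith

theorem card_vertex (c : M.HalfEdge) :
    (Finset.univ.filter fun w : M.HalfEdge => w.1 = c.1).card = (M.siblings c).card + 1 := by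
  have : (Finset.univ.filter fun w : M.HalfEdge => w.1 = c.1) = insert c (M.siblings c) := by
    ext w
    simp only [Finset.mem_filter, Finset.mem_univ, true_and, Finset.mem_insert, mem_siblings]
    by_cases h : w = c <;> simp [h]
  rw [this, Finset.card_insert_of_notMem]
  simp [mem_siblings]

theorem card_ball_succ_le (η : M.Conf) (x : M.HalfEdge) (i : ℕ) :
    ((ball η x (i + 1)).card : ℝ) ≤ (ball η x i).card
      + ∑ c, (if c ∈ boundary η x i then 1 else 0) * ((M.siblings c).card + 1 : ℝ) := by
  have hsub : ball η x (i + 1) ⊆ ball η x i ∪ (boundary η x i).biUnion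
      fun c => Finset.univ.filter fun w : M.HalfEdge => w.1 = c.1 := by
    intro w hw
    rw [Finset.mem_union, Finset.mem_biUnion]
    by_cases hwb : w ∈ ball η x i
    · exact Or.inl hwb
    · rcases mem_ball_succ.1 hw with h | ⟨y, hy, h⟩
      · exact absurd h hwb
      · refine Or.inr ⟨η.1 y, mem_boundary.2 ⟨fun h' => hwb (mem_ball_of_vertex h h'), ?_⟩, ?_⟩
        · rwa [conf_conf]
        · simpa using h
  have h1 := (Finset.card_le_card hsub).trans ((Finset.card_union_le _ _).trans
    (Nat.add_le_add_left Finset.card_biUnion_le _))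
  simp only [card_vertex] at h1
  have h2 : ((ball η x (i + 1)).card : ℝ) ≤ (((ball η x i).card
      + ∑ c ∈ boundary η x i, ((M.siblings c).card + 1) : ℕ) : ℝ) := by exact_mod_cast h1
  refine h2.trans (le_of_eq ?_)
  push_cast
  congr 1
  simp only [ite_mul, one_mul, zero_mul]
  rw [Finset.sum_ite_mem, Finset.univ_inter]

theorem sum_deg_add_one : ∑ x : M.HalfEdge, ((M.siblings x).card + 1 : ℝ)
    = M.ell * (M.nu + 1) := by
  rw [Finset.sum_add_distrib, sum_deg_eq, Finset.sum_const, Finset.card_univ, card_halfEdge,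
    nsmul_eq_mul]
  ring

/-- The growth factor is `1 + 2 (ν + 1)`: the old ball, plus boundary half-edges `c`, each bringing
the whole vertex of `c`. Configurations whose ball already exceeds `ℓ/2` are at the truncation level
`1` and are counted by `r`. -/
theorem sum_min_ball_succ_le (x : M.HalfEdge) (i : ℕ) :
    ∑ η : M.Conf, min 1 (2 * ((ball η x (i + 1)).card : ℝ) / M.ell)
      ≤ (2 * M.nu + 3) * ∑ η : M.Conf, min 1 (2 * ((ball η x i).card : ℝ) / M.ell) := by
  have hell : (0 : ℝ) < M.ell := by exact_mod_cast M.ell_pos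
  have hν := M.nu_nonneg
  obtain ⟨s, hs⟩ : ∃ s : ℝ, s = ∑ η : M.Conf,
    if 2 * (ball η x i).card ≤ M.ell then ((ball η x i).card : ℝ) else 0 := ⟨_, rfl⟩
  obtain ⟨r, hr⟩ : ∃ r : ℝ, r = ∑ η : M.Conf,
    if 2 * (ball η x i).card ≤ M.ell then (0 : ℝ) else 1 := ⟨_, rfl⟩
  have hr0 : 0 ≤ r := by
    rw [hr]
    exact Finset.sum_nonneg fun η _ => by split_ifs <;> norm_num
  have h1 : ∑ η : M.Conf, min 1 (2 * ((ball η x i).card : ℝ) / M.ell) = r + 2 / M.ell * s := by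
    rw [hr, hs, Finset.mul_sum, ← Finset.sum_add_distrib]
    refine Finset.sum_congr rfl fun η _ => ?_
    split_ifs with h
    · have : ((2 * (ball η x i).card : ℕ) : ℝ) ≤ M.ell := by exact_mod_cast h
      push_cast at this
      rw [min_eq_right ((div_le_one hell).2 this)]
      ring
    · have : (M.ell : ℝ) ≤ ((2 * (ball η x i).card : ℕ) : ℝ) := by
        exact_mod_cast (not_le.1 h).le
      push_cast at this
      rw [min_eq_left ((one_le_div hell).2 this)]
      ring
  have h2 : ∑ η : M.Conf, (if 2 * (ball η x i).card ≤ M.ell then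
      ((ball η x (i + 1)).card : ℝ) else 0) ≤ (2 * M.nu + 3) * s := by
    calc ∑ η : M.Conf, (if 2 * (ball η x i).card ≤ M.ell then
          ((ball η x (i + 1)).card : ℝ) else 0)
        ≤ ∑ η : M.Conf, ((if 2 * (ball η x i).card ≤ M.ell then ((ball η x i).card : ℝ) else 0)
          + ∑ c, (if 2 * (ball η x i).card ≤ M.ell ∧ c ∈ boundary η x i then 1 else 0)
            * ((M.siblings c).card + 1 : ℝ)) := by
          refine Finset.sum_le_sum fun η _ => ?_
          by_cases h : 2 * (ball η x i).card ≤ M.ell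
          · simp only [h, if_true, true_and]
            exact card_ball_succ_le η x i
          · simp [h]
      _ = s + ∑ c, (∑ η : M.Conf, if 2 * (ball η x i).card ≤ M.ell ∧ c ∈ boundary η x i
            then (1 : ℝ) else 0) * ((M.siblings c).card + 1 : ℝ) := by
          rw [Finset.sum_add_distrib, ← hs, Finset.sum_comm]
          simp only [Finset.sum_mul]
      _ ≤ s + ∑ c : M.HalfEdge, (2 * s / M.ell) * ((M.siblings c).card + 1 : ℝ) := by
          refine add_le_add le_rfl (Finset.sum_le_sum fun c _ => ?_)
          refine mul_le_mul_of_nonneg_right ?_ (by positivity)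
          rw [le_div_iff₀ hell, mul_comm, hs]
          exact sum_mem_boundary_le x c i
      _ = (2 * M.nu + 3) * s := by
          rw [← Finset.mul_sum, sum_deg_add_one]
          field_simp
          ring
  calc ∑ η : M.Conf, min 1 (2 * ((ball η x (i + 1)).card : ℝ) / M.ell)
      ≤ ∑ η : M.Conf, ((if 2 * (ball η x i).card ≤ M.ell then (0 : ℝ) else 1)
        + 2 / M.ell * if 2 * (ball η x i).card ≤ M.ell then
          ((ball η x (i + 1)).card : ℝ) else 0) := by
        refine Finset.sum_le_sum fun η _ => ?_
        split_ifs
        · refine (min_le_right _ _).trans (le_of_eq ?_)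
          ring
        · refine (min_le_left _ _).trans (le_of_eq ?_)
          ring
    _ = r + 2 / M.ell * ∑ η : M.Conf, (if 2 * (ball η x i).card ≤ M.ell then
          ((ball η x (i + 1)).card : ℝ) else 0) := by
        rw [Finset.sum_add_distrib, ← hr, Finset.mul_sum]
    _ ≤ r + 2 / M.ell * ((2 * M.nu + 3) * s) := by gcongr
    _ ≤ (2 * M.nu + 3) * (r + 2 / M.ell * s) := by nlinarith
    _ = _ := by rw [h1]

/-- For a uniform initial state, the mean size of a ball of radius `i` is `O((2ν + 3)^i)`, if balls
with more than `ℓ / 2` elements are counted as having `ℓ / 2`. -/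
theorem sum_min_ball_le (i : ℕ) :
    ∑ η : M.Conf, ∑ x : M.HalfEdge, min 1 (2 * ((ball η x i).card : ℝ) / M.ell)
      ≤ Fintype.card M.Conf * ((2 * M.nu + 3) ^ i * (2 * (M.nu + 1))) := by
  have hell : (0 : ℝ) < M.ell := by exact_mod_cast M.ell_pos
  have hν := M.nu_nonneg
  have h1 : ∀ x : M.HalfEdge, ∑ η : M.Conf, min 1 (2 * ((ball η x i).card : ℝ) / M.ell)
      ≤ (2 * M.nu + 3) ^ i * (Fintype.card M.Conf
        * (2 * ((M.siblings x).card + 1 : ℝ) / M.ell)) := by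
    intro x
    induction i with
    | zero =>
      rw [pow_zero, one_mul, ← nsmul_eq_mul, ← Finset.card_univ, ← Finset.sum_const]
      refine Finset.sum_le_sum fun η _ => (min_le_right _ _).trans (le_of_eq ?_)
      rw [ball, card_vertex]
      push_cast
      ring
    | succ i ih =>
      refine (sum_min_ball_succ_le x i).trans ?_
      rw [pow_succ', mul_assoc]
      exact mul_le_mul_of_nonneg_left ih (by positivity)
  rw [Finset.sum_comm]
  refine (Finset.sum_le_sum fun x _ => h1 x).trans (le_of_eq ?_)
  have h2 : ∀ x : M.HalfEdge, (2 * M.nu + 3) ^ i * (Fintype.card M.Conf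
        * (2 * ((M.siblings x).card + 1 : ℝ) / M.ell))
      = (2 * M.nu + 3) ^ i * (Fintype.card M.Conf * 2 / M.ell) * ((M.siblings x).card + 1) := by
    intro x
    ring
  rw [Finset.sum_congr rfl fun x _ => h2 x, ← Finset.mul_sum, sum_deg_add_one]
  field_simp

/-! ### The probability of keeping edges -/

theorem keepProb_mem_Icc (j : ℕ) : 0 ≤ M.keepProb j ∧ M.keepProb j ≤ 1 := by
  rw [keepProb]
  refine ⟨by positivity, div_le_one_of_le₀ ?_ (by positivity)⟩
  exact_mod_cast Nat.choose_le_choose _ (Nat.sub_le _ _)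

theorem abs_mul_sub_mul_le {a b c d : ℝ} (ha : 0 ≤ a) (ha1 : a ≤ 1) (hd : 0 ≤ d) (hd1 : d ≤ 1) :
    |a * b - c * d| ≤ |a - c| + |b - d| := by
  have h : a * b - c * d = a * (b - d) + (a - c) * d := by ring
  rw [h]
  refine (abs_add_le _ _).trans ?_
  rw [abs_mul, abs_mul, abs_of_nonneg ha, abs_of_nonneg hd]
  nlinarith [abs_nonneg (b - d), abs_nonneg (a - c)]

/-- Keeping one more edge brings the factor `(m - j - k)/(m - j)`, read as `0` if `k > m - j`. It
differs from `1 - α` by at most `j/(m - j) ≤ 2t/m`, and errors of factors in `[0, 1]` add up. -/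
theorem abs_keepProb_sub_le {t : ℕ} (htm : 2 * t ≤ M.m) {j : ℕ} (hj : j ≤ t) :
    |M.keepProb j - (1 - M.alpha) ^ j| ≤ j * (2 * t / M.m) := by
  have hm : (0 : ℝ) < M.m := by exact_mod_cast M.m_pos
  have hα0 := sub_nonneg.2 M.alpha_le_one
  have hα1 : 1 - M.alpha ≤ 1 := by linarith [M.alpha_pos]
  induction j with
  | zero =>
    have hc : (M.m.choose M.k : ℝ) ≠ 0 := by exact_mod_cast (Nat.choose_pos M.k_le_m).ne'
    simp [keepProb, hc]
  | succ j ih =>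
    have ih' := ih (by omega)
    obtain ⟨a, ha⟩ : ∃ a, M.m = a + 1 + j := ⟨M.m - 1 - j, by omega⟩
    have har : (M.m : ℝ) = a + 1 + j := by exact_mod_cast ha
    have hjt : (j : ℝ) ≤ t := by exact_mod_cast (by omega : j ≤ t)
    have htmr : (2 * t : ℝ) ≤ M.m := by exact_mod_cast htm
    have ha0 : (0 : ℝ) < a + 1 := by positivity
    have hkp : M.keepProb (j + 1) = M.keepProb j * (((a + 1 - M.k : ℕ) : ℝ) / (a + 1)) := by
      have h := Nat.choose_mul_succ_eq a M.k
      have h' : ((a.choose M.k * (a + 1) : ℕ) : ℝ)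
          = (((a + 1).choose M.k * (a + 1 - M.k) : ℕ) : ℝ) := by rw [h]
      push_cast at h'
      rw [keepProb, keepProb, show M.m - (j + 1) = a by omega, show M.m - j = a + 1 by omega]
      field_simp
      rw [h']
    have hr : |((a + 1 - M.k : ℕ) : ℝ) / (a + 1) - (1 - M.alpha)| ≤ 2 * t / M.m := by
      have hkm : (M.k : ℝ) ≤ M.m := by exact_mod_cast M.k_le_m
      have hk0 : (0 : ℝ) ≤ M.k := Nat.cast_nonneg _
      have e1 : 1 - M.alpha = (M.m - M.k) / M.m := by
        rw [alpha]
        field_simp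
      have e2 : (j : ℝ) / (a + 1) ≤ 2 * t / M.m := by
        rw [div_le_div_iff₀ ha0 hm]
        have hj0 : (0 : ℝ) ≤ j := Nat.cast_nonneg _
        nlinarith
      refine le_trans ?_ e2
      rcases le_total M.k (a + 1) with hk | hk
      · rw [Nat.cast_sub hk, e1, abs_le]
        push_cast
        constructor
        · rw [le_sub_iff_add_le, neg_add_eq_sub, sub_le_iff_le_add, ← add_div,
            div_le_div_iff₀ hm ha0]
          rw [har] at hkm ⊢
          have hkar : (M.k : ℝ) ≤ a + 1 := by exact_mod_cast hk
          have hj0 : (0 : ℝ) ≤ j := Nat.cast_nonneg _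
          nlinarith [mul_nonneg hj0 hk0, mul_nonneg hj0 hj0, mul_nonneg hj0 ha0.le,
            mul_nonneg hj0 (sub_nonneg.2 hkar)]
        · rw [sub_le_iff_le_add]
          have : ((a : ℝ) + 1 - M.k) / (a + 1) ≤ (M.m - M.k) / M.m := by
            rw [div_le_div_iff₀ ha0 hm, har]
            have hj0 : (0 : ℝ) ≤ j := Nat.cast_nonneg _
            nlinarith [mul_nonneg hj0 hk0]
          have : (0 : ℝ) ≤ j / (a + 1) := by positivity
          linarith
      · rw [Nat.sub_eq_zero_of_le hk, Nat.cast_zero, zero_div, zero_sub, abs_neg,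
          abs_of_nonneg hα0, e1]
        have hkr : (a : ℝ) + 1 ≤ M.k := by exact_mod_cast hk
        have hj0 : (0 : ℝ) ≤ j := Nat.cast_nonneg _
        rw [div_le_div_iff₀ hm ha0]
        nlinarith
    rw [hkp, pow_succ]
    refine (abs_mul_sub_mul_le (keepProb_mem_Icc j).1 (keepProb_mem_Icc j).2 hα0 hα1).trans ?_
    push_cast
    linarith

theorem abs_prod_keepProb_sub_le {t : ℕ} (htm : 2 * t ≤ M.m) :
    |∏ j ∈ Finset.range t, M.keepProb (j + 1) - (1 - M.alpha) ^ (t * (t + 1) / 2)|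
      ≤ 2 * t ^ 3 / M.m := by
  have hm : (0 : ℝ) < M.m := by exact_mod_cast M.m_pos
  have hα0 := sub_nonneg.2 M.alpha_le_one
  have hα1 : 1 - M.alpha ≤ 1 := by linarith [M.alpha_pos]
  have h : ∀ s ≤ t, |∏ j ∈ Finset.range s, M.keepProb (j + 1)
      - (1 - M.alpha) ^ (s * (s + 1) / 2)| ≤ s * (t * (2 * t / M.m)) := by
    intro s
    induction s with
    | zero => simp
    | succ s ih =>
      intro hs
      have e : (s + 1) * (s + 1 + 1) / 2 = s * (s + 1) / 2 + (s + 1) := by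
        rw [show (s + 1) * (s + 1 + 1) = s * (s + 1) + (s + 1) * 2 by ring,
          Nat.add_mul_div_right _ _ (by norm_num)]
      rw [Finset.prod_range_succ, e, pow_add]
      refine (abs_mul_sub_mul_le (Finset.prod_nonneg fun j _ => (keepProb_mem_Icc _).1)
        (Finset.prod_le_one (fun j _ => (keepProb_mem_Icc _).1) fun j _ => (keepProb_mem_Icc _).2)
        (pow_nonneg hα0 _) (pow_le_one₀ hα0 hα1)).trans ?_
      have h1 := ih (by omega)
      have h2 := abs_keepProb_sub_le htm hs
      have h3 : ((s + 1 : ℕ) : ℝ) * (2 * t / M.m) ≤ t * (2 * t / M.m) := by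
        have : ((s + 1 : ℕ) : ℝ) ≤ t := by exact_mod_cast hs
        gcongr
      push_cast at h2 h3 ⊢
      linarith
  refine (h t le_rfl).trans (le_of_eq ?_)
  ring

/-! ### The three estimates for typical initial conditions -/

theorem conf_nonempty : Nonempty M.Conf := by
  have hc : Fintype.card M.HalfEdge = Fintype.card (Fin M.m ⊕ Fin M.m) := by
    rw [card_halfEdge, ell_eq, Fintype.card_sum, Fintype.card_fin, two_mul]
  obtain ⟨e⟩ := Fintype.card_eq.1 hc
  refine ⟨⟨(e.trans (Equiv.sumComm _ _)).trans e.symm, fun x => by simp, fun x hx => ?_⟩⟩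
  have h : (e x).swap = e x := by
    have := congrArg e hx
    simpa using this
  cases hex : e x <;> simp [hex] at h

theorem initMeasure_le_one (S : Set (M.Conf × M.HalfEdge)) : M.initMeasure S ≤ 1 := by
  rw [initMeasure, ← Set.ncard_univ]
  refine div_le_one_of_le₀ ?_ (Nat.cast_nonneg _)
  exact_mod_cast Set.ncard_le_ncard (Set.subset_univ S)

theorem card_conf_prod : (Nat.card (M.Conf × M.HalfEdge) : ℝ) = Fintype.card M.Conf * M.ell := by
  rw [Nat.card_eq_fintype_card, Fintype.card_prod, card_halfEdge, Nat.cast_mul]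

theorem ncard_mul_le_sum {Ω : Type*} [Fintype Ω] {f : Ω → ℝ} (hf : ∀ p, 0 ≤ f p) {a : ℝ}
    (ha : 0 ≤ a) {B : Set Ω} (hB : ∀ p ∈ B, a ≤ f p) : (B.ncard : ℝ) * a ≤ ∑ p, f p := by
  classical
  have hsub : B ⊆ (Finset.univ.filter fun p => a ≤ f p : Finset Ω) := fun p hp => by
    simpa using hB p hp
  have hcard_le := Set.ncard_le_ncard hsub (Finset.finite_toSet _)
  rw [Set.ncard_coe_finset] at hcard_le
  refine (mul_le_mul_of_nonneg_right (Nat.cast_le.2 hcard_le) ha).trans ?_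
  rw [← nsmul_eq_mul]
  exact (Finset.card_nsmul_le_sum _ f a fun p hp => (Finset.mem_filter.1 hp).2).trans
    (Finset.sum_le_univ_sum_of_nonneg hf)

/-- Markov's inequality for uniform initial conditions. -/
theorem one_sub_le_initMeasure {f : M.Conf → M.HalfEdge → ℝ} (hf : ∀ η x, 0 ≤ f η x) {a : ℝ}
    (ha : 0 < a) (hsum : ∑ η, ∑ x, f η x ≤ Fintype.card M.Conf * M.ell * a ^ 2)
    {S : Set (M.Conf × M.HalfEdge)} (hS : ∀ η x, f η x ≤ a → (η, x) ∈ S) :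
    1 - a ≤ M.initMeasure S := by
  classical
  have hne := conf_nonempty (M := M)
  have hcard : (0 : ℝ) < Fintype.card M.Conf * M.ell := by
    have h1 : 0 < Fintype.card M.Conf := Fintype.card_pos
    have h2 := M.ell_pos
    positivity
  have hcompl : (Sᶜ.ncard : ℝ) * a ≤ ∑ p : M.Conf × M.HalfEdge, f p.1 p.2 := by
    refine ncard_mul_le_sum (f := fun p : M.Conf × M.HalfEdge => f p.1 p.2) (fun p => hf p.1 p.2)
      ha.le fun p hp => ?_
    by_contra h
    exact hp (hS p.1 p.2 (not_le.1 h).le)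
  rw [Fintype.sum_prod_type] at hcompl
  have hle : (Sᶜ.ncard : ℝ) ≤ Fintype.card M.Conf * M.ell * a := by
    refine le_of_mul_le_mul_right ?_ ha
    calc (Sᶜ.ncard : ℝ) * a ≤ _ := hcompl.trans hsum
      _ = _ := by ring
  have hadd : (S.ncard : ℝ) + Sᶜ.ncard = Fintype.card M.Conf * M.ell := by
    rw [← card_conf_prod]
    exact_mod_cast Set.ncard_add_ncard_compl S
  rw [initMeasure, card_conf_prod, le_div_iff₀ hcard]
  linarith

variable (M) in
/-- Bound for the mean over uniform initial conditions of the errors at time `t`. -/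
noncomputable def meanErr (t : ℕ) : ℝ :=
  t ^ 4 * (104 + 32 * M.nu) / (M.alpha ^ 2 * M.ell)
    + (2 * M.nu + 3) ^ t * (2 * (M.nu + 1)) / M.ell + t ^ 2 * (4 * M.nu + 6) / M.ell

theorem meanErr_pos (t : ℕ) : 0 < M.meanErr t := by
  have h1 := M.ell_pos
  have h2 := M.nu_nonneg
  have h3 := M.alpha_pos
  unfold meanErr
  positivity

/-- Markov's inequality for the sum of the three random errors, at level `√meanErr`, so that the
error and the exceptional probability are both at most `√meanErr`. The term `2t³/m` is deterministic
and comes from replacing the product of `keepProb` by a power. -/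
theorem one_sub_sqrt_meanErr_le {t : ℕ} (hL : 4 * t ≤ M.ell) :
    1 - √(M.meanErr t) ≤ M.initMeasure {p : M.Conf × M.HalfEdge |
      (1 ≤ t → tvDist (M.condLaw p.1 p.2 t {w | Path.tau w ≤ (t : ℕ∞)}) M.unif
        ≤ √(M.meanErr t) + 2 * t ^ 3 / M.m) ∧
      (0 < M.prob p.1 p.2 t {w | (t : ℕ∞) < Path.tau w} →
        1 - (√(M.meanErr t) + 2 * t ^ 3 / M.m)
          ≤ tvDist (M.condLaw p.1 p.2 t {w | (t : ℕ∞) < Path.tau w}) M.unif) ∧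
      |M.prob p.1 p.2 t {w | (t : ℕ∞) < Path.tau w} - (1 - M.alpha) ^ (t * (t + 1) / 2)|
        ≤ √(M.meanErr t) + 2 * t ^ 3 / M.m} := by
  have hell : (0 : ℝ) < M.ell := by exact_mod_cast M.ell_pos
  have hα := M.alpha_pos
  have hm : (0 : ℝ) < M.m := by exact_mod_cast M.m_pos
  have hPs : ∀ P ∈ List.replicate t (1 : Module.End ℝ (M.Conf → ℝ)), IsMarkov P := by
    intro P hP
    rw [List.eq_of_mem_replicate hP]
    exact IsMarkov.one'
  have hrev := fun (η : M.Conf) (x : M.HalfEdge) => (revisit_mem_Icc hPs {x.1} η x).1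
  have hmix : ∀ η : M.Conf, 0 ≤ mixErr t η / M.alpha := fun η => by
    have := mixErr_nonneg t η
    positivity
  have hmin : ∀ (η : M.Conf) (x : M.HalfEdge), 0 ≤ min 1 (2 * ((ball η x t).card : ℝ) / M.ell) :=
    fun η x => le_min zero_le_one (by positivity)
  have hdet : (0 : ℝ) ≤ 2 * t ^ 3 / M.m := by positivity
  refine one_sub_le_initMeasure
    (f := fun η x => mixErr t η / M.alpha + min 1 (2 * ((ball η x t).card : ℝ) / M.ell)
      + revisit (List.replicate t 1) {x.1} η x)
    (fun η x => add_nonneg (add_nonneg (hmix η) (hmin η x)) (hrev η x))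
    (Real.sqrt_pos.2 (meanErr_pos t)) ?_ ?_
  · rw [Real.sq_sqrt (meanErr_pos t).le]
    have h1 := sum_mixErr_le (M := M) t
    have h2 := sum_min_ball_le (M := M) t
    have h3 := sum_revisit_le hPs (L := t) (by simp)
    rw [List.length_replicate] at h3
    have h4 : ∑ η : M.Conf, ∑ _x : M.HalfEdge, mixErr t η / M.alpha
        = M.ell / M.alpha * ∑ η : M.Conf, mixErr t η := by
      simp only [Finset.sum_const, Finset.card_univ, card_halfEdge, nsmul_eq_mul, Finset.mul_sum]
      exact Finset.sum_congr rfl fun η _ => by ring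
    have h5 : M.ell / M.alpha * ∑ η : M.Conf, mixErr t η
        ≤ M.ell / M.alpha
          * (Fintype.card M.Conf * (t ^ 4 * (104 + 32 * M.nu) / (M.alpha * M.ell))) := by
      gcongr
    simp only [Finset.sum_add_distrib, h4]
    refine (add_le_add (add_le_add h5 h2) h3).trans (le_of_eq ?_)
    rw [meanErr]
    field_simp
  · intro η x hle
    have hrevx := hrev η x
    have hmixx := hmix η
    have hminx := hmin η x
    refine ⟨fun ht => ?_, fun hpos => ?_, ?_⟩
    · refine (tvDist_condLaw_le η x ht hL).trans ?_
      linarith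
    · refine le_trans ?_ (le_tvDist_condLaw η x t hpos)
      -- The truncation is harmless, since this proportion never exceeds `1`.
      have hb : ((ball η x t).card : ℝ) / M.ell
          ≤ min 1 (2 * ((ball η x t).card : ℝ) / M.ell) := by
        refine le_min ?_ ?_
        · refine div_le_one_of_le₀ ?_ hell.le
          rw [← card_halfEdge]
          exact_mod_cast Finset.card_le_univ _
        · gcongr
          linarith [(Nat.cast_nonneg (ball η x t).card : (0 : ℝ) ≤ _)]
      linarith
    · have htm : 2 * t ≤ M.m := by
        have := M.ell_eq
        omega
      have h1 := abs_prob_tau_gt_sub_le η x t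
      have h2 := abs_prod_keepProb_sub_le (M := M) htm
      refine (abs_sub_le _ (∏ j ∈ Finset.range t, M.keepProb (j + 1)) _).trans ?_
      linarith

/-! ### Asymptotics -/

variable (M) in
theorem le_m : n ≤ M.m := by
  have h : 2 * n ≤ M.ell := by
    have := Finset.sum_le_sum fun (v : Fin n) (_ : v ∈ Finset.univ) => M.two_le_d v
    simp only [Finset.sum_const, Finset.card_univ, Fintype.card_fin, smul_eq_mul] at this
    unfold ell
    omega
  have := M.ell_eq
  omega

/-- Here `ℓ ≥ n = e^l`, `1/α² ≤ l⁴` and `(2ν + 3)^t ≤ e^(l/2)`, so each term retains a factor at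
most `e^(-l/2)` against powers of `l`. -/
theorem meanErr_le {t : ℕ} {C l : ℝ} (hn : 0 < n) (hl : Real.log n = l) (hν : M.nu ≤ C)
    (htl : (t : ℝ) ≤ l) (htC : (t : ℝ) * Real.log (2 * C + 3) ≤ l / 2) (hα : 1 ≤ M.alpha * l ^ 2) :
    M.meanErr t ≤ (104 + 32 * C) * (l ^ 8 * Real.exp (-l))
      + 2 * (C + 1) * Real.exp (-(l / 2)) + (4 * C + 6) * (l ^ 2 * Real.exp (-l)) := by
  have hn' : (0 : ℝ) < n := by exact_mod_cast hn
  have hexp : Real.exp l = n := by rw [← hl, Real.exp_log hn']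
  have hnell : Real.exp l ≤ M.ell := by
    rw [hexp]
    have h1 := M.le_m
    have h2 := M.ell_eq
    exact_mod_cast (by omega : n ≤ M.ell)
  have hν0 := M.nu_nonneg
  have hC0 : 0 ≤ C := hν0.trans hν
  have hα0 := M.alpha_pos
  have hell : (0 : ℝ) < M.ell := by exact_mod_cast M.ell_pos
  have ht0 : (0 : ℝ) ≤ t := Nat.cast_nonneg t
  have hl0 : 0 ≤ l := ht0.trans htl
  have hinv : 1 / (M.ell : ℝ) ≤ Real.exp (-l) := by
    rw [Real.exp_neg, ← one_div]
    exact one_div_le_one_div_of_le (Real.exp_pos l) hnell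
  have hinvα : 1 / M.alpha ^ 2 ≤ l ^ 4 := by
    rw [div_le_iff₀ (by positivity)]
    nlinarith
  have hpow : (2 * M.nu + 3) ^ t ≤ Real.exp (l / 2) := by
    calc (2 * M.nu + 3) ^ t ≤ (2 * C + 3) ^ t := by gcongr
      _ = Real.exp (t * Real.log (2 * C + 3)) := by
        rw [Real.exp_nat_mul, Real.exp_log (by positivity)]
      _ ≤ _ := Real.exp_le_exp.2 htC
  have hhalf : Real.exp (l / 2) * Real.exp (-l) = Real.exp (-(l / 2)) := by
    rw [← Real.exp_add]
    congr 1
    ring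
  rw [meanErr]
  refine add_le_add (add_le_add ?_ ?_) ?_
  · calc t ^ 4 * (104 + 32 * M.nu) / (M.alpha ^ 2 * M.ell)
        = t ^ 4 * (104 + 32 * M.nu) * (1 / M.alpha ^ 2) * (1 / M.ell) := by field_simp
      _ ≤ l ^ 4 * (104 + 32 * C) * l ^ 4 * Real.exp (-l) := by gcongr
      _ = _ := by ring
  · calc (2 * M.nu + 3) ^ t * (2 * (M.nu + 1)) / M.ell
        = (2 * M.nu + 3) ^ t * (2 * (M.nu + 1)) * (1 / M.ell) := by ring
      _ ≤ Real.exp (l / 2) * (2 * (C + 1)) * Real.exp (-l) := by gcongr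
      _ = _ := by
        rw [← hhalf]
        ring
  · calc t ^ 2 * (4 * M.nu + 6) / M.ell = t ^ 2 * (4 * M.nu + 6) * (1 / M.ell) := by ring
      _ ≤ l ^ 2 * (4 * C + 6) * Real.exp (-l) := by gcongr
      _ = _ := by ring

theorem two_mul_cube_div_le {t : ℕ} {l : ℝ} (hn : 0 < n) (hl : Real.log n = l)
    (htl : (t : ℝ) ≤ l) : 2 * (t : ℝ) ^ 3 / M.m ≤ 2 * (l ^ 3 * Real.exp (-l)) := by
  have hn' : (0 : ℝ) < n := by exact_mod_cast hn
  have hnm : (n : ℝ) ≤ M.m := by exact_mod_cast M.le_m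
  have hl0 : 0 ≤ l := (Nat.cast_nonneg t).trans htl
  rw [Real.exp_neg, ← hl, Real.exp_log hn', hl, ← div_eq_mul_inv, mul_div_assoc]
  gcongr

theorem four_mul_le_ell {t : ℕ} (hn : 0 < n) (htl : (t : ℝ) ≤ Real.log n) : 4 * t ≤ M.ell := by
  have hn' : (0 : ℝ) < n := by exact_mod_cast hn
  have h1 : 2 * (t : ℝ) ≤ n := by
    -- With `x = log n / 2`, the bound is `n = (e^x)² ≥ (1 + x)² ≥ 4x ≥ 2t`.
    have h := Real.add_one_le_exp (Real.log n / 2)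
    have h2 : Real.exp (Real.log n / 2) * Real.exp (Real.log n / 2) = n := by
      rw [← Real.exp_add, add_halves, Real.exp_log hn']
    have h0 : (0 : ℝ) ≤ t := Nat.cast_nonneg t
    nlinarith [sq_nonneg (1 - Real.log n / 2)]
  have h2 : 2 * t ≤ n := by exact_mod_cast h1
  have h3 := M.le_m
  have h4 := M.ell_eq
  omega

end DynConfModel

/-- The models are indexed by `i`, the `i`-th one having `N i` vertices with `N i → ∞`. -/
theorem mainTheorem2
    (N : ℕ → ℕ) (hN : Tendsto N atTop atTop)
    (M : ∀ i, DynConfModel (N i))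
    (hR1 : (fun i => ((M i).ell : ℝ)) =Θ[atTop] fun i => (N i : ℝ))
    (hR2 : IsBoundedUnder (· ≤ ·) atTop fun i => (M i).nu)
    (hfast : Tendsto (fun i => (M i).alpha * Real.log (N i) ^ 2) atTop atTop)
    (t : ℕ → ℕ) (ht : (fun i => (t i : ℝ)) =o[atTop] fun i => Real.log (N i)) :
    ∃ ε : ℕ → ℝ, Tendsto ε atTop (𝓝 0) ∧
      Tendsto (fun i => (M i).initMeasure {p : (M i).Conf × (M i).HalfEdge |
        (1 ≤ t i →
          tvDist ((M i).condLaw p.1 p.2 (t i) {w | DynConfModel.Path.tau w ≤ t i}) (M i).unif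
            ≤ ε i) ∧
        (0 < (M i).prob p.1 p.2 (t i) {w | t i < DynConfModel.Path.tau w} →
          1 - ε i ≤
            tvDist ((M i).condLaw p.1 p.2 (t i) {w | t i < DynConfModel.Path.tau w})
              (M i).unif) ∧
        |(M i).prob p.1 p.2 (t i) {w | t i < DynConfModel.Path.tau w}
            - (1 - (M i).alpha) ^ (t i * (t i + 1) / 2)| ≤ ε i}) atTop (𝓝 1) := by
  obtain ⟨C, hC⟩ := hR2
  rw [Filter.eventually_map] at hC
  have hlog : Tendsto (fun i => Real.log (N i)) atTop atTop :=
    Real.tendsto_log_atTop.comp (tendsto_natCast_atTop_atTop.comp hN)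
  have hN0 : ∀ᶠ i in atTop, 0 < N i := hN.eventually_gt_atTop 0
  have hlog0 : ∀ᶠ i in atTop, 0 < Real.log (N i) := hlog.eventually_gt_atTop 0
  have hα : ∀ᶠ i in atTop, 1 ≤ (M i).alpha * Real.log (N i) ^ 2 := hfast.eventually_ge_atTop 1
  have hto : ∀ c : ℝ, 0 < c → ∀ᶠ i in atTop, (t i : ℝ) ≤ c * Real.log (N i) := by
    intro c hc
    filter_upwards [ht.bound hc, hlog0] with i hi hi0
    rwa [Real.norm_of_nonneg (Nat.cast_nonneg _), Real.norm_of_nonneg hi0.le] at hi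
  have htl : ∀ᶠ i in atTop, (t i : ℝ) ≤ Real.log (N i) := by
    simpa only [one_mul] using hto 1 one_pos
  have htC : ∀ᶠ i in atTop, (t i : ℝ) * Real.log (2 * C + 3) ≤ Real.log (N i) / 2 := by
    -- A positive upper bound for the logarithm is needed, as `1/(2a)` serves as the constant in `t
    -- = o(log n)`.
    obtain ⟨a, ha, haC⟩ : ∃ a : ℝ, 0 < a ∧ Real.log (2 * C + 3) ≤ a :=
      ⟨max 1 (Real.log (2 * C + 3)), by positivity, le_max_right _ _⟩
    filter_upwards [hto (1 / (2 * a)) (by positivity)] with i hi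
    calc (t i : ℝ) * Real.log (2 * C + 3) ≤ t i * a := by gcongr
      _ ≤ 1 / (2 * a) * Real.log (N i) * a := by gcongr
      _ = _ := by field_simp
  have hexp : ∀ r : ℕ, Tendsto (fun i => Real.log (N i) ^ r * Real.exp (-Real.log (N i))) atTop
      (𝓝 0) := fun r => (Real.tendsto_pow_mul_exp_neg_atTop_nhds_zero r).comp hlog
  have hexp2 : Tendsto (fun i => Real.exp (-(Real.log (N i) / 2))) atTop (𝓝 0) :=
    Real.tendsto_exp_neg_atTop_nhds_zero.comp (hlog.atTop_div_const two_pos)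
  have hmean : Tendsto (fun i => (M i).meanErr (t i)) atTop (𝓝 0) := by
    have hlim := (((hexp 8).const_mul (104 + 32 * C)).add (hexp2.const_mul (2 * (C + 1)))).add
      ((hexp 2).const_mul (4 * C + 6))
    simp only [mul_zero, add_zero] at hlim
    refine tendsto_of_tendsto_of_tendsto_of_le_of_le' tendsto_const_nhds hlim
      (Eventually.of_forall fun i => (DynConfModel.meanErr_pos (t i)).le) ?_
    filter_upwards [hN0, hC, htl, htC, hα] with i h1 h2 h3 h4 h5
    exact DynConfModel.meanErr_le h1 rfl h2 h3 h4 h5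
  have hsqrt : Tendsto (fun i => √((M i).meanErr (t i))) atTop (𝓝 0) := by
    simpa only [Real.sqrt_zero] using hmean.sqrt
  have hcube : Tendsto (fun i => 2 * (t i : ℝ) ^ 3 / (M i).m) atTop (𝓝 0) := by
    have hlim := (hexp 3).const_mul 2
    rw [mul_zero] at hlim
    refine tendsto_of_tendsto_of_tendsto_of_le_of_le' tendsto_const_nhds hlim
      (Eventually.of_forall fun i => by positivity) ?_
    filter_upwards [hN0, htl] with i h1 h2
    exact DynConfModel.two_mul_cube_div_le h1 rfl h2
  refine ⟨fun i => √((M i).meanErr (t i)) + 2 * (t i : ℝ) ^ 3 / (M i).m, ?_, ?_⟩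
  · simpa only [add_zero] using hsqrt.add hcube
  · have hlim : Tendsto (fun i => 1 - √((M i).meanErr (t i))) atTop (𝓝 1) := by
      simpa only [sub_zero] using hsqrt.const_sub 1
    refine tendsto_of_tendsto_of_tendsto_of_le_of_le' hlim tendsto_const_nhds ?_
      (Eventually.of_forall fun i => DynConfModel.initMeasure_le_one _)
    filter_upwards [hN0, htl] with i h1 h2
    exact DynConfModel.one_sub_sqrt_meanErr_le (DynConfModel.four_mul_le_ell h1 h2)
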